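/- **Setting.** Let $\mathcal A$ be a unital complex $*$-algebra and $(\mathcal A,\mathcal H,D)$ a spectral triple ($\mathcal A$ acts on $\mathcal H$ by bounded operators through a unital $*$-representation, $D$ is self-adjoint with compact resolvent, all $[D,a]$ are bounded) with an orthonormal basis $(\varphi_i)$ of eigenvectors, $D\varphi_i=\lambda_i\varphi_i$. Write $V_{ij}=\langle\varphi_i,V\varphi_j\rangle$ and let $\mathcal M$ be the linear span of the operators $|\varphi_i\rangle\langle\varphi_j|$. Fix a cutoff $N\in\mathbb N$ with $N$ basis vectors $\varphi_1,\dots,\varphi_N$, let $H_N$ be the space of Hermitian elements of $\operatorname{span}\{|\varphi_i\rangle\langle\varphi_j|: i,j\le N\}$ with Lebesgue measure in the coordinates $\operatorname{Re}Q_{ij}$ ($i\le j$), $\operatorname{Im}Q_{ij}$ ($i<j$), and let $f\in C^\infty(\mathbb R,\mathbb C)$ satisfy $f'[\lambda_k,\lambda_l]>0$ for $k,l\le N$, where $g[x_0,\dots,x_n]$ denotes divided differences. Assume that $a[D,b]\in\mathcal M$ for all $a,b\in\mathcal A$ and that $\operatorname{span}\{\varphi_1,\dots,\varphi_N\}$ is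 invariant under $\mathcal A$. (Both hold automatically if $\dim\mathcal H=N$.) Put, for $V_j\in\mathcal M$, $$\langle V_1,\dots,V_n\rangle=\sum_{i_1,\dots,i_n}f'[\lambda_{i_1},\dots,\lambda_{i_n}](V_1)_{i_1i_2}\cdots(V_n)_{i_ni_1}.$$ A noncommutative Feynman diagram is a finite multigraph with $n$ marked external edges whose internal vertices carry a cyclic (clockwise) order of the incident edges. Its amplitude $\Gamma^G_N(V_1,\dots,V_n)$ is obtained from the product of the brackets of its vertices by inserting its internal edges one by one; inserting an edge means putting the same $Q\in H_N$ on both of its ends and applying $\Phi\mapsto-\int_{H_N}\Phi(Q)e^{-\frac12\langle Q,Q\rangle}dQ\big/\int_{H_N}e^{-\frac12\langle Q,Q\rangle}dQ$. A diagram is relevant if it is planar with clockwise vertices, connected, one-loop ($1-\#\text{vertices}+\#\text{internal edges}=1$) and one-particle-irreducible (it stays connected when any internal edge is removed), has all vertices of degree $\ge3$, and has all external edges outside the loop and marked $1,\dots,n$ in clockwise cyclic order. The one-loop bracket is $$\langle\!\langle V_1,\dots,V_n\rangle\!\rangle_N=\sum_G\Gamma_N^G(V_1,\dots,V_n),$$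 the sum over isomorphism classes of relevant $n$-point diagrams. The one-loop quantum effective spectral action is the formal series $\sum_{n\ge1}\frac1n\langle\!\langle V,\dots,V\rangle\!\rangle_N$. Let $\Omega(\mathcal A)$ be the algebra of universal forms. A Hochschild $n$-cochain is an $(n+1)$-linear functional $\phi$ on $\mathcal A$ that vanishes when $a_j=1$ for some $j\ge1$, and $\int_\phi a_0\,da_1\cdots da_n:=\phi(a_0,\dots,a_n)$. With $b$ the Hochschild coboundary, $B_0\phi(a_0,\dots,a_n)=\phi(1,a_0,\dots,a_n)$ and $B\phi(a_0,\dots,a_n)=\sum_{j=0}^n(-1)^{nj}\phi(1,a_j,a_{j+1},\dots,a_{j-1})$, an odd $(b,B)$-cocycle is a sequence $(\psi_1,\psi_3,\dots)$ of cochains with $b\psi_{n}+B\psi_{n+2}=0$ and $B\psi_1=0$; an even one is a sequence $(\phi_0,\phi_2,\dots)$ with $b\phi_n+B\phi_{n+2}=0$. Define $\phi^N_0=0$ and, for $n,k\ge1$, $$\phi_n^N(a_0,\dots,a_n)=\langle\!\langle a_0[D,a_1],[D,a_2],\dots,[D,a_n]\rangle\!\rangle_N,$$ $$\psi^N_{2k-1}=\phi^N_{2k-1}-\tfrac12B_0\phi^N_{2k},\qquad\tilde\psi^N_{2k-1}=(-1)^{k-1}\tfrac{(k-1)!}{(2k-1)!}\psi^N_{2k-1}.$$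 For a one-form $A=\sum_ja_j\,db_j\in\Omega^1(\mathcal A)$ let $V=\sum_ja_j[D,b_j]$, $F=dA+A^2$ and $\mathrm{cs}_{2k-1}(A)=\int_0^1A\,(t\,dA+t^2A^2)^{k-1}\,dt$. **Theorem.** 1. For $k,l,m,n\le N$ the normalized Gaussian integral of $Q_{kl}Q_{mn}$ over $H_N$ with weight $e^{-\frac12\langle Q,Q\rangle}$ equals $\delta_{kn}\delta_{lm}G_{kl}$ with $G_{kl}=1/f'[\lambda_k,\lambda_l]$. 2. For each $n$ there are finitely many isomorphism classes of relevant $n$-point diagrams, and isomorphic relevant diagrams have the same amplitude. For $V_1,\dots,V_n\in\mathcal M$ one has $\langle\!\langle V_2,\dots,V_n,V_1\rangle\!\rangle_N=\langle\!\langle V_1,\dots,V_n\rangle\!\rangle_N$, and for $n\ge1$ and $a\in\mathcal A$ the quantum Ward identity $$\langle\!\langle aV_1,V_2,\dots,V_n\rangle\!\rangle_N-\langle\!\langle V_1,\dots,V_{n-1},V_na\rangle\!\rangle_N=\langle\!\langle V_1,\dots,V_n,[D,a]\rangle\!\rangle_N .$$ 3. The $\phi^N_n$ are Hochschild cochains,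 $b\phi^N_{2k}=0$ for every $k$, $(\phi^N_{2k})_{k\ge0}$ is an even $(b,B)$-cocycle and $(\tilde\psi^N_{2k-1})_{k\ge1}$ is an odd $(b,B)$-cocycle. 4. For every one-form $A$, $$\sum_{n=1}^\infty\frac1n\langle\!\langle V,\dots,V\rangle\!\rangle_N\sim\sum_{k=1}^\infty\Big(\int_{\psi^N_{2k-1}}\mathrm{cs}_{2k-1}(A)+\frac1{2k}\int_{\phi^N_{2k}}F^k\Big),$$ which means: for every $K\in\mathbb N$ there are forms $\omega_l\in\Omega^l(\mathcal A)$, $K+1\le l\le2K+1$, such that $$\sum_{n=1}^K\frac1n\langle\!\langle V,\dots,V\rangle\!\rangle_N-\sum_{k=1}^K\Big(\int_{\psi^N_{2k-1}}\mathrm{cs}_{2k-1}(A)+\frac1{2k}\int_{\phi^N_{2k}}F^k\Big)=\sum_{l=K+1}^{2K+1}\int_{\phi^N_l}\omega_l .$$ The forms $\omega_l$ can be chosen to depend only on $\mathcal A$, on the elements $a_j,b_j$ with $A=\sum_ja_j\,db_j$, and on $K$, not on the spectral triple, its eigenbasis, $N$ or $f$. -/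

import Mathlib

open scoped TensorProduct BigOperators

namespace OneLoop

noncomputable section

/-! ### Universal differential forms

`Forms 𝒜` is the universal differential graded algebra `Ω(𝒜)` of a unital complex algebra:
it is generated by the algebra `𝒜` and by symbols `da` that are linear in `a` and satisfy
`d(ab) = a db + da b` (so that `d1 = 0`). -/

/-- The relations of `Ω(𝒜)`; `Sum.inl a` stands for `a` and `Sum.inr a` for `da`. -/
inductive FormRel (𝒜 : Type*) [Ring 𝒜] [Algebra ℂ 𝒜] :
    FreeAlgebra ℂ (𝒜 ⊕ 𝒜) → FreeAlgebra ℂ (𝒜 ⊕ 𝒜) → Prop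
  | one : FormRel 𝒜 (FreeAlgebra.ι ℂ (Sum.inl 1)) 1
  | add (a b : 𝒜) : FormRel 𝒜 (FreeAlgebra.ι ℂ (Sum.inl (a + b)))
      (FreeAlgebra.ι ℂ (Sum.inl a) + FreeAlgebra.ι ℂ (Sum.inl b))
  | smul (c : ℂ) (a : 𝒜) : FormRel 𝒜 (FreeAlgebra.ι ℂ (Sum.inl (c • a)))
      (c • FreeAlgebra.ι ℂ (Sum.inl a))
  | mul (a b : 𝒜) : FormRel 𝒜 (FreeAlgebra.ι ℂ (Sum.inl (a * b)))
      (FreeAlgebra.ι ℂ (Sum.inl a) * FreeAlgebra.ι ℂ (Sum.inl b))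
  | d_add (a b : 𝒜) : FormRel 𝒜 (FreeAlgebra.ι ℂ (Sum.inr (a + b)))
      (FreeAlgebra.ι ℂ (Sum.inr a) + FreeAlgebra.ι ℂ (Sum.inr b))
  | d_smul (c : ℂ) (a : 𝒜) : FormRel 𝒜 (FreeAlgebra.ι ℂ (Sum.inr (c • a)))
      (c • FreeAlgebra.ι ℂ (Sum.inr a))
  | leibniz (a b : 𝒜) : FormRel 𝒜 (FreeAlgebra.ι ℂ (Sum.inr (a * b)))
      (FreeAlgebra.ι ℂ (Sum.inl a) * FreeAlgebra.ι ℂ (Sum.inr b) +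
        FreeAlgebra.ι ℂ (Sum.inr a) * FreeAlgebra.ι ℂ (Sum.inl b))

/-- The algebra `Ω(𝒜)` of universal differential forms. -/
def Forms (𝒜 : Type*) [Ring 𝒜] [Algebra ℂ 𝒜] : Type _ := RingQuot (FormRel 𝒜)

instance (𝒜 : Type*) [Ring 𝒜] [Algebra ℂ 𝒜] : Ring (Forms 𝒜) :=
  inferInstanceAs (Ring (RingQuot (FormRel 𝒜)))

instance (𝒜 : Type*) [Ring 𝒜] [Algebra ℂ 𝒜] : Algebra ℂ (Forms 𝒜) :=
  inferInstanceAs (Algebra ℂ (RingQuot (FormRel 𝒜)))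

section Forms

variable {𝒜 : Type*} [Ring 𝒜] [Algebra ℂ 𝒜]

variable (𝒜) in
/-- The quotient map onto `Ω(𝒜)`. -/
def Forms.mk : FreeAlgebra ℂ (𝒜 ⊕ 𝒜) →ₐ[ℂ] Forms 𝒜 := RingQuot.mkAlgHom ℂ (FormRel 𝒜)

theorem Forms.mk_rel {x y : FreeAlgebra ℂ (𝒜 ⊕ 𝒜)} (h : FormRel 𝒜 x y) :
    Forms.mk 𝒜 x = Forms.mk 𝒜 y := RingQuot.mkAlgHom_rel ℂ h

/-- The universal property of `Ω(𝒜)` as an algebra. -/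
def Forms.lift {R : Type*} [Ring R] [Algebra ℂ R] (g : FreeAlgebra ℂ (𝒜 ⊕ 𝒜) →ₐ[ℂ] R)
    (hg : ∀ ⦃x y⦄, FormRel 𝒜 x y → g x = g y) : Forms 𝒜 →ₐ[ℂ] R :=
  RingQuot.liftAlgHom ℂ ⟨g, hg⟩

theorem Forms.lift_mk {R : Type*} [Ring R] [Algebra ℂ R] (g : FreeAlgebra ℂ (𝒜 ⊕ 𝒜) →ₐ[ℂ] R)
    (hg : ∀ ⦃x y⦄, FormRel 𝒜 x y → g x = g y) (x : FreeAlgebra ℂ (𝒜 ⊕ 𝒜)) :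
    Forms.lift g hg (Forms.mk 𝒜 x) = g x :=
  RingQuot.liftAlgHom_mkAlgHom_apply ℂ g hg x

/-- The element `a ∈ 𝒜` as a form of degree zero. -/
def Forms.of (a : 𝒜) : Forms 𝒜 := Forms.mk 𝒜 (FreeAlgebra.ι ℂ (Sum.inl a))

/-- The one-form `da`. -/
def Forms.dOf (a : 𝒜) : Forms 𝒜 := Forms.mk 𝒜 (FreeAlgebra.ι ℂ (Sum.inr a))

theorem Forms.of_one : Forms.of (1 : 𝒜) = 1 := by
  simpa [Forms.of] using Forms.mk_rel (FormRel.one (𝒜 := 𝒜))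

theorem Forms.of_add (a b : 𝒜) : Forms.of (a + b) = Forms.of a + Forms.of b := by
  simpa [Forms.of] using Forms.mk_rel (FormRel.add a b)

theorem Forms.of_smul (c : ℂ) (a : 𝒜) : Forms.of (c • a) = c • Forms.of a := by
  simpa [Forms.of] using Forms.mk_rel (FormRel.smul c a)

theorem Forms.of_mul (a b : 𝒜) : Forms.of (a * b) = Forms.of a * Forms.of b := by
  simpa [Forms.of] using Forms.mk_rel (FormRel.mul a b)

theorem Forms.dOf_add (a b : 𝒜) : Forms.dOf (a + b) = Forms.dOf a + Forms.dOf b := by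
  simpa [Forms.dOf] using Forms.mk_rel (FormRel.d_add a b)

theorem Forms.dOf_smul (c : ℂ) (a : 𝒜) : Forms.dOf (c • a) = c • Forms.dOf a := by
  simpa [Forms.dOf] using Forms.mk_rel (FormRel.d_smul c a)

theorem Forms.dOf_mul (a b : 𝒜) :
    Forms.dOf (a * b) = Forms.of a * Forms.dOf b + Forms.dOf a * Forms.of b := by
  simpa [Forms.of, Forms.dOf] using Forms.mk_rel (FormRel.leibniz a b)

/-- The monomial form `a₀ da₁ ⋯ daₙ`. -/
def Forms.monomial {n : ℕ} (a : Fin (n + 1) → 𝒜) : Forms 𝒜 :=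
  Forms.of (a 0) * (List.ofFn fun j : Fin n => Forms.dOf (a j.succ)).prod

variable (𝒜) in
/-- The space `Ωⁿ(𝒜)` of forms of degree `n`, spanned by the monomials `a₀ da₁ ⋯ daₙ`. -/
def Forms.degree (n : ℕ) : Submodule ℂ (Forms 𝒜) :=
  Submodule.span ℂ (Set.range (Forms.monomial (𝒜 := 𝒜) (n := n)))

variable (𝒜) in
/-- The algebra homomorphism `ω ↦ [[γ ω, dω], [0, ω]]`, where `γ` is the parity automorphism,
given on generators by `a ↦ [[a, da], [0, a]]` and `da ↦ [[-da, 0], [0, da]]`. That it is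
multiplicative is the graded Leibniz rule `d(ωη) = dω η + γ(ω) dη`. -/
def Forms.dBlock : Forms 𝒜 →ₐ[ℂ] Matrix (Fin 2) (Fin 2) (Forms 𝒜) :=
  Forms.lift (FreeAlgebra.lift ℂ (Sum.elim
      (fun a => !![Forms.of a, Forms.dOf a; 0, Forms.of a])
      (fun a => !![-Forms.dOf a, 0; 0, Forms.dOf a]))) <| by
    intro x y h
    have h1 : Forms.dOf (1 : 𝒜) = 0 := by
      have := Forms.dOf_mul (1 : 𝒜) 1
      simpa [Forms.of_one] using this
    induction h <;> ext i j <;> fin_cases i <;> fin_cases j <;>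
      simp [Forms.of_one, Forms.of_add, Forms.of_smul, Forms.of_mul, Forms.dOf_add,
        Forms.dOf_smul, Forms.dOf_mul, Matrix.mul_apply, Fin.sum_univ_two, h1] <;> abel

/-- The differential `d : Ω(𝒜) → Ω(𝒜)`. -/
def Forms.d : Forms 𝒜 →ₗ[ℂ] Forms 𝒜 where
  toFun ω := Forms.dBlock 𝒜 ω 0 1
  map_add' _ _ := by simp
  map_smul' _ _ := by simp

theorem Forms.d_of (a : 𝒜) : Forms.d (Forms.of a) = Forms.dOf a := by
  simp [Forms.d, Forms.dBlock, Forms.of, Forms.lift_mk]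

theorem Forms.d_of_mul_dOf (a b : 𝒜) :
    Forms.d (Forms.of a * Forms.dOf b) = Forms.dOf a * Forms.dOf b := by
  simp [Forms.d, Forms.dBlock, Forms.of, Forms.dOf, Forms.lift_mk, Matrix.mul_apply, Fin.sum_univ_two]

/-- The curvature `F = dA + A²`. -/
def curvature (A : Forms 𝒜) : Forms 𝒜 := Forms.d A + A ^ 2

/-- The Chern-Simons form `cs_{2k-1}(A) = ∫₀¹ A (t dA + t² A²)^{k-1} dt` for `k ≥ 1`: the integrand
is a polynomial in `t` with coefficients in `Ω(𝒜)`, and it is integrated term by term. -/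
def chernSimons (k : ℕ) (A : Forms 𝒜) : Forms 𝒜 :=
  (Polynomial.C A * (Polynomial.X * Polynomial.C (Forms.d A) +
      Polynomial.X ^ 2 * Polynomial.C (A ^ 2)) ^ (k - 1)).sum
    fun j c => (1 / ((j : ℂ) + 1)) • c

end Forms

/-! ### Hochschild cochains, the operators `b` and `B`, and integrals of forms -/

section Cochains

variable {𝒜 : Type*} [Ring 𝒜] [Algebra ℂ 𝒜]

/-- Functions of `n + 1` variables in `𝒜`; see `IsHochschildCochain`. -/
abbrev Cochain (𝒜 : Type*) (n : ℕ) : Type _ := (Fin (n + 1) → 𝒜) → ℂ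

/-- `φ ∈ 𝒞ⁿ(𝒜)`: the function `φ` is `(n+1)`-linear and vanishes as soon as `a_j = 1` for some
`j ≥ 1`. -/
def IsHochschildCochain {n : ℕ} (φ : Cochain 𝒜 n) : Prop :=
  (∃ M : MultilinearMap ℂ (fun _ : Fin (n + 1) => 𝒜) ℂ, ∀ a, M a = φ a) ∧
    ∀ (a : Fin (n + 1) → 𝒜) (j : Fin n), a j.succ = 1 → φ a = 0

/-- The Hochschild coboundary `b`. -/
def opb {n : ℕ} (φ : Cochain 𝒜 n) : Cochain 𝒜 (n + 1) := fun a =>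
  (∑ j : Fin (n + 1), (-1 : ℂ) ^ (j : ℕ) * φ (Fin.contractNth j.castSucc (· * ·) a)) +
    (-1 : ℂ) ^ (n + 1) *
      φ (Fin.cons (a (Fin.last (n + 1)) * a 0) fun j : Fin n => a j.succ.castSucc)

/-- The operator `B₀`, `B₀φ(a₀,…,aₙ) = φ(1,a₀,…,aₙ)`. -/
def opB0 {n : ℕ} (φ : Cochain 𝒜 (n + 1)) : Cochain 𝒜 n := fun a => φ (Fin.cons 1 a)

/-- The operator `B`, `Bφ(a₀,…,aₙ) = ∑_j (-1)^{nj} φ(1,a_j,a_{j+1},…,a_{j-1})`. -/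
def opB {n : ℕ} (φ : Cochain 𝒜 (n + 1)) : Cochain 𝒜 n := fun a =>
  ∑ j : Fin (n + 1), (-1 : ℂ) ^ (n * (j : ℕ)) * φ (Fin.cons 1 fun i : Fin (n + 1) => a (i + j))

/-- The odd members of the family `(ψ_n)` form an odd `(b,B)`-cocycle `(ψ_1, ψ_3, …)`. -/
def IsOddCocycle (ψ : (n : ℕ) → Cochain 𝒜 n) : Prop :=
  (∀ n, Odd n → IsHochschildCochain (ψ n)) ∧
    (∀ n, Odd n → opb (ψ n) + opB (ψ (n + 2)) = 0) ∧ opB (ψ 1) = 0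

/-- The even members of the family `(φ_n)` form an even `(b,B)`-cocycle `(φ_0, φ_2, …)`. -/
def IsEvenCocycle (φ : (n : ℕ) → Cochain 𝒜 n) : Prop :=
  (∀ n, Even n → IsHochschildCochain (φ n)) ∧
    ∀ n, Even n → opb (φ n) + opB (φ (n + 2)) = 0

/-- `I` is the linear functional on forms with `I(a₀ da₁ ⋯ daₙ) = φ(a₀,…,aₙ)`, extended by zero
to the forms of other degrees. -/
def IsFormIntegral {n : ℕ} (φ : Cochain 𝒜 n) (I : Forms 𝒜 →ₗ[ℂ] ℂ) : Prop :=
  (∀ a : Fin (n + 1) → 𝒜, I (Forms.monomial a) = φ a) ∧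
    ∀ m, m ≠ n → ∀ a : Fin (m + 1) → 𝒜, I (Forms.monomial a) = 0

theorem exists_proj : ∃ p : 𝒜 →ₗ[ℂ] 𝒜, p 1 = 0 ∧ ∀ a, ∃ c : ℂ, a - p a = c • 1 := by
  obtain ⟨g, hg⟩ := LinearMap.exists_rightInverse_of_surjective
    (Submodule.mkQ (Submodule.span ℂ {(1 : 𝒜)})) (Submodule.range_mkQ _)
  refine ⟨g ∘ₗ Submodule.mkQ _, ?_, fun a => ?_⟩
  · have : (Submodule.mkQ (Submodule.span ℂ {(1 : 𝒜)})) 1 = 0 := by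
      simp [Submodule.mem_span_singleton_self]
    simp only [LinearMap.comp_apply, this, map_zero]
  · have h : (Submodule.mkQ (Submodule.span ℂ {(1 : 𝒜)})) (a - g (Submodule.mkQ _ a)) = 0 := by
      rw [map_sub, sub_eq_zero]
      exact (LinearMap.congr_fun hg _).symm
    rw [Submodule.mkQ_apply, Submodule.Quotient.mk_eq_zero, Submodule.mem_span_singleton] at h
    obtain ⟨c, hc⟩ := h
    exact ⟨c, hc.symm⟩

/-- Multiplication by a linear image: `x ⊗ t ↦ p(x) t`. -/
def shiftMap (p : 𝒜 →ₗ[ℂ] 𝒜) : 𝒜 ⊗[ℂ] TensorAlgebra ℂ 𝒜 →ₗ[ℂ] TensorAlgebra ℂ 𝒜 :=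
  LinearMap.mul' ℂ _ ∘ₗ LinearMap.rTensor _ (TensorAlgebra.ι ℂ ∘ₗ p)

/-- Left multiplication by `b` on forms in the normal form `x ⊗ t`. -/
def leftMul (b : 𝒜) : Module.End ℂ (𝒜 ⊗[ℂ] TensorAlgebra ℂ 𝒜) :=
  LinearMap.rTensor _ (LinearMap.mulLeft ℂ b)

/-- Left multiplication by `db`, using `db x dt = d(bx) dt - b dx dt`. -/
def leftMulD (p : 𝒜 →ₗ[ℂ] 𝒜) (b : 𝒜) : Module.End ℂ (𝒜 ⊗[ℂ] TensorAlgebra ℂ 𝒜) :=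
  TensorProduct.mk ℂ 𝒜 _ 1 ∘ₗ shiftMap p ∘ₗ leftMul b - TensorProduct.mk ℂ 𝒜 _ b ∘ₗ shiftMap p

theorem leftMul_tmul (b x : 𝒜) (t : TensorAlgebra ℂ 𝒜) :
    leftMul b (x ⊗ₜ t) = (b * x) ⊗ₜ t := by simp [leftMul]

theorem leftMulD_tmul (p : 𝒜 →ₗ[ℂ] 𝒜) (b x : 𝒜) (t : TensorAlgebra ℂ 𝒜) :
    leftMulD p b (x ⊗ₜ t) = (1 : 𝒜) ⊗ₜ (TensorAlgebra.ι ℂ (p (b * x)) * t) -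
      b ⊗ₜ (TensorAlgebra.ι ℂ (p x) * t) := by
  simp [leftMulD, leftMul, shiftMap]

/-- The action of forms on normal forms by left multiplication. -/
def formAction (p : 𝒜 →ₗ[ℂ] 𝒜) :
    Forms 𝒜 →ₐ[ℂ] Module.End ℂ (𝒜 ⊗[ℂ] TensorAlgebra ℂ 𝒜) :=
  Forms.lift (FreeAlgebra.lift ℂ (Sum.elim leftMul (leftMulD p))) <| by
    intro x y h
    induction h <;>
      (simp only [map_mul, map_add, map_smul, map_one, FreeAlgebra.lift_ι_apply, Sum.elim_inl,
        Sum.elim_inr]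
       refine TensorProduct.ext' fun x t => ?_
       simp only [leftMul_tmul, leftMulD_tmul, LinearMap.add_apply, LinearMap.smul_apply,
        Module.End.mul_apply, Module.End.one_apply, map_sub, one_mul, mul_one, add_mul,
        smul_mul_assoc, map_add, map_smul, TensorProduct.add_tmul, TensorProduct.tmul_add,
        TensorProduct.smul_tmul', TensorProduct.tmul_smul, smul_sub, mul_assoc]
       try abel)

theorem formAction_of (p : 𝒜 →ₗ[ℂ] 𝒜) (a : 𝒜) : formAction p (Forms.of a) = leftMul a := by
  simp [formAction, Forms.of, Forms.lift_mk]

theorem formAction_dOf (p : 𝒜 →ₗ[ℂ] 𝒜) (a : 𝒜) : formAction p (Forms.dOf a) = leftMulD p a := by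
  simp [formAction, Forms.dOf, Forms.lift_mk]

theorem formAction_prod (p : 𝒜 →ₗ[ℂ] 𝒜) (hp : p 1 = 0) (l : List 𝒜) :
    formAction p (l.map Forms.dOf).prod (1 ⊗ₜ 1) =
      (1 : 𝒜) ⊗ₜ[ℂ] (l.map fun a => TensorAlgebra.ι ℂ (p a)).prod := by
  induction l with
  | nil => simp
  | cons a l ih =>
    rw [List.map_cons, List.prod_cons, map_mul, Module.End.mul_apply, ih, formAction_dOf,
      leftMulD_tmul]
    simp [hp]

theorem formAction_monomial (p : 𝒜 →ₗ[ℂ] 𝒜) (hp : p 1 = 0) {n : ℕ} (a : Fin (n + 1) → 𝒜) :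
    formAction p (Forms.monomial a) (1 ⊗ₜ 1) =
      a 0 ⊗ₜ[ℂ] (List.ofFn fun j : Fin n => TensorAlgebra.ι ℂ (p (a j.succ))).prod := by
  have h := formAction_prod p hp (List.ofFn fun j : Fin n => a j.succ)
  simp only [List.map_ofFn, Function.comp_def] at h
  rw [Forms.monomial, map_mul, Module.End.mul_apply, h, formAction_of, leftMul_tmul, mul_one]

theorem IsHochschildCochain.apply_proj {n : ℕ} {M : MultilinearMap ℂ (fun _ : Fin (n + 1) => 𝒜) ℂ}
    (hM : ∀ (a : Fin (n + 1) → 𝒜) (j : Fin n), a j.succ = 1 → M a = 0) (p : 𝒜 →ₗ[ℂ] 𝒜)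
    (hp : ∀ a, ∃ c : ℂ, a - p a = c • 1) (a : Fin (n + 1) → 𝒜) :
    M (Fin.cons (a 0) fun j => p (a j.succ)) = M a := by
  classical
  have key : ∀ s : Finset (Fin n),
      M (Fin.cons (a 0) fun j => if j ∈ s then p (a j.succ) else a j.succ) = M a := by
    intro s
    induction s using Finset.induction_on with
    | empty => simp only [Finset.notMem_empty, if_false]; congr 1; exact Fin.cons_self_tail a
    | insert i s hi ih =>
      rw [← ih]
      obtain ⟨c, hc⟩ := hp (a i.succ)
      set v : Fin (n + 1) → 𝒜 :=
        Fin.cons (a 0) fun j => if j ∈ s then p (a j.succ) else a j.succ with hv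
      have e1 : (Fin.cons (a 0) fun j => if j ∈ insert i s then p (a j.succ) else a j.succ :
          Fin (n + 1) → 𝒜) = Function.update v i.succ (p (a i.succ)) := by
        funext k
        refine Fin.cases ?_ (fun j => ?_) k
        · rw [Function.update_of_ne (Fin.succ_ne_zero i).symm]; simp [hv]
        · by_cases hj : j = i
          · subst hj; simp
          · rw [Function.update_of_ne (by simpa using hj)]; simp [hv, hj]
      have e2 : v = Function.update v i.succ (a i.succ) := by
        rw [eq_comm, Function.update_eq_self_iff]; simp [hv, hi]
      have e3 : M (Function.update v i.succ (a i.succ - p (a i.succ))) = 0 := by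
        rw [hc, M.map_update_smul, hM _ i (by simp), smul_zero]
      rw [e1]
      conv_rhs => rw [e2]
      rw [M.map_update_sub, sub_eq_zero] at e3
      exact e3.symm
  simpa using key Finset.univ

/-- Evaluation of normal forms on a multilinear map. -/
def evalNormal {n : ℕ} (M : MultilinearMap ℂ (fun _ : Fin (n + 1) => 𝒜) ℂ) :
    𝒜 ⊗[ℂ] TensorAlgebra ℂ 𝒜 →ₗ[ℂ] ℂ :=
  TensorProduct.lift
    (LinearMap.lcomp ℂ ℂ
        (DirectSum.component ℂ ℕ (fun i => ⨂[ℂ]^i 𝒜) n ∘ₗ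
          (TensorAlgebra.toDirectSum (R := ℂ) (M := 𝒜)).toLinearMap) ∘ₗ
      (PiTensorProduct.lift (R := ℂ) (s := fun _ : Fin n => 𝒜) (E := ℂ)).toLinearMap ∘ₗ
        M.curryLeft)

theorem evalNormal_tmul {n m : ℕ} (M : MultilinearMap ℂ (fun _ : Fin (n + 1) => 𝒜) ℂ) (x : 𝒜)
    (v : Fin m → 𝒜) :
    evalNormal M (x ⊗ₜ (List.ofFn fun j => TensorAlgebra.ι ℂ (v j)).prod) =
      if h : m = n then M (Fin.cons x fun j => v (Fin.cast h.symm j)) else 0 := by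
  have h1 : (List.ofFn fun j => TensorAlgebra.ι ℂ (v j)).prod = TensorAlgebra.tprod ℂ 𝒜 m v := by
    rw [TensorAlgebra.tprod_apply]
  rw [h1]
  simp only [evalNormal, TensorProduct.lift.tmul, LinearMap.comp_apply, LinearMap.lcomp_apply,
    AlgHom.toLinearMap_apply, TensorAlgebra.toDirectSum_tensorPower_tprod,
    LinearEquiv.coe_coe]
  split_ifs with h
  · subst h
    rw [← DirectSum.lof_eq_of ℂ, DirectSum.component.lof_self]
    simp
  · rw [← DirectSum.lof_eq_of ℂ, DirectSum.component.of, dif_neg h, map_zero]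

/-- Every Hochschild cochain integrates forms. -/
theorem exists_isFormIntegral {n : ℕ} {φ : Cochain 𝒜 n} (hφ : IsHochschildCochain φ) :
    ∃ I : Forms 𝒜 →ₗ[ℂ] ℂ, IsFormIntegral φ I := by
  obtain ⟨⟨M, hM⟩, hn⟩ := hφ
  obtain ⟨p, hp1, hp⟩ := exists_proj (𝒜 := 𝒜)
  refine ⟨evalNormal M ∘ₗ LinearMap.applyₗ ((1 : 𝒜) ⊗ₜ[ℂ] (1 : TensorAlgebra ℂ 𝒜)) ∘ₗ
    (formAction p).toLinearMap, fun a => ?_, fun m hm a => ?_⟩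
  · simp only [LinearMap.comp_apply, AlgHom.toLinearMap_apply, LinearMap.applyₗ_apply_apply,
      formAction_monomial p hp1]
    rw [evalNormal_tmul, dif_pos rfl, ← hM]
    exact IsHochschildCochain.apply_proj (fun a j h => (hM a).trans (hn a j h)) p hp a
  · simp only [LinearMap.comp_apply, AlgHom.toLinearMap_apply, LinearMap.applyₗ_apply_apply,
      formAction_monomial p hp1]
    rw [evalNormal_tmul, dif_neg hm]

open Classical in
/-- The integral `∫_φ : Ω(𝒜) → ℂ` of forms against a Hochschild cochain `φ`. -/
def formIntegral {n : ℕ} (φ : Cochain 𝒜 n) : Forms 𝒜 →ₗ[ℂ] ℂ :=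
  if h : ∃ I : Forms 𝒜 →ₗ[ℂ] ℂ, IsFormIntegral φ I then h.choose else 0

theorem formIntegral_spec {n : ℕ} {φ : Cochain 𝒜 n} (hφ : IsHochschildCochain φ) :
    IsFormIntegral φ (formIntegral φ) := by
  have h := exists_isFormIntegral hφ
  rw [formIntegral, dif_pos h]
  exact h.choose_spec

end Cochains

/-! ### Spectral triples -/

/-- A spectral triple `(𝒜, H, D)` with `D` unbounded in general. -/
structure SpectralTriple (𝒜 : Type*) [Ring 𝒜] [StarRing 𝒜] [Algebra ℂ 𝒜] (H : Type*)
    [NormedAddCommGroup H] [InnerProductSpace ℂ H] [CompleteSpace H] where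
  /-- the representation of `𝒜` by bounded operators -/
  rep : 𝒜 →⋆ₐ[ℂ] (H →L[ℂ] H)
  /-- the operator `D` -/
  D : H →ₗ.[ℂ] H
  selfAdjoint : IsSelfAdjoint D
  /-- the resolvent `(i - D)⁻¹` is compact -/
  compactResolvent : ∃ R : H →L[ℂ] H, IsCompactOperator R ∧
    ∀ x, ∃ h : R x ∈ D.domain, Complex.I • R x - D ⟨R x, h⟩ = x
  rep_mem : ∀ (a : 𝒜) (x : D.domain), rep a x ∈ D.domain
  boundedComm : ∀ a : 𝒜, ∃ T : H →L[ℂ] H, ∀ x : D.domain,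
    T x = D ⟨rep a x, rep_mem a x⟩ - rep a (D x)

/-- The bounded operator `[D, a]` (unique, because the domain of `D` is dense). -/
def SpectralTriple.comm {𝒜 : Type*} [Ring 𝒜] [StarRing 𝒜] [Algebra ℂ 𝒜] {H : Type*}
    [NormedAddCommGroup H] [InnerProductSpace ℂ H] [CompleteSpace H]
    (T : SpectralTriple 𝒜 H) (a : 𝒜) : H →L[ℂ] H := (T.boundedComm a).choose

/-! ### Divided differences and the bracket of the spectral action -/

/-- The divided difference `g[x₀,…,xₙ]` of a smooth function, repeated points being allowed:
`g[x₀] = g(x₀)`, and `g[x₀,x₁,…,xₙ] = h[x₁,…,xₙ]` with `h(x) = g[x₀,x]`, that is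
`h(x) = (g(x) - g(x₀))/(x - x₀)` for `x ≠ x₀` and `h(x₀) = g'(x₀)`. -/
def divDiff : List ℝ → (ℝ → ℂ) → ℂ
  | [], _ => 0
  | [x], g => g x
  | x :: y :: l, g => divDiff (y :: l) (dslope g x)

section Amplitudes

variable {ι : Type*} [DecidableEq ι]

/-- The bracket `⟨V₁,…,Vₙ⟩ = ∑ f'[λ_{i₁},…,λ_{iₙ}] (V₁)_{i₁i₂} ⋯ (Vₙ)_{iₙi₁}`, as a function of the
matrices of `V₁,…,Vₙ` in an orthonormal basis of eigenvectors of `D` with eigenvalues `lam`. -/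
def bracket (f : ℝ → ℂ) (lam : ι → ℝ) {n : ℕ} (V : Fin n → ι → ι → ℂ) : ℂ :=
  ∑' i : Fin n → ι, divDiff (List.ofFn fun j => lam (i j)) (deriv f) *
    ∏ j, V j (i j) (i (finRotate n j))

/-- The Hermitian `N × N` matrix `Q` with coordinates `Re Q_{kl} = x k l` for `k ≤ l` and
`Im Q_{kl} = x l k` for `k < l`. -/
def hermitian {N : ℕ} (x : Fin N → Fin N → ℝ) (k l : Fin N) : ℂ :=
  if k < l then x k l + x l k * Complex.I
  else if l < k then x l k - x k l * Complex.I
  else x k k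

/-- `Q ∈ H_N` as a matrix in the full eigenbasis; `e 0, e 1, …` are the first `N` indices. -/
def hermitianExt {N : ℕ} (e : Fin N ↪ ι) (x : Fin N → Fin N → ℝ) (i j : ι) : ℂ :=
  ∑ k, ∑ l, if e k = i ∧ e l = j then hermitian x k l else 0

/-- The Gaussian weight `exp(-⟨Q,Q⟩/2)` on `H_N`. -/
def gaussWeight (f : ℝ → ℂ) (lam : ι → ℝ) {N : ℕ} (e : Fin N ↪ ι) (x : Fin N → Fin N → ℝ) : ℂ :=
  Complex.exp (-(1 / 2) * bracket f lam ![hermitianExt e x, hermitianExt e x])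

/-- The normalized Gaussian integral over `H_N`, with respect to the Lebesgue measure in the
coordinates `Re Q_{kl}` (`k ≤ l`), `Im Q_{kl}` (`k < l`). -/
def gaussMean (f : ℝ → ℂ) (lam : ι → ℝ) {N : ℕ} (e : Fin N ↪ ι)
    (Φ : (Fin N → Fin N → ℝ) → ℂ) : ℂ :=
  (∫ x : Fin N → Fin N → ℝ, Φ x * gaussWeight f lam e x) /
    ∫ x : Fin N → Fin N → ℝ, gaussWeight f lam e x

/-- Connecting the edges `h` and `h'` by a propagator, at the level of amplitudes: `Q` is put on
both edges and integrated out, with a minus sign. -/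
def propagate (f : ℝ → ℂ) (lam : ι → ℝ) {N : ℕ} (e : Fin N ↪ ι) {m : ℕ} (h h' : Fin m)
    (Φ : (Fin m → ι → ι → ℂ) → ℂ) (W : Fin m → ι → ι → ℂ) : ℂ :=
  -gaussMean f lam e fun x =>
    Φ (Function.update (Function.update W h (hermitianExt e x)) h' (hermitianExt e x))

/-! ### Noncommutative Feynman diagrams -/

/-- A noncommutative Feynman diagram with `n` marked external edges, given by the set `Fin m` of
its half-edges at the internal vertices. The permutation `next` sends a half-edge to the
clockwise next one at the same vertex, so that the vertices, with their cyclic orders, are the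
cycles of `next` (fixed points included). The involution `opp` exchanges the two halves of each
internal edge and fixes the half-edges that belong to external edges, which are `leg 0, …`. -/
structure NCDiagram (n m : ℕ) where
  next : Equiv.Perm (Fin m)
  opp : Equiv.Perm (Fin m)
  leg : Fin n ↪ Fin m
  opp_opp : ∀ h, opp (opp h) = h
  opp_eq_self_iff : ∀ h, opp h = h ↔ h ∈ Set.range leg

/-- The set of cycles of a permutation, fixed points included. -/
abbrev Cycles {m : ℕ} (σ : Equiv.Perm (Fin m)) : Type :=
  Quotient (Equiv.Perm.SameCycle.setoid σ)

namespace NCDiagram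

variable {n m : ℕ} (G : NCDiagram n m)

/-- The internal edges, each represented by the smaller of its two half-edges. -/
def edges : List (Fin m) := (List.finRange m).filter fun h => h < G.opp h

/-- The permutation that walks along the boundary of the faces: cross the edge (or, if it is
external, go around it), then take the clockwise next edge. -/
def face : Equiv.Perm (Fin m) := G.next * G.opp

/-- The multigraph is connected, when only the internal edges whose half-edges satisfy `keep`
are retained. -/
def ConnectedVia (keep : Fin m → Prop) : Prop :=
  ∀ h h', Relation.EqvGen (fun x y => y = G.next x ∨ (keep x ∧ y = G.opp x)) h h'

/-- The loop order `1 - V + E`. -/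
def loopOrder : ℤ := 1 - (Nat.card (Cycles G.next) : ℤ) + (G.edges.length : ℤ)

/-- The planar one-loop one-particle-irreducible diagrams with clockwise vertices of degree at
least 3, with the external edges outside the loop and marked cyclically. Planarity (the vertices
being oriented clockwise) is Euler's formula; there are then two faces, and the last condition
says that the first external edge met, when walking along the boundary of a face from the external
edge `j`, is `j + 1`: all external edges lie on one face in this cyclic order, and the other face
is the inside of the loop. -/
structure Relevant : Prop where
  connected : G.ConnectedVia fun _ => True
  planar : (Nat.card (Cycles G.next) : ℤ) - (G.edges.length : ℤ) + (Nat.card (Cycles G.face) : ℤ) = 2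
  oneLoop : G.loopOrder = 1
  irreducible : ∀ h, G.opp h ≠ h → G.ConnectedVia fun x => x ≠ h ∧ x ≠ G.opp h
  degree : ∀ h, 3 ≤ Function.minimalPeriod G.next h
  marked : ∀ j : Fin n, ∃ r : ℕ, 0 < r ∧ (G.face ^ r) (G.leg j) = G.leg (finRotate n j) ∧
    ∀ s : ℕ, 0 < s → s < r → (G.face ^ s) (G.leg j) ∉ Set.range G.leg

/-- Isomorphism of marked diagrams. -/
def Iso (G G' : NCDiagram n m) : Prop :=
  ∃ τ : Equiv.Perm (Fin m), (∀ h, τ (G.next h) = G'.next (τ h)) ∧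
    (∀ h, τ (G.opp h) = G'.opp (τ h)) ∧ ∀ j, τ (G.leg j) = G'.leg j

/-- The product of the brackets of all vertices, for given fields `W` on all half-edges. -/
def vertexProduct (f : ℝ → ℂ) (lam : ι → ℝ) (W : Fin m → ι → ι → ℂ) : ℂ :=
  ∏ᶠ v : Cycles G.next, bracket f lam
    fun j : Fin (Function.minimalPeriod G.next v.out) => W ((G.next ^ (j : ℕ)) v.out)

/-- The amplitude `Γ_N^G(V₁,…,Vₙ)`: starting from the disjoint union of the vertices of `G`, the
internal edges are put in one after the other. -/
def amplitude (f : ℝ → ℂ) (lam : ι → ℝ) {N : ℕ} (e : Fin N ↪ ι) (V : Fin n → ι → ι → ℂ) : ℂ :=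
  G.edges.foldr (fun h Φ => propagate f lam e h (G.opp h) Φ) (G.vertexProduct f lam)
    (Function.extend G.leg V 0)

end NCDiagram

/-- Isomorphism of relevant diagrams as an equivalence relation. -/
instance relevantSetoid (n m : ℕ) : Setoid {G : NCDiagram n m // G.Relevant} where
  r G G' := NCDiagram.Iso G.1 G'.1
  iseqv :=
    { refl := fun G => ⟨1, by simp, by simp, by simp⟩
      symm := by
        rintro G G' ⟨τ, h1, h2, h3⟩
        refine ⟨τ⁻¹, fun h => ?_, fun h => ?_, fun j => ?_⟩
        · rw [Equiv.Perm.inv_eq_iff_eq, h1]; simp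
        · rw [Equiv.Perm.inv_eq_iff_eq, h2]; simp
        · rw [Equiv.Perm.inv_eq_iff_eq, h3]
      trans := by
        rintro G G' G'' ⟨τ, h1, h2, h3⟩ ⟨τ', h1', h2', h3'⟩
        exact ⟨τ' * τ, by simp [h1, h1'], by simp [h2, h2'], by simp [h3, h3']⟩ }

/-- The isomorphism classes of relevant diagrams with `n` marked external edges. -/
abbrev RelevantClass (n : ℕ) : Type :=
  Σ m : ℕ, Quotient (relevantSetoid n m)

/-- The one-loop bracket `⟪V₁,…,Vₙ⟫`: the sum of the amplitudes of all relevant diagrams, up to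
isomorphism. -/
def oneLoopBracket (f : ℝ → ℂ) (lam : ι → ℝ) {N : ℕ} (e : Fin N ↪ ι) {n : ℕ}
    (V : Fin n → ι → ι → ℂ) : ℂ :=
  ∑ᶠ c : RelevantClass n, NCDiagram.amplitude c.2.out.1 f lam e V

end Amplitudes

/-! ### The one-loop bracket of operators and its cochains -/

section Operators

variable {H : Type*} [NormedAddCommGroup H] [InnerProductSpace ℂ H]
  {ι : Type*} [DecidableEq ι]

/-- The matrix elements `V_{ij} = ⟨φ_i, V φ_j⟩`. -/
def matrixElt (φ : HilbertBasis ι ℂ H) (V : H →L[ℂ] H) (i j : ι) : ℂ := inner ℂ (φ i) (V (φ j))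

/-- `V` lies in the linear span of the operators `|φ_i⟩⟨φ_j|`. -/
def IsFiniteMatrix (φ : HilbertBasis ι ℂ H) (V : H →L[ℂ] H) : Prop :=
  {p : ι × ι | matrixElt φ V p.1 p.2 ≠ 0}.Finite

/-- The one-loop bracket `⟪V₁,…,Vₙ⟫` of operators. -/
def opBracket (φ : HilbertBasis ι ℂ H) (f : ℝ → ℂ) (lam : ι → ℝ) {N : ℕ} (e : Fin N ↪ ι) {n : ℕ}
    (V : Fin n → H →L[ℂ] H) : ℂ :=
  oneLoopBracket f lam e fun j => matrixElt φ (V j)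

variable [CompleteSpace H] {𝒜 : Type*} [Ring 𝒜] [StarRing 𝒜] [Algebra ℂ 𝒜]

/-- The cochains `φ_n^N(a₀,…,aₙ) = ⟪a₀[D,a₁],[D,a₂],…,[D,aₙ]⟫`, with `φ_0^N = 0`. -/
def phiN (T : SpectralTriple 𝒜 H) (φ : HilbertBasis ι ℂ H) (f : ℝ → ℂ) (lam : ι → ℝ) {N : ℕ}
    (e : Fin N ↪ ι) : (n : ℕ) → Cochain 𝒜 n
  | 0 => fun _ => 0
  | n + 1 => fun a => opBracket φ f lam e
      (Fin.cons (T.rep (a 0) * T.comm (a 1)) (fun j : Fin n => T.comm (a j.succ.succ)) :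
        Fin (n + 1) → H →L[ℂ] H)

/-- The cochains `ψ_n^N = φ_n^N - ½ B₀ φ_{n+1}^N`, of interest for odd `n`. -/
def psiN (T : SpectralTriple 𝒜 H) (φ : HilbertBasis ι ℂ H) (f : ℝ → ℂ) (lam : ι → ℝ) {N : ℕ}
    (e : Fin N ↪ ι) (n : ℕ) : Cochain 𝒜 n :=
  phiN T φ f lam e n - (1 / 2 : ℂ) • opB0 (phiN T φ f lam e (n + 1))

/-- The cochains `ψ̃_{2k-1}^N = (-1)^{k-1} (k-1)!/(2k-1)! ψ_{2k-1}^N`; for `n = 2k - 1` one has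
`n / 2 = k - 1`. -/
def psiTildeN (T : SpectralTriple 𝒜 H) (φ : HilbertBasis ι ℂ H) (f : ℝ → ℂ) (lam : ι → ℝ) {N : ℕ}
    (e : Fin N ↪ ι) (n : ℕ) : Cochain 𝒜 n :=
  ((-1 : ℂ) ^ (n / 2) * ((n / 2).factorial : ℂ) / (n.factorial : ℂ)) • psiN T φ f lam e n

end Operators

end

end OneLoop

open OneLoop

namespace OneLoop

noncomputable section

/-! ### Divided differences -/

/-! The proof has a combinatorial half, which turns diagrams into sums over cuts of a cyclic word
and proves the Ward identity there, and an algebraic half, which uses only cyclicity and the Ward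
identity.

The Gaussian measure is a product measure in the real coordinates of `Q`. Inserting an edge
therefore multiplies by `-G_{ab}` and identifies the indices on either side of the edge
(`gaussMean_hermitian`, `foldr_propagate_eq_sum`). In a relevant diagram the loop order gives as
many edges as vertices and irreducibility gives at least two internal half-edges at each vertex,
hence exactly two. Planarity then leaves two faces, and the marking puts all legs on one of them. So
the diagram is a ring with its legs outside (`NCDiagram.Relevant.isRing`), determined by the
nonempty set of legs that are followed by an edge (`RelevantClass.cuts_bijective`).

Consequently the one-loop bracket is a sum over outer indices of a product of matrix elements with a
coefficient `loopCoeff` (`oneLoopBracket_eq`). The coefficient cuts the cyclic word of outer indices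
in all ways: a cut at `y` contributes `-G_{yk}` and a piece contributes a divided difference at
`λ_k` and its letters, where `k` is the index inside the loop. Cyclicity is invariance under
rotation. For the Ward identity one multiplies by `λ_y - λ_x` for neighbouring letters. Pieces that
contain both letters split by the recursion of divided differences, and the terms with a cut at `x`
or `y` are balanced by `G_{xk} G_{yk} (f'[λ_k,λ_y] - f'[λ_k,λ_x]) = G_{xk} - G_{yk}`
(`ward_loopSum`). This needs `x` and `y` on the same side of the cutoff, which holds whenever
`a_{yx} ≠ 0` because the span is invariant under a `*`-algebra.

The algebraic half works in a `WardBracket`. The cochains `φ_n` form one functional on `Ω(𝒜)`, and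
forms carry a second associative product `x y + x₋ dy`. By the Ward identity, multiplication by a
one-form in this product inserts a field (`functional_one_form_mul`). Hence the functional is a
trace for it (`functional_mul_comm`) and `⟪V,…,V⟫` is its value on a power of `A` (`brk_replicate`).
The trace property and the Leibniz rule give the cocycle identities.

For the expansion let `S_{n+1}` be the coefficient of `t^n` in `∑_k (t dA + t² A²)^k`. The power
with `n + 1` factors is `A S_{n+1} + A S_n A`, and the trace property kills `A dS_n`
(`functional_mul_d_connSeq`). What remains are the coefficients of the Chern-Simons and curvature
terms. The power of `t` counts fields and `k` counts degree, so the two truncations at `K` differ by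
a finite sum of forms, the remainder. -/

theorem hasDerivAt_moment_integral {g : ℝ → ℂ} (hg : ContDiff ℝ 1 g) (a : ℕ) (x y : ℝ) :
    HasDerivAt (fun y => ∫ t in (0 : ℝ)..1, ((t : ℂ) ^ a) * g (x + t * (y - x)))
      (∫ t in (0 : ℝ)..1, ((t : ℂ) ^ (a + 1)) * deriv g (x + t * (y - x))) y := by
  have hd : Continuous (deriv g) := hg.continuous_deriv le_rfl
  have hc : Continuous g := hg.continuous
  have hcont : Continuous fun p : ℝ × ℝ =>
      ((p.2 : ℂ) ^ (a + 1)) * deriv g (x + p.2 * (p.1 - x)) :=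
    ((Complex.continuous_ofReal.comp continuous_snd).pow _).mul (hd.comp (by fun_prop))
  obtain ⟨C, hC⟩ := ((isCompact_closedBall y (1 : ℝ)).prod (isCompact_Icc (a := (0 : ℝ))
    (b := 1))).exists_bound_of_continuousOn hcont.continuousOn
  refine (intervalIntegral.hasDerivAt_integral_of_dominated_loc_of_deriv_le
    (F := fun y t => ((t : ℂ) ^ a) * g (x + t * (y - x)))
    (F' := fun y t => ((t : ℂ) ^ (a + 1)) * deriv g (x + t * (y - x)))
    (s := Metric.closedBall y 1) (bound := fun _ => C) (Metric.closedBall_mem_nhds y one_pos)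
    ?_ ?_ ?_ ?_ ?_ ?_).2
  · refine Filter.Eventually.of_forall fun z => Continuous.aestronglyMeasurable ?_
    fun_prop
  · exact Continuous.intervalIntegrable (by fun_prop) _ _
  · exact Continuous.aestronglyMeasurable (by fun_prop)
  · refine Filter.Eventually.of_forall fun t ht z hz => ?_
    refine hC (z, t) ⟨hz, ?_⟩
    rw [Set.uIoc_of_le zero_le_one] at ht
    exact ⟨ht.1.le, ht.2⟩
  · exact intervalIntegrable_const
  · refine Filter.Eventually.of_forall fun t _ z _ => ?_
    have h1 : HasDerivAt (fun z : ℝ => x + t * (z - x)) t z := by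
      simpa using (((hasDerivAt_id z).sub_const x).const_mul t).const_add x
    have h2 := ((hg.differentiable one_ne_zero (x + t * (z - x))).hasDerivAt.scomp z h1).const_mul
      ((t : ℂ) ^ a)
    have e : (t : ℂ) ^ a * t • deriv g (x + t * (z - x)) =
        (t : ℂ) ^ (a + 1) * deriv g (x + t * (z - x)) := by
      rw [Complex.real_smul]; ring
    rw [e] at h2
    exact h2

/-- Differentiation under the integral turns the moment of order `a` of `g` into the moment of order
`a + 1` of `g'`. Treating all `a` together makes the induction on the order of smoothness close. -/
theorem contDiff_moment_integral {g : ℝ → ℂ} (hg : ContDiff ℝ (⊤ : ℕ∞) g) (a : ℕ) (x : ℝ) :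
    ContDiff ℝ (⊤ : ℕ∞)
      fun y => ∫ t in (0 : ℝ)..1, ((t : ℂ) ^ a) * g (x + t * (y - x)) := by
  rw [contDiff_infty]
  intro n
  induction n generalizing a g with
  | zero =>
    exact contDiff_zero.2 (Differentiable.continuous (𝕜 := ℝ) fun y =>
      (hasDerivAt_moment_integral (hg.of_le (by simp)) a x y).differentiableAt)
  | succ n ih =>
    have h1 := hasDerivAt_moment_integral (hg.of_le (by simp)) a x
    push_cast
    rw [contDiff_succ_iff_deriv]
    refine ⟨fun y => (h1 y).differentiableAt, by simp, ?_⟩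
    have h2 : deriv (fun y => ∫ t in (0 : ℝ)..1, ((t : ℂ) ^ a) * g (x + t * (y - x))) =
        fun y => ∫ t in (0 : ℝ)..1, ((t : ℂ) ^ (a + 1)) * deriv g (x + t * (y - x)) :=
      funext fun y => (h1 y).deriv
    rw [h2]
    exact ih (contDiff_infty_iff_deriv.1 hg).2 (a + 1)

/-- Hadamard's formula, by the fundamental theorem of calculus along the segment. It shows
smoothness across the diagonal, so that divided differences can be iterated at repeated points. -/
theorem dslope_eq_integral {g : ℝ → ℂ} (hg : ContDiff ℝ 1 g) (x y : ℝ) :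
    dslope g x y = ∫ t in (0 : ℝ)..1, ((t : ℂ) ^ 0) * deriv g (x + t * (y - x)) := by
  have hd : Continuous (deriv g) := hg.continuous_deriv le_rfl
  by_cases h : y = x
  · subst h; simp
  · rw [dslope_of_ne _ h, slope_def_module]
    have h1 : ∀ t ∈ Set.uIcc (0 : ℝ) 1,
        HasDerivAt (fun t : ℝ => g (x + t * (y - x))) ((y - x) • deriv g (x + t * (y - x))) t := by
      intro t _
      have h1 : HasDerivAt (fun t : ℝ => x + t * (y - x)) (y - x) t := by
        simpa using ((hasDerivAt_id t).mul_const (y - x)).const_add x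
      exact (hg.differentiable one_ne_zero (x + t * (y - x))).hasDerivAt.scomp t h1
    have h2 := intervalIntegral.integral_eq_sub_of_hasDerivAt h1
      (Continuous.intervalIntegrable (by fun_prop) _ _)
    rw [intervalIntegral.integral_smul] at h2
    simp only [one_mul, zero_mul, add_zero, add_sub_cancel] at h2
    simp only [pow_zero, one_mul]
    rw [← h2, smul_smul, inv_mul_cancel₀ (sub_ne_zero.2 h), one_smul]

theorem contDiff_dslope {g : ℝ → ℂ} (hg : ContDiff ℝ (⊤ : ℕ∞) g) (x : ℝ) :
    ContDiff ℝ (⊤ : ℕ∞) (dslope g x) := by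
  have h : dslope g x = _ := funext fun y => dslope_eq_integral (hg.of_le (by simp)) x y
  rw [h]
  exact contDiff_moment_integral (contDiff_infty_iff_deriv.1 hg).2 0 x

theorem dslope_comm {g : ℝ → ℂ} (x y : ℝ) : dslope g x y = dslope g y x := by
  by_cases h : y = x
  · rw [h]
  · rw [dslope_of_ne _ h, dslope_of_ne _ (Ne.symm h), slope_comm]

/-- The confluent case `g[x, y, y]`: one side is the derivative at `y` of a difference quotient, the
other a difference quotient built from `g'(y)`. The product rule identifies them. -/
theorem dslope_dslope_apply_right {g : ℝ → ℂ} (hg : Differentiable ℝ g) {x y : ℝ} (h : y ≠ x) :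
    dslope (dslope g x) y y = dslope (dslope g y) x y := by
  have hyx : ((y : ℂ) - x) ≠ 0 := by exact_mod_cast sub_ne_zero.2 h
  rw [dslope_same, dslope_of_ne _ h, slope_def_module, dslope_same, dslope_of_ne _ (Ne.symm h),
    (dslope_eventuallyEq_slope_of_ne g h).deriv_eq]
  have h1 : HasDerivAt (fun z : ℝ => (z - x)⁻¹ • (g z - g x))
      ((y - x)⁻¹ • deriv g y + (-1 / (y - x) ^ 2) • (g y - g x)) y :=
    HasDerivAt.smul (((hasDerivAt_id y).sub_const x).inv (sub_ne_zero.2 h))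
      ((hg y).hasDerivAt.sub_const (g x))
  have h2 : slope g x = fun z : ℝ => (z - x)⁻¹ • (g z - g x) := by
    funext z; rw [slope_def_module]
  have hxy : ((x : ℂ) - y) ≠ 0 := by exact_mod_cast sub_ne_zero.2 (Ne.symm h)
  rw [h2, h1.deriv, slope_def_module]
  simp only [Complex.real_smul]
  push_cast
  field_simp
  ring

theorem dslope_dslope_comm {g : ℝ → ℂ} (hg : Differentiable ℝ g) (x y : ℝ) :
    dslope (dslope g x) y = dslope (dslope g y) x := by
  by_cases h : y = x
  · rw [h]
  funext z
  by_cases hz : z = y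
  · subst hz; exact dslope_dslope_apply_right hg h
  by_cases hz' : z = x
  · subst hz'; exact (dslope_dslope_apply_right hg (Ne.symm h)).symm
  rw [dslope_of_ne _ hz, dslope_of_ne _ hz', slope_def_module, slope_def_module,
    dslope_of_ne _ hz, dslope_of_ne _ hz', dslope_of_ne _ h, dslope_of_ne _ (Ne.symm h)]
  simp only [slope_def_module, Complex.real_smul]
  have h1 : ((y : ℂ) - x) ≠ 0 := by exact_mod_cast sub_ne_zero.2 h
  have h1' : ((x : ℂ) - y) ≠ 0 := by exact_mod_cast sub_ne_zero.2 (Ne.symm h)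
  have h2 : ((z : ℂ) - y) ≠ 0 := by exact_mod_cast sub_ne_zero.2 hz
  have h3 : ((z : ℂ) - x) ≠ 0 := by exact_mod_cast sub_ne_zero.2 hz'
  push_cast
  field_simp
  ring

theorem divDiff_cons {g : ℝ → ℂ} (x : ℝ) {l : List ℝ} (hl : l ≠ []) :
    divDiff (x :: l) g = divDiff l (dslope g x) := by
  cases l with
  | nil => exact absurd rfl hl
  | cons y l => rfl

/-- Adjacent transpositions suffice, and peeling off a common first point replaces `g` by `dslope g
x`, which is again smooth. -/
theorem divDiff_perm {l l' : List ℝ} (h : l.Perm l') {g : ℝ → ℂ}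
    (hg : ContDiff ℝ (⊤ : ℕ∞) g) : divDiff l g = divDiff l' g := by
  induction h generalizing g with
  | nil => rfl
  | @cons x l₁ l₂ h ih =>
    by_cases hl : l₁ = []
    · subst hl; rw [h.nil_eq]
    · have hl' : l₂ ≠ [] := fun h' => hl (by subst h'; exact h.eq_nil)
      rw [divDiff_cons x hl, divDiff_cons x hl', ih (contDiff_dslope hg x)]
  | swap x y l =>
    cases l with
    | nil => exact dslope_comm _ _
    | cons z l =>
      simp only [divDiff]
      rw [dslope_dslope_comm (hg.differentiable (by simp))]
  | trans _ _ ih1 ih2 => rw [ih1 hg, ih2 hg]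

/-- At the last two points the definition has been reduced to one difference quotient, so the
recursion is immediate there; symmetry later moves it to any position. -/
theorem divDiff_append_pair (l : List ℝ) (x y : ℝ) (g : ℝ → ℂ) :
    ((x : ℂ) - y) * divDiff (l ++ [x, y]) g = divDiff (l ++ [x]) g - divDiff (l ++ [y]) g := by
  induction l generalizing g with
  | nil =>
    have h := sub_smul_dslope g y x
    rw [Complex.real_smul] at h
    push_cast at h
    simp only [List.nil_append, divDiff]
    rw [dslope_comm, h]
  | cons z l ih =>
    simp only [List.cons_append]
    rw [divDiff_cons z (by simp), divDiff_cons z (by simp), divDiff_cons z (by simp), ih]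

/-- The recursion of divided differences at two neighbouring points. -/
theorem sub_mul_divDiff {g : ℝ → ℂ} (hg : ContDiff ℝ (⊤ : ℕ∞) g) (l₁ l₂ : List ℝ) (x y : ℝ) :
    ((x : ℂ) - y) * divDiff (l₁ ++ x :: y :: l₂) g =
      divDiff (l₁ ++ x :: l₂) g - divDiff (l₁ ++ y :: l₂) g := by
  have h := divDiff_append_pair (l₁ ++ l₂) x y g
  have h1 : ∀ l, (l₁ ++ l₂ ++ l).Perm (l₁ ++ (l ++ l₂)) := fun l => by
    rw [List.append_assoc]
    exact (List.perm_append_comm).append_left _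
  rwa [divDiff_perm (h1 [x, y]) hg, divDiff_perm (h1 [x]) hg, divDiff_perm (h1 [y]) hg] at h

/-! ### Gaussian integrals -/

open MeasureTheory in
-- The integrand is a constant multiple of the derivative of the Gaussian.
theorem integral_mul_gaussian {c : ℝ} (hc : 0 < c) :
    ∫ t : ℝ, (t : ℂ) * (Real.exp (-(c / 2) * t ^ 2) : ℂ) = 0 := by
  have h1 : ∀ t : ℝ, HasDerivAt (fun t => Real.exp (-(c / 2) * t ^ 2))
      (-c * (t * Real.exp (-(c / 2) * t ^ 2))) t := fun t => by
    convert ((hasDerivAt_pow 2 t).const_mul (-(c / 2))).exp using 1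
    simp; ring
  have h2 := integral_eq_zero_of_hasDerivAt_of_integrable h1
    ((integrable_mul_exp_neg_mul_sq (half_pos hc)).const_mul _)
    (integrable_exp_neg_mul_sq (half_pos hc))
  rw [integral_const_mul] at h2
  have h3 : ∫ t : ℝ, t * Real.exp (-(c / 2) * t ^ 2) = 0 :=
    (mul_eq_zero.1 h2).resolve_left (neg_ne_zero.2 hc.ne')
  have h4 := congrArg (fun z : ℝ => (z : ℂ)) h3
  simp only [Complex.ofReal_zero] at h4
  rw [← h4, ← integral_complex_ofReal]
  simp

theorem integrable_sq_mul_gaussian {c : ℝ} (hc : 0 < c) :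
    MeasureTheory.Integrable fun t : ℝ => t * t * Real.exp (-(c / 2) * t ^ 2) := by
  have h := integrable_rpow_mul_exp_neg_mul_sq (half_pos hc) (s := 2) (by norm_num)
  refine h.congr (Filter.Eventually.of_forall fun t => ?_)
  have h2 : t ^ (2 : ℝ) = t * t := by rw [Real.rpow_two, pow_two]
  exact congrArg (· * Real.exp (-(c / 2) * t ^ 2)) h2

open MeasureTheory in
-- Integration by parts, in the form that the derivative of `t exp(-c t²/2)` has integral zero.
theorem integral_sq_mul_gaussian {c : ℝ} (hc : 0 < c) :
    ∫ t : ℝ, (t : ℂ) * t * (Real.exp (-(c / 2) * t ^ 2) : ℂ) =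
      1 / c * ∫ t : ℝ, (Real.exp (-(c / 2) * t ^ 2) : ℂ) := by
  have h1 : ∀ t : ℝ, HasDerivAt (fun t => t * Real.exp (-(c / 2) * t ^ 2))
      (Real.exp (-(c / 2) * t ^ 2) - c * (t * t * Real.exp (-(c / 2) * t ^ 2))) t := fun t => by
    refine HasDerivAt.congr_deriv ((hasDerivAt_id' t).fun_mul
      ((hasDerivAt_pow 2 t).const_mul (-(c / 2))).exp) ?_
    push_cast; ring
  have i1 := integrable_exp_neg_mul_sq (half_pos hc)
  have i2 := (integrable_sq_mul_gaussian hc).const_mul c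
  have h2 := integral_eq_zero_of_hasDerivAt_of_integrable h1 (i1.sub i2)
    (integrable_mul_exp_neg_mul_sq (half_pos hc))
  rw [integral_sub i1 i2, integral_const_mul, sub_eq_zero] at h2
  have h3 : ∫ t : ℝ, t * t * Real.exp (-(c / 2) * t ^ 2) =
      1 / c * ∫ t : ℝ, Real.exp (-(c / 2) * t ^ 2) := by
    rw [h2, ← mul_assoc, one_div, inv_mul_cancel₀ hc.ne', one_mul]
  have h4 := congrArg (fun z : ℝ => (z : ℂ)) h3
  simp only [Complex.ofReal_mul] at h4
  rw [← integral_complex_ofReal, ← integral_complex_ofReal] at h4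
  simpa using h4

section Weight

variable {N : ℕ} (c : Fin N → Fin N → ℝ)

/-- A product of Gaussian densities in the entries of a real matrix. -/
def prodGauss (x : Fin N → Fin N → ℝ) : ℂ :=
  ∏ k, ∏ l, (Real.exp (-(c k l / 2) * x k l ^ 2) : ℂ)

/-- One factor per coordinate, with `p = q` allowed, so that Fubini treats all second moments alike.
-/
theorem mul_prodGauss (p q : Fin N × Fin N) (x : Fin N → Fin N → ℝ) :
    (x p.1 p.2 : ℂ) * x q.1 q.2 * prodGauss c x =
      ∏ k, ∏ l, ((if (k, l) = p then (x k l : ℂ) else 1) * (if (k, l) = q then (x k l : ℂ) else 1) *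
        (Real.exp (-(c k l / 2) * x k l ^ 2) : ℂ)) := by
  have h : ∀ p : Fin N × Fin N, ∏ k, ∏ l, (if (k, l) = p then (x k l : ℂ) else 1) = x p.1 p.2 := by
    intro p
    rw [← Fintype.prod_prod_type (fun r : Fin N × Fin N => if r = p then (x r.1 r.2 : ℂ) else 1)]
    simp
  simp only [Finset.prod_mul_distrib, h, prodGauss]

variable {c} (hc : ∀ k l, 0 < c k l)
include hc

theorem integrable_gauss_factor (b b' : Prop) [Decidable b] [Decidable b'] (k l : Fin N) :
    MeasureTheory.Integrable fun t : ℝ => (if b then (t : ℂ) else 1) * (if b' then (t : ℂ) else 1) *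
      (Real.exp (-(c k l / 2) * t ^ 2) : ℂ) := by
  have i0 := (integrable_exp_neg_mul_sq (half_pos (hc k l))).ofReal (𝕜 := ℂ)
  have i1 := (integrable_mul_exp_neg_mul_sq (half_pos (hc k l))).ofReal (𝕜 := ℂ)
  have i2 := (integrable_sq_mul_gaussian (hc k l)).ofReal (𝕜 := ℂ)
  by_cases h : b <;> by_cases h' : b' <;> simp only [h, h', if_true, if_false, one_mul, mul_one]
  · simpa using i2
  · simpa using i1
  · simpa using i1
  · simpa using i0

theorem integrable_mul_prodGauss (p q : Fin N × Fin N) :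
    MeasureTheory.Integrable fun x : Fin N → Fin N → ℝ =>
      (x p.1 p.2 : ℂ) * x q.1 q.2 * prodGauss c x := by
  simp only [mul_prodGauss]
  refine MeasureTheory.Integrable.fintype_prod (E := Fin N → ℝ) (𝕜 := ℂ) (f := fun k y => ∏ l,
    ((if (k, l) = p then (y l : ℂ) else 1) * (if (k, l) = q then (y l : ℂ) else 1) *
        (Real.exp (-(c k l / 2) * y l ^ 2) : ℂ))) fun k => ?_
  exact MeasureTheory.Integrable.fintype_prod (E := ℝ) (𝕜 := ℂ) (f := fun l t =>
    ((if (k, l) = p then (t : ℂ) else 1) * (if (k, l) = q then (t : ℂ) else 1) *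
        (Real.exp (-(c k l / 2) * t ^ 2) : ℂ))) fun l => integrable_gauss_factor hc _ _ k l

omit hc in
theorem integral_mul_prodGauss_eq (p q : Fin N × Fin N) :
    ∫ x : Fin N → Fin N → ℝ, (x p.1 p.2 : ℂ) * x q.1 q.2 * prodGauss c x =
      ∏ r : Fin N × Fin N, ∫ t : ℝ, (if r = p then (t : ℂ) else 1) * (if r = q then (t : ℂ) else 1) *
        (Real.exp (-(c r.1 r.2 / 2) * t ^ 2) : ℂ) := by
  simp only [mul_prodGauss]
  rw [MeasureTheory.integral_fintype_prod_volume_eq_prod (E := fun _ => Fin N → ℝ) (𝕜 := ℂ)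
    (fun k y => ∏ l,
    ((if (k, l) = p then (y l : ℂ) else 1) * (if (k, l) = q then (y l : ℂ) else 1) *
        (Real.exp (-(c k l / 2) * y l ^ 2) : ℂ))), Fintype.prod_prod_type]
  refine Finset.prod_congr rfl fun k _ => ?_
  exact MeasureTheory.integral_fintype_prod_volume_eq_prod (E := fun _ => ℝ) (𝕜 := ℂ) (fun l t =>
    ((if (k, l) = p then (t : ℂ) else 1) * (if (k, l) = q then (t : ℂ) else 1) *
        (Real.exp (-(c k l / 2) * t ^ 2) : ℂ)))

omit hc in
theorem integral_prodGauss_eq :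
    ∫ x : Fin N → Fin N → ℝ, prodGauss c x =
      ∏ r : Fin N × Fin N, ∫ t : ℝ, (Real.exp (-(c r.1 r.2 / 2) * t ^ 2) : ℂ) := by
  simp only [prodGauss]
  rw [MeasureTheory.integral_fintype_prod_volume_eq_prod (E := fun _ => Fin N → ℝ) (𝕜 := ℂ)
    (fun k y => ∏ l, (Real.exp (-(c k l / 2) * y l ^ 2) : ℂ)), Fintype.prod_prod_type]
  refine Finset.prod_congr rfl fun k _ => ?_
  exact MeasureTheory.integral_fintype_prod_volume_eq_prod (E := fun _ => ℝ) (𝕜 := ℂ) (fun l t =>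
        (Real.exp (-(c k l / 2) * t ^ 2) : ℂ))

theorem integral_prodGauss_ne_zero : ∫ x : Fin N → Fin N → ℝ, prodGauss c x ≠ 0 := by
  rw [integral_prodGauss_eq]
  refine Finset.prod_ne_zero_iff.2 fun r _ => ?_
  have h : (∫ t : ℝ, (Real.exp (-(c r.1 r.2 / 2) * t ^ 2) : ℂ)) =
      ((∫ t : ℝ, Real.exp (-(c r.1 r.2 / 2) * t ^ 2) : ℝ) : ℂ) := integral_ofReal
  rw [h, integral_gaussian]
  have : 0 < Real.pi / (c r.1 r.2 / 2) := div_pos Real.pi_pos (half_pos (hc _ _))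
  exact_mod_cast (Real.sqrt_pos.2 this).ne'

/-- The second moments of a product of Gaussian densities. -/
theorem integral_mul_prodGauss (p q : Fin N × Fin N) :
    ∫ x : Fin N → Fin N → ℝ, (x p.1 p.2 : ℂ) * x q.1 q.2 * prodGauss c x =
      (if p = q then 1 / (c p.1 p.2 : ℂ) else 0) * ∫ x : Fin N → Fin N → ℝ, prodGauss c x := by
  rw [integral_mul_prodGauss_eq]
  split_ifs with h
  · subst h
    rw [integral_prodGauss_eq, ← Finset.mul_prod_erase _ _ (Finset.mem_univ p),
      ← Finset.mul_prod_erase Finset.univ (fun r : Fin N × Fin N =>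
        ∫ t : ℝ, (Real.exp (-(c r.1 r.2 / 2) * t ^ 2) : ℂ)) (Finset.mem_univ p), ← mul_assoc]
    congr 1
    · simp only [if_true]
      exact integral_sq_mul_gaussian (hc _ _)
    · refine Finset.prod_congr rfl fun r hr => ?_
      simp [Finset.ne_of_mem_erase hr]
  · rw [zero_mul]
    refine Finset.prod_eq_zero (Finset.mem_univ p) ?_
    simp only [if_true, h, if_false, mul_one]
    exact integral_mul_gaussian (hc _ _)

end Weight

/-- The sign in front of the imaginary part of an entry of a Hermitian matrix. -/
def hermSign {N : ℕ} (k l : Fin N) : ℂ := if k < l then 1 else if l < k then -1 else 0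

theorem hermitian_eq {N : ℕ} (x : Fin N → Fin N → ℝ) (k l : Fin N) :
    hermitian x k l = x (min k l) (max k l) +
      hermSign k l * Complex.I * x (max k l) (min k l) := by
  rcases lt_trichotomy k l with h | h | h
  · simp [hermitian, hermSign, h, min_eq_left h.le, max_eq_right h.le]; ring
  · subst h; simp [hermitian, hermSign]
  · simp [hermitian, hermSign, h, h.not_gt, min_eq_right h.le, max_eq_left h.le]; ring

theorem hermitian_mul_eq {N : ℕ} (x : Fin N → Fin N → ℝ) (k l m n : Fin N) :
    hermitian x k l * hermitian x m n =
      (x (min k l) (max k l) : ℂ) * x (min m n) (max m n) +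
      hermSign m n * Complex.I * ((x (min k l) (max k l) : ℂ) * x (max m n) (min m n)) +
      hermSign k l * Complex.I * ((x (max k l) (min k l) : ℂ) * x (min m n) (max m n)) -
      hermSign k l * hermSign m n * ((x (max k l) (min k l) : ℂ) * x (max m n) (min m n)) := by
  rw [hermitian_eq, hermitian_eq]
  linear_combination (-hermSign k l * hermSign m n *
    ((x (max k l) (min k l) : ℂ) * x (max m n) (min m n))) * (-Complex.I_sq)

section Weight

variable {N : ℕ} {c : Fin N → Fin N → ℝ} (hc : ∀ k l, 0 < c k l)
include hc

theorem integrable_hermitian_mul (k l m n : Fin N) :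
    MeasureTheory.Integrable fun x : Fin N → Fin N → ℝ =>
      hermitian x k l * hermitian x m n * prodGauss c x := by
  have h := fun p q => integrable_mul_prodGauss hc p q
  refine ((((h (min k l, max k l) (min m n, max m n)).add
    ((h (min k l, max k l) (max m n, min m n)).const_mul (hermSign m n * Complex.I))).add
    ((h (max k l, min k l) (min m n, max m n)).const_mul (hermSign k l * Complex.I))).sub
    ((h (max k l, min k l) (max m n, min m n)).const_mul (hermSign k l * hermSign m n))).congr
    (Filter.Eventually.of_forall fun x => ?_)
  simp only [hermitian_mul_eq, Pi.add_apply, Pi.sub_apply]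
  ring

omit hc in
theorem integral_add_add_sub {α : Type*} [MeasurableSpace α] {μ : MeasureTheory.Measure α}
    {f₁ f₂ f₃ f₄ : α → ℂ} (h₁ : MeasureTheory.Integrable f₁ μ) (h₂ : MeasureTheory.Integrable f₂ μ)
    (h₃ : MeasureTheory.Integrable f₃ μ) (h₄ : MeasureTheory.Integrable f₄ μ) :
    ∫ x, f₁ x + f₂ x + f₃ x - f₄ x ∂μ =
      ∫ x, f₁ x ∂μ + ∫ x, f₂ x ∂μ + ∫ x, f₃ x ∂μ - ∫ x, f₄ x ∂μ := by
  have h12 : MeasureTheory.Integrable (fun x => f₁ x + f₂ x) μ := h₁.add h₂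
  have h123 : MeasureTheory.Integrable (fun x => f₁ x + f₂ x + f₃ x) μ := h12.add h₃
  rw [MeasureTheory.integral_sub h123 h₄, MeasureTheory.integral_add h12 h₃,
    MeasureTheory.integral_add h₁ h₂]

/-- Off the diagonal the real and imaginary parts are independent with variance `1 / (2s)`: their
contributions cancel in `Q_{kl} Q_{kl}` and add up to `1 / s` in `Q_{kl} Q_{lk}`. On the diagonal
there is only a real part, of variance `1 / s`. The nine cases are the relative orders of `k, l` and
of `m, n`. -/
theorem integral_hermitian_mul {s : Fin N → Fin N → ℝ} (hs : ∀ k l, s k l = s l k)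
    (hcs : ∀ k l, c k l = if k = l then s k l else 2 * s k l) (k l m n : Fin N) :
    ∫ x : Fin N → Fin N → ℝ, hermitian x k l * hermitian x m n * prodGauss c x =
      (if k = n ∧ l = m then 1 / (s k l : ℂ) else 0) *
        ∫ x : Fin N → Fin N → ℝ, prodGauss c x := by
  have h := fun p q => integrable_mul_prodGauss hc p q
  have e : ∀ x : Fin N → Fin N → ℝ, hermitian x k l * hermitian x m n * prodGauss c x =
      (x (min k l) (max k l) : ℂ) * x (min m n) (max m n) * prodGauss c x +
      (hermSign m n * Complex.I) *
        ((x (min k l) (max k l) : ℂ) * x (max m n) (min m n) * prodGauss c x) +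
      (hermSign k l * Complex.I) *
        ((x (max k l) (min k l) : ℂ) * x (min m n) (max m n) * prodGauss c x) -
      (hermSign k l * hermSign m n) *
        ((x (max k l) (min k l) : ℂ) * x (max m n) (min m n) * prodGauss c x) := fun x => by
    rw [hermitian_mul_eq]; ring
  have i1 := h (min k l, max k l) (min m n, max m n)
  have i2 := (h (min k l, max k l) (max m n, min m n)).const_mul (hermSign m n * Complex.I)
  have i3 := (h (max k l, min k l) (min m n, max m n)).const_mul (hermSign k l * Complex.I)
  have i4 := (h (max k l, min k l) (max m n, min m n)).const_mul (hermSign k l * hermSign m n)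
  simp only [e]
  refine (integral_add_add_sub i1 i2 i3 i4).trans ?_
  rw [MeasureTheory.integral_const_mul, MeasureTheory.integral_const_mul,
    MeasureTheory.integral_const_mul,
    integral_mul_prodGauss hc (min k l, max k l) (min m n, max m n),
    integral_mul_prodGauss hc (min k l, max k l) (max m n, min m n),
    integral_mul_prodGauss hc (max k l, min k l) (min m n, max m n),
    integral_mul_prodGauss hc (max k l, min k l) (max m n, min m n)]
  simp only [← mul_assoc, ← add_mul, ← sub_mul]
  congr 1
  have hpos : ∀ k l, (s k l : ℂ) ≠ 0 := fun k l => by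
    have h1 := hc k l
    rw [hcs] at h1
    have : 0 < s k l := by split_ifs at h1 <;> linarith
    exact_mod_cast this.ne'
  simp only [hermSign, hcs, Prod.mk.injEq]
  rcases lt_trichotomy k l with h1 | h1 | h1 <;> rcases lt_trichotomy m n with h2 | h2 | h2
  · have a1 : ¬ (k = n ∧ l = m) := by rintro ⟨rfl, rfl⟩; exact absurd h1 h2.not_gt
    have a2 : ¬ (k = n ∧ l = m) := a1
    have a3 : ¬ (l = m ∧ k = n) := fun h => a1 h.symm
    simp only [h1, h2, min_eq_left h1.le, max_eq_right h1.le, min_eq_left h2.le, max_eq_right h2.le,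
      h1.ne, h1.ne', if_true, if_false, a1, a3, and_comm (a := l = n)]
    split_ifs with a4
    · rw [hs l k]; ring
    · ring
  · subst h2
    have a1 : ¬ (k = m ∧ l = m) := by rintro ⟨rfl, rfl⟩; exact absurd h1 (lt_irrefl _)
    have a3 : ¬ (l = m ∧ k = m) := fun h => a1 h.symm
    simp [h1, min_eq_left h1.le, max_eq_right h1.le, a1, a3]
  · simp only [h1, h2, h2.not_gt, min_eq_left h1.le, max_eq_right h1.le, min_eq_right h2.le,
      max_eq_left h2.le, h1.ne, h1.ne', if_true, if_false]
    have a1 : ¬ (k = m ∧ l = n) := by rintro ⟨rfl, rfl⟩; exact absurd h1 h2.not_gt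
    have a3 : ¬ (l = n ∧ k = m) := fun h => a1 h.symm
    simp only [a1, a3, if_false, and_comm (a := l = m)]
    split_ifs with a4
    · rw [hs l k]; have := hpos k l; push_cast; field_simp; ring
    · ring
  · subst h1
    have a1 : ¬ (k = n ∧ k = m) := by rintro ⟨rfl, rfl⟩; exact absurd h2 (lt_irrefl _)
    have a3 : ¬ (k = m ∧ k = n) := fun h => a1 h.symm
    simp [h2, min_eq_left h2.le, max_eq_right h2.le, a1, a3]
  · subst h1; subst h2
    simp
  · subst h1
    have a1 : ¬ (k = n ∧ k = m) := by rintro ⟨rfl, rfl⟩; exact absurd h2 (lt_irrefl _)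
    have a3 : ¬ (k = m ∧ k = n) := fun h => a1 h.symm
    simp [h2, min_eq_right h2.le, max_eq_left h2.le, a1, a3]
  · simp only [h1, h2, h1.not_gt, min_eq_right h1.le, max_eq_left h1.le, min_eq_left h2.le,
      max_eq_right h2.le, h1.ne, h1.ne', if_true, if_false]
    have a1 : ¬ (k = m ∧ l = n) := by rintro ⟨rfl, rfl⟩; exact absurd h1 h2.not_gt
    have a3 : ¬ (l = n ∧ k = m) := fun h => a1 h.symm
    simp only [a1, a3, if_false, and_comm (a := l = m)]
    split_ifs with a4
    · rw [hs l k]; have := hpos k l; push_cast; field_simp; ring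
    · ring
  · subst h2
    have a1 : ¬ (k = m ∧ l = m) := by rintro ⟨rfl, rfl⟩; exact absurd h1 (lt_irrefl _)
    have a3 : ¬ (l = m ∧ k = m) := fun h => a1 h.symm
    simp [h1, h1.not_gt, min_eq_right h1.le, max_eq_left h1.le, a1, a3]
  · have a1 : ¬ (k = n ∧ l = m) := by rintro ⟨rfl, rfl⟩; exact absurd h1 h2.not_gt
    have a3 : ¬ (l = m ∧ k = n) := fun h => a1 h.symm
    simp only [h1, h2, h1.not_gt, h2.not_gt, min_eq_right h1.le, max_eq_left h1.le,
      min_eq_right h2.le, max_eq_left h2.le,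
      h1.ne, h1.ne', if_true, if_false, a1, a3, and_comm (a := l = n)]
    split_ifs with a4
    · rw [hs l k]; ring
    · ring

end Weight

/-! ### The amplitude of a diagram as a sum over index assignments -/

section Brackets

variable {ι : Type*}

/-- The matrix `V` is supported in `A × A`. -/
def SupportedIn (A : Finset ι) (V : ι → ι → ℂ) : Prop := ∀ a b, V a b ≠ 0 → a ∈ A ∧ b ∈ A

theorem SupportedIn.mono {A B : Finset ι} (h : A ⊆ B) {V : ι → ι → ℂ} (hV : SupportedIn A V) :
    SupportedIn B V := fun a b hab => ⟨h (hV a b hab).1, h (hV a b hab).2⟩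

theorem bracket_eq_sum (f : ℝ → ℂ) (lam : ι → ℝ) (A : Finset ι) {n : ℕ} {V : Fin n → ι → ι → ℂ}
    (hV : ∀ j, SupportedIn A (V j)) :
    bracket f lam V = ∑ i ∈ Fintype.piFinset (fun _ : Fin n => A),
      divDiff (List.ofFn fun j => lam (i j)) (deriv f) * ∏ j, V j (i j) (i (finRotate n j)) := by
  refine tsum_eq_sum fun i hi => ?_
  rw [Fintype.mem_piFinset, not_forall] at hi
  obtain ⟨j, hj⟩ := hi
  rw [Finset.prod_eq_zero (Finset.mem_univ j) (not_not.1 fun h => hj (hV j _ _ h).1), mul_zero]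

variable [DecidableEq ι] {N : ℕ} (e : Fin N ↪ ι)

theorem hermitianExt_apply (x : Fin N → Fin N → ℝ) (k l : Fin N) :
    hermitianExt e x (e k) (e l) = hermitian x k l := by
  simp only [hermitianExt, EmbeddingLike.apply_eq_iff_eq, ite_and]
  simp

theorem hermitianExt_eq_zero (x : Fin N → Fin N → ℝ) {i j : ι}
    (h : ¬ ((∃ k, e k = i) ∧ ∃ l, e l = j)) : hermitianExt e x i j = 0 := by
  refine Finset.sum_eq_zero fun k _ => Finset.sum_eq_zero fun l _ => ?_
  rw [if_neg]
  exact fun h' => h ⟨⟨k, h'.1⟩, ⟨l, h'.2⟩⟩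

theorem hermitianExt_supportedIn {A : Finset ι} (hA : ∀ k, e k ∈ A) (x : Fin N → Fin N → ℝ) :
    SupportedIn A (hermitianExt e x) := by
  intro a b h
  by_contra hab
  refine h (hermitianExt_eq_zero e x ?_)
  rintro ⟨⟨k, rfl⟩, ⟨l, rfl⟩⟩
  exact hab ⟨hA k, hA l⟩

/-- The propagator `G_{ab} = 1 / f'[λ_a, λ_b]`, extended by zero outside the cutoff. -/
def propagator (f : ℝ → ℂ) (lam : ι → ℝ) (a b : ι) : ℂ :=
  if (∃ k, e k = a) ∧ ∃ l, e l = b then 1 / divDiff [lam a, lam b] (deriv f) else 0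

theorem propagator_symm (f : ℝ → ℂ) (lam : ι → ℝ) (a b : ι) :
    propagator e f lam a b = propagator e f lam b a := by
  simp only [propagator, divDiff, and_comm (a := ∃ k, e k = a)]
  rw [dslope_comm]

section Gauss

variable {f : ℝ → ℂ} {lam : ι → ℝ}
  (hf : ∀ k l : Fin N, ∃ s : ℝ, 0 < s ∧ divDiff [lam (e k), lam (e l)] (deriv f) = (s : ℂ))

omit [DecidableEq ι] in
-- Each off-diagonal coordinate occurs both in the `(k, l)` and in the `(l, k)` summand, whence the
-- factor `2` in `c`.
theorem sum_hermitian_mul_hermitian {s c : Fin N → Fin N → ℝ} (hs : ∀ k l, s k l = s l k)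
    (hcs : ∀ k l, c k l = if k = l then s k l else 2 * s k l) (x : Fin N → Fin N → ℝ) :
    ∑ k, ∑ l, (s k l : ℂ) * (hermitian x k l * hermitian x l k) =
      ∑ k, ∑ l, (c k l : ℂ) * (x k l : ℂ) ^ 2 := by
  have h1 : ∀ k l, (s k l : ℂ) * (hermitian x k l * hermitian x l k) =
      s k l * (x k l : ℂ) ^ 2 + (if k = l then 0 else (s l k : ℂ) * (x l k : ℂ) ^ 2) := by
    intro k l
    rcases lt_trichotomy k l with h | h | h
    · simp only [hermitian, h, h.not_gt, if_true, if_false, h.ne, hs l k]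
      linear_combination (-(s k l : ℂ) * (x l k : ℂ) ^ 2) * Complex.I_sq
    · subst h; simp [hermitian, pow_two]
    · simp only [hermitian, h, h.not_gt, if_true, if_false, h.ne', hs l k]
      linear_combination (-(s k l : ℂ) * (x k l : ℂ) ^ 2) * Complex.I_sq
  simp only [h1, Finset.sum_add_distrib]
  rw [Finset.sum_comm (f := fun k l => if k = l then (0 : ℂ) else (s l k : ℂ) * (x l k : ℂ) ^ 2),
    ← Finset.sum_add_distrib]
  refine Finset.sum_congr rfl fun k _ => ?_
  rw [← Finset.sum_add_distrib]
  refine Finset.sum_congr rfl fun l _ => ?_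
  rw [hcs]
  by_cases h : k = l
  · subst h; simp
  · rw [if_neg (Ne.symm h), if_neg h]; push_cast; ring

theorem bracket_pair (x : Fin N → Fin N → ℝ) :
    bracket f lam ![hermitianExt e x, hermitianExt e x] =
      ∑ k, ∑ l, divDiff [lam (e k), lam (e l)] (deriv f) *
        (hermitian x k l * hermitian x l k) := by
  have hinj : Function.Injective fun (p : Fin 2 → Fin N) j => e (p j) :=
    fun p q h => funext fun j => e.injective (congrFun h j)
  rw [bracket, ← hinj.tsum_eq, tsum_fintype, ← (finTwoArrowEquiv (Fin N)).symm.sum_comp,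
    Fintype.sum_prod_type]
  · refine Finset.sum_congr rfl fun k _ => Finset.sum_congr rfl fun l _ => ?_
    simp [Fin.prod_univ_two, hermitianExt_apply, List.ofFn_succ]
  · intro i hi
    have hi' := right_ne_zero_of_mul hi
    rw [Finset.prod_ne_zero_iff] at hi'
    have h0 := hi' 0 (Finset.mem_univ _)
    simp only [Matrix.cons_val_zero] at h0
    have h1 : (∃ k, e k = i 0) ∧ ∃ l, e l = i (finRotate 2 0) := by
      by_contra h; exact h0 (hermitianExt_eq_zero e x h)
    obtain ⟨⟨k, hk⟩, ⟨l, hl⟩⟩ := h1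
    refine ⟨![k, l], funext fun j => ?_⟩
    fin_cases j
    · exact hk
    · exact hl

include hf in
-- The quadratic form `⟨Q, Q⟩` is diagonal in the real coordinates, so the weight is an explicit
-- product density. Every Gaussian computation goes through this.
theorem exists_gaussWeight_eq : ∃ s c : Fin N → Fin N → ℝ, (∀ k l, 0 < c k l) ∧
    (∀ k l, s k l = s l k) ∧ (∀ k l, c k l = if k = l then s k l else 2 * s k l) ∧
    (∀ k l, divDiff [lam (e k), lam (e l)] (deriv f) = (s k l : ℂ)) ∧
    ∀ x, gaussWeight f lam e x = prodGauss c x := by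
  choose s hs0 hs using hf
  have hsymm : ∀ k l, s k l = s l k := fun k l => by
    have : (s k l : ℂ) = s l k := by rw [← hs, ← hs]; exact dslope_comm _ _
    exact_mod_cast this
  refine ⟨s, fun k l => if k = l then s k l else 2 * s k l, fun k l => ?_, hsymm, fun _ _ => rfl, hs,
    fun x => ?_⟩
  · have := hs0 k l
    dsimp only
    split_ifs <;> linarith
  · rw [gaussWeight, bracket_pair]
    simp only [hs]
    rw [sum_hermitian_mul_hermitian hsymm (fun _ _ => rfl), Finset.mul_sum, Complex.exp_sum,
      prodGauss]
    refine Finset.prod_congr rfl fun k _ => ?_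
    rw [Finset.mul_sum, Complex.exp_sum]
    refine Finset.prod_congr rfl fun l _ => ?_
    rw [Complex.ofReal_exp]
    push_cast
    ring_nf

include hf in
theorem integrable_hermitian_mul_gaussWeight (k l m n : Fin N) :
    MeasureTheory.Integrable fun x : Fin N → Fin N → ℝ =>
      hermitian x k l * hermitian x m n * gaussWeight f lam e x := by
  obtain ⟨s, c, hc, -, -, -, hw⟩ := exists_gaussWeight_eq e hf
  simp only [hw]
  exact integrable_hermitian_mul hc k l m n

include hf in
/-- The propagator as a Gaussian integral. -/
theorem gaussMean_hermitian (k l m n : Fin N) :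
    gaussMean f lam e (fun x => hermitian x k l * hermitian x m n) =
      if k = n ∧ l = m then 1 / divDiff [lam (e k), lam (e l)] (deriv f) else 0 := by
  obtain ⟨s, c, hc, hs, hcs, hd, hw⟩ := exists_gaussWeight_eq e hf
  simp only [gaussMean, hw, hd]
  rw [integral_hermitian_mul hc hs hcs, mul_div_assoc, div_self (integral_prodGauss_ne_zero hc),
    mul_one]

include hf in
theorem gaussMean_hermitianExt (a b c d : ι) :
    gaussMean f lam e (fun x => hermitianExt e x a b * hermitianExt e x c d) =
      if a = d ∧ b = c then propagator e f lam a b else 0 := by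
  by_cases h1 : (∃ k, e k = a) ∧ ∃ l, e l = b
  · by_cases h2 : (∃ k, e k = c) ∧ ∃ l, e l = d
    · obtain ⟨⟨k, rfl⟩, l, rfl⟩ := h1
      obtain ⟨⟨m, rfl⟩, n, rfl⟩ := h2
      simp only [hermitianExt_apply, gaussMean_hermitian e hf, propagator,
        EmbeddingLike.apply_eq_iff_eq]
      simp
    · have h3 : ¬ (a = d ∧ b = c) := by
        rintro ⟨rfl, rfl⟩; exact h2 h1.symm
      simp only [hermitianExt_eq_zero e _ h2, mul_zero, if_neg h3]
      simp [gaussMean]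
  · simp only [hermitianExt_eq_zero e _ h1, zero_mul, propagator, if_neg h1, ite_self]
    simp [gaussMean]

include hf in
theorem integrable_hermitianExt_mul (a b c d : ι) :
    MeasureTheory.Integrable fun x : Fin N → Fin N → ℝ =>
      hermitianExt e x a b * hermitianExt e x c d * gaussWeight f lam e x := by
  by_cases h1 : (∃ k, e k = a) ∧ ∃ l, e l = b
  · by_cases h2 : (∃ k, e k = c) ∧ ∃ l, e l = d
    · obtain ⟨⟨k, rfl⟩, l, rfl⟩ := h1
      obtain ⟨⟨m, rfl⟩, n, rfl⟩ := h2
      simp only [hermitianExt_apply]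
      exact integrable_hermitian_mul_gaussWeight e hf k l m n
    · simp [hermitianExt_eq_zero e _ h2]
  · simp [hermitianExt_eq_zero e _ h1]

include hf in
-- Wick contraction of two fields inside a finite linear combination; exchanging sum and integral
-- needs the integrability of each term.
theorem gaussMean_sum {κ : Type*} (S : Finset κ) (z : κ → ℂ) (a b c d : κ → ι) :
    gaussMean f lam e (fun x => ∑ i ∈ S,
        z i * (hermitianExt e x (a i) (b i) * hermitianExt e x (c i) (d i))) =
      ∑ i ∈ S, z i * if a i = d i ∧ b i = c i then propagator e f lam (a i) (b i) else 0 := by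
  simp only [← gaussMean_hermitianExt e hf, gaussMean, Finset.sum_mul]
  rw [MeasureTheory.integral_finsetSum, Finset.sum_div]
  · refine Finset.sum_congr rfl fun i _ => ?_
    simp only [mul_assoc (z i)]
    rw [MeasureTheory.integral_const_mul, mul_div_assoc]
  · intro i _
    simp only [mul_assoc (z i)]
    exact (integrable_hermitianExt_mul e hf _ _ _ _).const_mul _

end Gauss

end Brackets

/-! ### Cycles of a permutation -/

section Cycles

variable {m : ℕ} (σ : Equiv.Perm (Fin m))

instance : Fintype (Cycles σ) := Fintype.ofFinite _

instance : DecidableEq (Cycles σ) := Classical.decEq _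

theorem minimalPeriod_perm_pos {X : Type*} [Finite X] (σ : Equiv.Perm X) (x : X) :
    0 < Function.minimalPeriod σ x :=
  Function.minimalPeriod_pos_of_mem_periodicPts (σ.injective.mem_periodicPts x)

theorem perm_pow_minimalPeriod {X : Type*} (σ : Equiv.Perm X) (x : X) :
    (σ ^ Function.minimalPeriod σ x) x = x := by
  rw [← Equiv.Perm.iterate_eq_pow]
  exact Function.isPeriodicPt_minimalPeriod σ x

theorem perm_pow_finRotate {X : Type*} (σ : Equiv.Perm X) (x : X)
    (j : Fin (Function.minimalPeriod σ x)) :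
    (σ ^ (finRotate _ j : ℕ)) x = σ ((σ ^ (j : ℕ)) x) := by
  have key : ∀ p, p = Function.minimalPeriod σ x → ∀ j : Fin p,
      (σ ^ (finRotate p j : ℕ)) x = σ ((σ ^ (j : ℕ)) x) := by
    intro p hp j
    cases p with
    | zero => exact j.elim0
    | succ p =>
      rw [← Equiv.Perm.mul_apply, ← pow_succ', coe_finRotate]
      split_ifs with h
      · subst h
        rw [pow_zero, Fin.val_last, hp, perm_pow_minimalPeriod]; rfl
      · rfl
  exact key _ rfl j

/-- The elements of all cycles, enumerated cycle by cycle. -/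
def cyclesEquiv : (Σ v : Cycles σ, Fin (Function.minimalPeriod σ v.out)) ≃ Fin m :=
  Equiv.ofBijective (fun p => (σ ^ (p.2 : ℕ)) p.1.out) <| by
    constructor
    · rintro ⟨v, j⟩ ⟨v', j'⟩ h
      dsimp only at h
      have hv : v = v' := by
        rw [← Quotient.out_equiv_out]
        have h1 : σ.SameCycle v.out ((σ ^ (j : ℕ)) v.out) := ⟨j, by simp⟩
        have h2 : σ.SameCycle v'.out ((σ ^ (j' : ℕ)) v'.out) := ⟨j', by simp⟩
        exact h1.trans (h ▸ h2.symm)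
      subst hv
      congr 1
      refine Fin.ext (Function.iterate_injOn_Iio_minimalPeriod (f := σ) (x := v.out) j.2 j'.2 ?_)
      simpa only [Equiv.Perm.iterate_eq_pow] using h
    · intro h
      have h1 : σ.SameCycle (⟦h⟧ : Cycles σ).out h := Quotient.mk_out (s := Equiv.Perm.SameCycle.setoid σ) h
      obtain ⟨i, hi⟩ := h1.exists_nat_pow_eq
      refine ⟨⟨⟦h⟧, ⟨i % Function.minimalPeriod σ (⟦h⟧ : Cycles σ).out,
        Nat.mod_lt _ (minimalPeriod_perm_pos σ _)⟩⟩, ?_⟩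
      dsimp only
      rw [← Equiv.Perm.iterate_eq_pow, Function.iterate_mod_minimalPeriod_eq,
        Equiv.Perm.iterate_eq_pow, hi]

theorem cyclesEquiv_apply (p : Σ v : Cycles σ, Fin (Function.minimalPeriod σ v.out)) :
    cyclesEquiv σ p = (σ ^ (p.2 : ℕ)) p.1.out := rfl

end Cycles

/-! ### Expansion of amplitudes over indices on half-edges -/

section Amplitude

variable {ι : Type*} [DecidableEq ι] {n m : ℕ} (G : NCDiagram n m) (f : ℝ → ℂ) (lam : ι → ℝ)

/-- The divided difference at the points met when walking around the cycle of `σ` through `h`. -/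
def cycleDiff {X : Type*} (σ : Equiv.Perm X) (i : X → ι) (h : X) : ℂ :=
  divDiff (List.ofFn fun j : Fin (Function.minimalPeriod σ h) => lam (i ((σ ^ (j : ℕ)) h))) (deriv f)

omit [DecidableEq ι] in
-- The index sums at the separate vertices are distributed into one sum over indices of half-edges.
-- The index `i h` sits in the corner before `h`, so the field on `h` enters with the matrix element
-- `(i h, i (next h))`.
theorem vertexProduct_eq_sum (A : Finset ι) {W : Fin m → ι → ι → ℂ}
    (hW : ∀ h, SupportedIn A (W h)) :
    G.vertexProduct f lam W = ∑ i ∈ Fintype.piFinset (fun _ : Fin m => A),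
      (∏ v : Cycles G.next, cycleDiff f lam G.next i v.out) * ∏ h, W h (i h) (i (G.next h)) := by
  have h1 := fun v : Cycles G.next => bracket_eq_sum f lam A
    (V := fun j : Fin (Function.minimalPeriod G.next v.out) => W ((G.next ^ (j : ℕ)) v.out))
    fun j => hW _
  rw [NCDiagram.vertexProduct, finprod_eq_prod_of_fintype]
  simp only [h1]
  rw [Finset.prod_univ_sum]
  refine Finset.sum_nbij' (fun q h => q ((cyclesEquiv G.next).symm h).1
    ((cyclesEquiv G.next).symm h).2) (fun i v j => i (cyclesEquiv G.next ⟨v, j⟩)) ?_ ?_ ?_ ?_ ?_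
  · intro q hq
    simp only [Fintype.mem_piFinset] at hq ⊢
    exact fun h => hq _ _
  · intro i hi
    simp only [Fintype.mem_piFinset] at hi ⊢
    exact fun v j => hi _
  · intro q _
    funext v j
    exact congrArg (fun s : Σ v : Cycles G.next, Fin (Function.minimalPeriod G.next v.out) =>
      q s.1 s.2) (Equiv.symm_apply_apply _ ⟨v, j⟩)
  · intro i _
    funext h
    simp only [Sigma.eta, Equiv.apply_symm_apply]
  · intro q _
    rw [Finset.prod_mul_distrib]
    have hq : ∀ (v : Cycles G.next) (j : Fin (Function.minimalPeriod G.next v.out)), q v j =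
        q ((cyclesEquiv G.next).symm ((G.next ^ (j : ℕ)) v.out)).1
          ((cyclesEquiv G.next).symm ((G.next ^ (j : ℕ)) v.out)).2 := fun v j => by
      exact (congrArg (fun s : Σ v : Cycles G.next, Fin (Function.minimalPeriod G.next v.out) =>
        q s.1 s.2) (Equiv.symm_apply_apply (cyclesEquiv G.next) ⟨v, j⟩)).symm
    congr 1
    · refine Finset.prod_congr rfl fun v _ => ?_
      simp only [cycleDiff, ← hq]
    · rw [← (cyclesEquiv G.next).prod_comp, Fintype.prod_sigma]
      refine Finset.prod_congr rfl fun v _ => Finset.prod_congr rfl fun j _ => ?_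
      rw [cyclesEquiv_apply, ← perm_pow_finRotate]
      dsimp only
      rw [← hq, ← hq]

variable {N : ℕ} (e : Fin N ↪ ι)

/-- The factor of an internal edge in the amplitude of a diagram. -/
def edgeFactor {X : Type*} (σ τ : Equiv.Perm X) (i : X → ι) (h : X) : ℂ :=
  -if i h = i (σ (τ h)) ∧ i (σ h) = i (τ h) then propagator e f lam (i h) (i (σ h)) else 0

variable {f lam}

/-- Induction on the list of edges, for all fields at once because an insertion changes the fields.
The head of the list is inserted last: its two ends carry `Q` and are contracted, while the
half-edges outside all edges of the list keep `W`. -/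
theorem foldr_propagate_eq_sum
    (hf : ∀ k l : Fin N, ∃ s : ℝ, 0 < s ∧ divDiff [lam (e k), lam (e l)] (deriv f) = (s : ℂ))
    {A : Finset ι} (hA : ∀ k, e k ∈ A) (w : (Fin m → ι) → ℂ) (Φ : (Fin m → ι → ι → ℂ) → ℂ)
    (hΦ : ∀ W : Fin m → ι → ι → ℂ, (∀ h, SupportedIn A (W h)) →
      Φ W = ∑ i ∈ Fintype.piFinset (fun _ : Fin m => A), w i * ∏ h, W h (i h) (i (G.next h)))
    (E : List (Fin m)) (hE : E.Nodup) (hE' : ∀ h ∈ E, h < G.opp h)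
    (W : Fin m → ι → ι → ℂ) (hW : ∀ h, SupportedIn A (W h)) :
    E.foldr (fun h Φ => propagate f lam e h (G.opp h) Φ) Φ W =
      ∑ i ∈ Fintype.piFinset (fun _ : Fin m => A),
        w i * (∏ h ∈ E.toFinset, edgeFactor f lam e G.next G.opp i h) *
          ∏ h ∈ Finset.univ.filter (fun h => h ∉ E ∧ G.opp h ∉ E), W h (i h) (i (G.next h)) := by
  induction E generalizing W with
  | nil => simpa using hΦ W hW
  | cons h E ih =>
    obtain ⟨hhE, hE1⟩ := List.nodup_cons.1 hE
    have hlt : h < G.opp h := hE' h (by simp)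
    have hopp : G.opp h ∉ E := fun h' => by
      have := hE' _ (List.mem_cons_of_mem h h')
      rw [G.opp_opp] at this
      exact absurd hlt this.not_gt
    have hW' : ∀ x h', SupportedIn A (Function.update (Function.update W h (hermitianExt e x))
        (G.opp h) (hermitianExt e x) h') := fun x h' => by
      by_cases h1 : h' = G.opp h
      · subst h1; simpa using hermitianExt_supportedIn e hA x
      · rw [Function.update_of_ne h1]
        by_cases h2 : h' = h
        · subst h2; simpa using hermitianExt_supportedIn e hA x
        · rw [Function.update_of_ne h2]; exact hW h'
    rw [List.foldr_cons, propagate]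
    have key : ∀ x, E.foldr (fun h Φ => propagate f lam e h (G.opp h) Φ) Φ
        (Function.update (Function.update W h (hermitianExt e x)) (G.opp h) (hermitianExt e x)) =
        ∑ i ∈ Fintype.piFinset (fun _ : Fin m => A),
        (w i * (∏ h ∈ E.toFinset, edgeFactor f lam e G.next G.opp i h) *
          ∏ h' ∈ Finset.univ.filter (fun h' => h' ∉ h :: E ∧ G.opp h' ∉ h :: E),
            W h' (i h') (i (G.next h'))) * (hermitianExt e x (i h) (i (G.next h)) *
              hermitianExt e x (i (G.opp h)) (i (G.next (G.opp h)))) := by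
      intro x
      rw [ih hE1 (fun h' hh' => hE' h' (List.mem_cons_of_mem h hh')) _ (hW' x)]
      refine Finset.sum_congr rfl fun i _ => ?_
      -- The half-edges left free by `E` are those left free by `h :: E` together with the two ends
      -- of the new edge.
      have hset : Finset.univ.filter (fun h' => h' ∉ E ∧ G.opp h' ∉ E) =
          insert h (insert (G.opp h)
            (Finset.univ.filter (fun h' => h' ∉ h :: E ∧ G.opp h' ∉ h :: E))) := by
        ext h'
        simp only [Finset.mem_filter, Finset.mem_univ, true_and, Finset.mem_insert, List.mem_cons,
          not_or]
        constructor
        · rintro ⟨h1, h2⟩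
          by_cases h3 : h' = h
          · exact Or.inl h3
          by_cases h4 : G.opp h' = h
          · right; left; rw [← h4, G.opp_opp]
          · exact Or.inr (Or.inr ⟨⟨h3, h1⟩, h4, h2⟩)
        · rintro (rfl | rfl | ⟨⟨_, h1⟩, _, h2⟩)
          · exact ⟨hhE, hopp⟩
          · rw [G.opp_opp]; exact ⟨hopp, hhE⟩
          · exact ⟨h1, h2⟩
      rw [hset, Finset.prod_insert, Finset.prod_insert]
      · rw [Function.update_self, Function.update_of_ne hlt.ne, Function.update_self]
        have : ∏ h' ∈ Finset.univ.filter (fun h' => h' ∉ h :: E ∧ G.opp h' ∉ h :: E),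
            Function.update (Function.update W h (hermitianExt e x)) (G.opp h)
              (hermitianExt e x) h' (i h') (i (G.next h')) =
            ∏ h' ∈ Finset.univ.filter (fun h' => h' ∉ h :: E ∧ G.opp h' ∉ h :: E),
            W h' (i h') (i (G.next h')) := by
          refine Finset.prod_congr rfl fun h' hh' => ?_
          simp only [Finset.mem_filter, Finset.mem_univ, true_and, List.mem_cons, not_or] at hh'
          rw [Function.update_of_ne, Function.update_of_ne hh'.1.1]
          rintro rfl
          rw [G.opp_opp] at hh'
          exact hh'.2.1 rfl
        rw [this]; ring
      · simp [G.opp_opp]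
      · simp [hlt.ne]
    simp only [key]
    rw [gaussMean_sum e hf, ← Finset.sum_neg_distrib]
    refine Finset.sum_congr rfl fun i _ => ?_
    rw [List.toFinset_cons, Finset.prod_insert (by simpa using hhE)]
    simp only [edgeFactor]
    ring

/-- The amplitude of a diagram with half-edges `X`, as a sum over the assignments of indices. -/
def ampSum (f : ℝ → ℂ) (lam : ι → ℝ) (A : Finset ι) {X : Type*} [Fintype X] [DecidableEq X]
    (σ τ : Equiv.Perm X) (E : Finset X) (leg : Fin n → X) (C : (X → ι) → ℂ) (V : Fin n → ι → ι → ℂ) : ℂ :=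
  ∑ i ∈ Fintype.piFinset (fun _ : X => A), C i * (∏ h ∈ E, edgeFactor f lam e σ τ i h) *
    ∏ j, V j (i (leg j)) (i (σ (leg j)))

theorem amplitude_eq_ampSum
    (hf : ∀ k l : Fin N, ∃ s : ℝ, 0 < s ∧ divDiff [lam (e k), lam (e l)] (deriv f) = (s : ℂ))
    {A : Finset ι} (hA : ∀ k, e k ∈ A) {V : Fin n → ι → ι → ℂ} (hV : ∀ j, SupportedIn A (V j)) :
    G.amplitude f lam e V = ampSum e f lam A G.next G.opp
      (Finset.univ.filter fun h => h < G.opp h) G.leg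
      (fun i => ∏ v : Cycles G.next, cycleDiff f lam G.next i v.out) V := by
  have hW : ∀ h, SupportedIn A (Function.extend G.leg V 0 h) := by
    intro h
    by_cases hh : ∃ j, G.leg j = h
    · obtain ⟨j, rfl⟩ := hh
      rw [G.leg.injective.extend_apply]; exact hV j
    · rw [Function.extend_apply' _ _ _ hh]
      intro a b h; simp at h
  rw [NCDiagram.amplitude, foldr_propagate_eq_sum G e hf hA _ _
    (fun W hW => vertexProduct_eq_sum G f lam A hW) G.edges
    ((List.nodup_finRange m).filter _) (fun h hh => by simpa [NCDiagram.edges] using hh) _ hW]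
  have h1 : G.edges.toFinset = Finset.univ.filter fun h => h < G.opp h := by
    ext h; simp [NCDiagram.edges]
  have h2 : Finset.univ.filter (fun h => h ∉ G.edges ∧ G.opp h ∉ G.edges) =
      Finset.univ.map G.leg := by
    ext h
    simp only [NCDiagram.edges, List.mem_filter, List.mem_finRange, decide_eq_true_eq, true_and,
      Finset.mem_filter, Finset.mem_univ, G.opp_opp, Finset.mem_map]
    have := G.opp_eq_self_iff h
    rw [Set.mem_range] at this
    rw [← this, not_lt, not_lt]
    exact ⟨fun h => le_antisymm h.1 h.2, fun h => ⟨h.le, h.ge⟩⟩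
  rw [h1, h2, ampSum]
  refine Finset.sum_congr rfl fun i _ => ?_
  rw [Finset.prod_map]
  simp only [G.leg.injective.extend_apply]

end Amplitude

/-! ### Invariance of amplitudes under isomorphisms -/

section Invariance

variable {ι : Type*} {f : ℝ → ℂ} (lam : ι → ℝ)

theorem ofFn_shift_perm {α : Type*} (p : ℕ) (g : ℕ → α) (h : g p = g 0) :
    (List.ofFn fun j : Fin p => g (j + 1)).Perm (List.ofFn fun j : Fin p => g j) := by
  cases p with
  | zero => simp
  | succ q =>
    rw [List.ofFn_succ', List.ofFn_succ, List.concat_eq_append]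
    simp only [Fin.val_castSucc, Fin.val_last, Fin.val_zero, Fin.val_succ, h]
    exact List.perm_append_singleton _ _

/-- Moving the starting point rotates the list of points, and divided differences are symmetric. So
the representative chosen at a vertex is irrelevant. -/
theorem cycleDiff_apply (hf : ContDiff ℝ (⊤ : ℕ∞) (deriv f)) {X : Type*} [Finite X]
    (σ : Equiv.Perm X) (i : X → ι) (h : X) :
    cycleDiff f lam σ i (σ h) = cycleDiff f lam σ i h := by
  have hp : Function.minimalPeriod σ (σ h) = Function.minimalPeriod σ h :=
    Function.minimalPeriod_apply (σ.injective.mem_periodicPts h)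
  have h1 := ofFn_shift_perm (Function.minimalPeriod σ h) (fun j => lam (i ((σ ^ j) h)))
    (by simp only [perm_pow_minimalPeriod, pow_zero]; rfl)
  rw [cycleDiff, cycleDiff, hp, ← divDiff_perm h1 hf]
  simp only [pow_succ, Equiv.Perm.mul_apply]

theorem cycleDiff_sameCycle (hf : ContDiff ℝ (⊤ : ℕ∞) (deriv f)) {X : Type*} [Finite X]
    (σ : Equiv.Perm X) (i : X → ι) {h h' : X} (hh : σ.SameCycle h h') :
    cycleDiff f lam σ i h = cycleDiff f lam σ i h' := by
  obtain ⟨k, rfl⟩ := hh.exists_nat_pow_eq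
  clear hh
  induction k with
  | zero => rfl
  | succ k ih => rw [pow_succ', Equiv.Perm.mul_apply, cycleDiff_apply lam hf, ih]

theorem minimalPeriod_semiconj {X Y : Type*} {σ : Equiv.Perm X} {σ' : Equiv.Perm Y} {τ : X → Y}
    (hinj : Function.Injective τ) (hτ : ∀ x, τ (σ x) = σ' (τ x)) (h : X) :
    Function.minimalPeriod σ' (τ h) = Function.minimalPeriod σ h := by
  rw [Function.minimalPeriod_eq_minimalPeriod_iff]
  intro n
  have h1 : Function.Semiconj τ σ σ' := hτ
  rw [Function.IsPeriodicPt, Function.IsFixedPt, ← (h1.iterate_right n).eq, hinj.eq_iff]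
  rfl

theorem pow_semiconj {X Y : Type*} {σ : Equiv.Perm X} {σ' : Equiv.Perm Y} {τ : X → Y}
    (hτ : ∀ x, τ (σ x) = σ' (τ x)) (h : X) (k : ℕ) : (σ' ^ k) (τ h) = τ ((σ ^ k) h) := by
  induction k with
  | zero => rfl
  | succ k ih => rw [pow_succ', Equiv.Perm.mul_apply, ih, ← hτ, pow_succ', Equiv.Perm.mul_apply]

theorem cycleDiff_semiconj {X Y : Type*} {σ : Equiv.Perm X} {σ' : Equiv.Perm Y} {τ : X → Y}
    (hinj : Function.Injective τ) (hτ : ∀ x, τ (σ x) = σ' (τ x)) (i : Y → ι) (h : X) :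
    cycleDiff f lam σ' i (τ h) = cycleDiff f lam σ (i ∘ τ) h := by
  simp only [cycleDiff, minimalPeriod_semiconj hinj hτ, pow_semiconj hτ, Function.comp_apply, Fin.val_cast]

theorem prod_cycleDiff (hf : ContDiff ℝ (⊤ : ℕ∞) (deriv f)) {m : ℕ} (σ : Equiv.Perm (Fin m))
    {S : Type*} [Fintype S] (rep : S → Fin m)
    (hr : Function.Bijective fun s => (⟦rep s⟧ : Cycles σ)) (i : Fin m → ι) :
    ∏ v : Cycles σ, cycleDiff f lam σ i v.out = ∏ s, cycleDiff f lam σ i (rep s) := by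
  rw [← hr.prod_comp]
  refine Finset.prod_congr rfl fun s _ => cycleDiff_sameCycle lam hf σ i ?_
  exact Quotient.mk_out (s := Equiv.Perm.SameCycle.setoid σ) (rep s)

variable [DecidableEq ι] {N : ℕ} (e : Fin N ↪ ι)

theorem edgeFactor_opp (f : ℝ → ℂ) {X : Type*} (σ τ : Equiv.Perm X) (i : X → ι) {h : X}
    (hh : τ (τ h) = h) :
    edgeFactor f lam e σ τ i (τ h) = edgeFactor f lam e σ τ i h := by
  simp only [edgeFactor, hh]
  by_cases h1 : i h = i (σ (τ h)) ∧ i (σ h) = i (τ h)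
  · rw [if_pos h1, if_pos ⟨h1.2.symm, h1.1.symm⟩, ← h1.1, ← h1.2, propagator_symm]
  · rw [if_neg h1, if_neg fun h2 => h1 ⟨h2.2.symm, h2.1.symm⟩]

/-- `E` contains exactly one of the two halves of each internal edge. -/
structure IsTransversal {X : Type*} (τ : Equiv.Perm X) (E : Finset X) : Prop where
  ne : ∀ h ∈ E, τ h ≠ h
  opp_notMem : ∀ h ∈ E, τ h ∉ E
  mem_or : ∀ h, τ h ≠ h → h ∈ E ∨ τ h ∈ E

/-- Two choices of halves are matched by passing to the opposite half wherever they disagree. -/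
theorem IsTransversal.prod_eq {X : Type*} [DecidableEq X] {τ : Equiv.Perm X} (hτ : ∀ h, τ (τ h) = h)
    {E E' : Finset X} (hE : IsTransversal τ E) (hE' : IsTransversal τ E') {p : X → ℂ}
    (hp : ∀ h, p (τ h) = p h) : ∏ h ∈ E, p h = ∏ h ∈ E', p h := by
  have key : ∀ {E E' : Finset X}, IsTransversal τ E → IsTransversal τ E' →
      (∀ h ∈ E, (if h ∈ E' then h else τ h) ∈ E') ∧
      ∀ h ∈ E, (fun h => if h ∈ E then h else τ h) (if h ∈ E' then h else τ h) = h := by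
    intro E E' hE hE'
    refine ⟨fun h hh => ?_, fun h hh => ?_⟩
    · split_ifs with h1
      · exact h1
      · exact (hE'.mem_or h (hE.ne h hh)).resolve_left h1
    · split_ifs with h1
      · simp [hh]
      · simp [hE.opp_notMem h hh, hτ]
  refine Finset.prod_nbij' (fun h => if h ∈ E' then h else τ h) (fun h => if h ∈ E then h else τ h)
    (key hE hE').1 (key hE' hE).1 (key hE hE').2 (key hE' hE).2 fun h _ => ?_
  split_ifs
  · rfl
  · exact (hp h).symm

theorem NCDiagram.isTransversal {n m : ℕ} (G : NCDiagram n m) :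
    IsTransversal G.opp (Finset.univ.filter fun h => h < G.opp h) := by
  refine ⟨fun h hh => ?_, fun h hh => ?_, fun h hh => ?_⟩
  · simp only [Finset.mem_filter, Finset.mem_univ, true_and] at hh
    exact hh.ne'
  · simp only [Finset.mem_filter, Finset.mem_univ, true_and, G.opp_opp] at hh ⊢
    exact hh.not_gt
  · simp only [Finset.mem_filter, Finset.mem_univ, true_and, G.opp_opp]
    exact (lt_or_gt_of_ne hh).symm

theorem bijective_cycles_of_semiconj {m : ℕ} {σ σ' : Equiv.Perm (Fin m)} (τ : Equiv.Perm (Fin m))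
    (hτ : ∀ h, τ (σ h) = σ' (τ h)) :
    Function.Bijective fun v : Cycles σ => (⟦τ v.out⟧ : Cycles σ') := by
  have h1 : ∀ x y, σ'.SameCycle (τ x) (τ y) ↔ σ.SameCycle x y := by
    intro x y
    constructor
    · intro h
      obtain ⟨k, hk⟩ := h.exists_nat_pow_eq
      rw [pow_semiconj hτ, τ.injective.eq_iff] at hk
      exact ⟨k, by simpa using hk⟩
    · intro h
      obtain ⟨k, hk⟩ := h.exists_nat_pow_eq
      exact ⟨k, by rw [zpow_natCast, pow_semiconj hτ, hk]⟩
  constructor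
  · intro v w h
    have h2 : σ'.SameCycle (τ v.out) (τ w.out) := Quotient.exact h
    exact Quotient.out_equiv_out.1 ((h1 _ _).1 h2)
  · intro w
    refine ⟨⟦τ.symm w.out⟧, ?_⟩
    have h2 : σ.SameCycle (⟦τ.symm w.out⟧ : Cycles σ).out (τ.symm w.out) :=
      Quotient.mk_out (s := Equiv.Perm.SameCycle.setoid σ) _
    have h3 := (h1 _ _).2 h2
    rw [Equiv.apply_symm_apply] at h3
    exact (Quotient.sound h3).trans (Quotient.out_eq w)

variable {lam}

/-- Indices are transported along the isomorphism. It need not respect the order of half-edges or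
the representatives of vertices, so the independence of both choices is what is used here. -/
theorem amplitude_eq_of_iso (hf : ContDiff ℝ (⊤ : ℕ∞) (deriv f))
    (hpos : ∀ k l : Fin N, ∃ s : ℝ, 0 < s ∧ divDiff [lam (e k), lam (e l)] (deriv f) = (s : ℂ))
    {A : Finset ι} (hA : ∀ k, e k ∈ A) {n m : ℕ} {G G' : NCDiagram n m} (h : G.Iso G')
    {V : Fin n → ι → ι → ℂ} (hV : ∀ j, SupportedIn A (V j)) :
    G.amplitude f lam e V = G'.amplitude f lam e V := by
  obtain ⟨τ, hn, ho, hl⟩ := h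
  rw [amplitude_eq_ampSum G e hpos hA hV, amplitude_eq_ampSum G' e hpos hA hV, ampSum, ampSum]
  symm
  refine Finset.sum_nbij' (fun i => i ∘ τ) (fun i => i ∘ τ.symm) ?_ ?_ ?_ ?_ ?_
  · intro i hi
    simp only [Fintype.mem_piFinset, Function.comp_apply] at hi ⊢
    exact fun h => hi _
  · intro i hi
    simp only [Fintype.mem_piFinset, Function.comp_apply] at hi ⊢
    exact fun h => hi _
  · intro i _; funext h; simp
  · intro i _; funext h; simp
  · intro i _
    congr 1
    · congr 1
      · rw [prod_cycleDiff lam hf G'.next _ (bijective_cycles_of_semiconj τ hn)]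
        exact Finset.prod_congr rfl fun v _ => cycleDiff_semiconj lam τ.injective hn i v.out
      · have hE : IsTransversal G'.opp
            ((Finset.univ.filter fun h => h < G.opp h).map τ.toEmbedding) := by
          have hG := G.isTransversal
          refine ⟨fun h hh => ?_, fun h hh => ?_, fun h hh => ?_⟩
          · obtain ⟨h, hh', rfl⟩ := Finset.mem_map.1 hh
            rw [Equiv.coe_toEmbedding, ← ho, τ.injective.ne_iff]
            exact hG.ne h hh'
          · obtain ⟨h, hh', rfl⟩ := Finset.mem_map.1 hh
            rw [Equiv.coe_toEmbedding, ← ho]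
            have := hG.opp_notMem h hh'
            simpa using this
          · obtain ⟨h, rfl⟩ := τ.surjective h
            rw [← ho, τ.injective.ne_iff] at hh
            rw [← ho]
            have := hG.mem_or h hh
            simpa using this
        rw [G'.isTransversal.prod_eq G'.opp_opp hE
          fun h => edgeFactor_opp lam e f _ _ i (G'.opp_opp h), Finset.prod_map]
        refine Finset.prod_congr rfl fun h _ => ?_
        simp only [edgeFactor, Equiv.coe_toEmbedding, Function.comp_apply, hn, ho]
    · refine Finset.prod_congr rfl fun j _ => ?_
      simp only [Function.comp_apply, hn, hl]

end Invariance

/-! ### Ring diagrams -/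

theorem finRotate_pow_zero {n : ℕ} (q : ℕ) (hq : q < n + 1) :
    ((finRotate (n + 1)) ^ q) 0 = ⟨q, hq⟩ := by
  induction q with
  | zero => rfl
  | succ q ih =>
    rw [pow_succ', Equiv.Perm.mul_apply, ih (by omega)]
    refine Fin.ext ?_
    rw [coe_finRotate, if_neg]
    simp [Fin.ext_iff]; omega

theorem exists_finRotate_pow_eq {n : ℕ} (i j : Fin n) : ∃ q : ℕ, ((finRotate n) ^ q) i = j := by
  cases n with
  | zero => exact i.elim0
  | succ n =>
    have h : ∀ i : Fin (n + 1), (finRotate (n + 1)).SameCycle 0 i := fun i =>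
      ⟨(i : ℕ), by rw [zpow_natCast]; exact finRotate_pow_zero i i.2⟩
    exact ((h i).symm.trans (h j)).exists_nat_pow_eq

/-! ### Return times and the cyclic order on a set of cuts -/

section Return

variable {n : ℕ} (S : Finset (Fin n))

/-- The number of steps after which the rotation of `Fin n` leads from `j` to `S`. -/
def retTime (j : Fin n) : ℕ := sInf {r | 0 < r ∧ ((finRotate n) ^ r) j ∈ S}

variable {S}

theorem retTime_spec {j : Fin n} (hS : S.Nonempty) :
    0 < retTime S j ∧ ((finRotate n) ^ retTime S j) j ∈ S := by
  refine Nat.sInf_mem (s := {r | 0 < r ∧ ((finRotate n) ^ r) j ∈ S}) ?_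
  obtain ⟨s, hs⟩ := hS
  obtain ⟨q, hq⟩ := exists_finRotate_pow_eq (finRotate n j) s
  refine ⟨q + 1, Nat.succ_pos q, ?_⟩
  rw [pow_succ, Equiv.Perm.mul_apply, hq]
  exact hs

theorem notMem_of_lt_retTime {j : Fin n} {r : ℕ} (h0 : 0 < r) (hr : r < retTime S j) :
    ((finRotate n) ^ r) j ∉ S := fun h => Nat.notMem_of_lt_sInf hr ⟨h0, h⟩

theorem retTime_le {j : Fin n} {r : ℕ} (h0 : 0 < r) (h : ((finRotate n) ^ r) j ∈ S) :
    retTime S j ≤ r := Nat.sInf_le ⟨h0, h⟩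

theorem retTime_eq {j : Fin n} {r : ℕ} (h0 : 0 < r) (h : ((finRotate n) ^ r) j ∈ S)
    (hlt : ∀ s, 0 < s → s < r → ((finRotate n) ^ s) j ∉ S) : retTime S j = r := by
  refine le_antisymm (retTime_le h0 h) (not_lt.1 fun h' => ?_)
  have hS : S.Nonempty := ⟨_, h⟩
  exact hlt _ (retTime_spec hS).1 h' (retTime_spec hS).2

/-- The element of `S` that follows `s` in the cyclic order. -/
def nextCut (s : S) : S := ⟨((finRotate n) ^ retTime S s) s, (retTime_spec ⟨s, s.2⟩).2⟩

/-- Of two distinct elements with the same successor, the one with the longer way would meet the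
other one before reaching it. -/
theorem nextCut_injective : Function.Injective (nextCut (S := S)) := by
  have key : ∀ s t : S, retTime S s ≤ retTime S t → nextCut s = nextCut t → s = t := by
    intro s t hle h
    have h1 : ((finRotate n) ^ retTime S s) s = ((finRotate n) ^ retTime S t) t :=
      congrArg Subtype.val h
    obtain ⟨d, hd⟩ := Nat.exists_eq_add_of_le hle
    rw [hd, pow_add, Equiv.Perm.mul_apply, Equiv.apply_eq_iff_eq] at h1
    by_contra hst
    have hd0 : 0 < d := by
      rcases Nat.eq_zero_or_pos d with h0 | h0
      · subst h0; exact absurd (Subtype.ext h1) hst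
      · exact h0
    have hpos := (retTime_spec (S := S) (j := s) ⟨s, s.2⟩).1
    refine notMem_of_lt_retTime (S := S) (j := (t : Fin n)) hd0 (by omega) ?_
    rw [← h1]; exact s.2
  intro s t h
  rcases le_total (retTime S s) (retTime S t) with hle | hle
  · exact key s t hle h
  · exact (key t s hle h.symm).symm

theorem nextCut_bijective : Function.Bijective (nextCut (S := S)) :=
  Finite.injective_iff_bijective.1 nextCut_injective

/-- The element of `S` that precedes `s` in the cyclic order. -/
def prevCut : S ≃ S := (Equiv.ofBijective nextCut nextCut_bijective).symm

theorem nextCut_prevCut (s : S) : nextCut (prevCut s) = s :=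
  Equiv.ofBijective_apply_symm_apply _ nextCut_bijective s

theorem prevCut_nextCut (s : S) : prevCut (nextCut s) = s :=
  Equiv.ofBijective_symm_apply_apply _ nextCut_bijective s

/-- A subset of `S` closed under passing to the next element is everything. -/
theorem nextCut_induction {P : S → Prop} (s : S) (h0 : P s) (h : ∀ t, P t → P (nextCut t)) (t : S) :
    P t := by
  have key : ∀ (q : ℕ) (s t : S), P s → ((finRotate n) ^ q) (s : Fin n) = t → P t := by
    intro q
    induction q using Nat.strong_induction_on with
    | _ q ih =>
      intro s t hs hq
      rcases Nat.eq_zero_or_pos q with h0 | h0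
      · subst h0
        have : s = t := Subtype.ext hq
        exact this ▸ hs
      · have hle : retTime S s ≤ q := retTime_le h0 (by rw [hq]; exact t.2)
        obtain ⟨d, hd⟩ := Nat.exists_eq_add_of_le hle
        refine ih d ?_ (nextCut s) t (h s hs) ?_
        · have := (retTime_spec (S := S) (j := s) ⟨s, s.2⟩).1
          omega
        · rw [← hq, hd, add_comm, pow_add, Equiv.Perm.mul_apply]; rfl
  obtain ⟨q, hq⟩ := exists_finRotate_pow_eq (s : Fin n) t
  exact key q s t h0 hq

end Return

open Sum in
/-- The diagram `G` is the loop with one vertex for each arc between cyclically consecutive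
elements of `S`. The half-edges are the legs `Θ (inl j)`, and for every `s ∈ S` the two halves
`Θ (inr (inl s))` and `Θ (inr (inr s))` of an edge between the legs `s` and `s + 1`. -/
structure IsRing {n m : ℕ} (G : NCDiagram n m) (S : Finset (Fin n)) (Θ : Fin n ⊕ (S ⊕ S) ≃ Fin m) :
    Prop where
  leg : ∀ j, G.leg j = Θ (inl j)
  opp_out : ∀ s : S, G.opp (Θ (inr (inl s))) = Θ (inr (inr s))
  next_mem : ∀ s : S, G.next (Θ (inl s)) = Θ (inr (inl s))
  next_notMem : ∀ j, j ∉ S → G.next (Θ (inl j)) = Θ (inl (finRotate n j))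
  next_back : ∀ s : S, G.next (Θ (inr (inr s))) = Θ (inl (finRotate n s))
  next_out : ∀ s : S, G.next (Θ (inr (inl (nextCut s)))) = Θ (inr (inr s))

namespace IsRing

open Sum

variable {n m : ℕ} {G : NCDiagram n m} {S : Finset (Fin n)} {Θ : Fin n ⊕ (S ⊕ S) ≃ Fin m}
  (R : IsRing G S Θ)
include R

theorem opp_back (s : S) : G.opp (Θ (inr (inr s))) = Θ (inr (inl s)) := by
  rw [← R.opp_out, G.opp_opp]

theorem opp_leg (j : Fin n) : G.opp (Θ (inl j)) = Θ (inl j) := by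
  rw [G.opp_eq_self_iff, ← R.leg]; exact ⟨j, rfl⟩

theorem next_out' (s : S) : G.next (Θ (inr (inl s))) = Θ (inr (inr (prevCut s))) := by
  rw [← R.next_out, nextCut_prevCut]

/-- The vertex between `s` and `nextCut s` consists, in clockwise order, of the half-edge `inr (inr
s)`, the legs after `s` up to the next cut, and the half-edge `inr (inl (nextCut s))`. Periods and
cycles of `next` are read off from this walk. -/
theorem next_pow_of_le (s : S) {t : ℕ} (h0 : 0 < t) (ht : t ≤ retTime S s) :
    (G.next ^ t) (Θ (inr (inr s))) = Θ (inl (((finRotate n) ^ t) (s : Fin n))) := by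
  induction t with
  | zero => exact absurd h0 (lt_irrefl _)
  | succ t ih =>
    rw [pow_succ', Equiv.Perm.mul_apply]
    rcases Nat.eq_zero_or_pos t with h1 | h1
    · subst h1; simpa using R.next_back s
    · rw [ih h1 (by omega), R.next_notMem _ (notMem_of_lt_retTime h1 (by omega)), pow_succ',
        Equiv.Perm.mul_apply]

theorem next_pow_succ (s : S) :
    (G.next ^ (retTime S s + 1)) (Θ (inr (inr s))) = Θ (inr (inl (nextCut s))) := by
  rw [pow_succ', Equiv.Perm.mul_apply,
    R.next_pow_of_le s (retTime_spec ⟨s, s.2⟩).1 le_rfl]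
  exact R.next_mem (nextCut s)

theorem next_pow_add_two (s : S) :
    (G.next ^ (retTime S s + 2)) (Θ (inr (inr s))) = Θ (inr (inr s)) := by
  rw [pow_succ', Equiv.Perm.mul_apply, R.next_pow_succ, R.next_out]

theorem minimalPeriod_back (s : S) :
    Function.minimalPeriod G.next (Θ (inr (inr s))) = retTime S s + 2 := by
  have hper : Function.IsPeriodicPt G.next (retTime S s + 2) (Θ (inr (inr s))) := by
    rw [Function.IsPeriodicPt, Function.IsFixedPt, Equiv.Perm.iterate_eq_pow, R.next_pow_add_two]
  have hle := hper.minimalPeriod_le (by omega)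
  have hpos := minimalPeriod_perm_pos G.next (Θ (inr (inr s)))
  have heq := perm_pow_minimalPeriod G.next (Θ (inr (inr s)))
  by_contra hne
  rcases Nat.lt_or_ge (retTime S s) (Function.minimalPeriod G.next (Θ (inr (inr s)))) with h | h
  · have h1 : Function.minimalPeriod G.next (Θ (inr (inr s))) = retTime S s + 1 := by omega
    rw [h1, R.next_pow_succ, EmbeddingLike.apply_eq_iff_eq] at heq
    simp at heq
  · rw [R.next_pow_of_le s hpos h, EmbeddingLike.apply_eq_iff_eq] at heq
    simp at heq

theorem back_of_sameCycle {s t : S}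
    (h : G.next.SameCycle (Θ (inr (inr s))) (Θ (inr (inr t)))) : s = t := by
  obtain ⟨k, hk⟩ := h.exists_nat_pow_eq
  rw [← Equiv.Perm.iterate_eq_pow, ← Function.iterate_mod_minimalPeriod_eq,
    Equiv.Perm.iterate_eq_pow] at hk
  have hlt := Nat.mod_lt k (minimalPeriod_perm_pos G.next (Θ (inr (inr s))))
  set r := k % Function.minimalPeriod G.next (Θ (inr (inr s)))
  rw [R.minimalPeriod_back] at hlt
  rcases Nat.eq_zero_or_pos r with h0 | h0
  · rw [h0, pow_zero, Equiv.Perm.one_apply, EmbeddingLike.apply_eq_iff_eq] at hk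
    simpa using hk
  · rcases Nat.lt_or_ge (retTime S s) r with h1 | h1
    · have h2 : r = retTime S s + 1 := by omega
      rw [h2, R.next_pow_succ, EmbeddingLike.apply_eq_iff_eq] at hk
      simp at hk
    · rw [R.next_pow_of_le s h0 h1, EmbeddingLike.apply_eq_iff_eq] at hk
      simp at hk

theorem sameCycle_out (s : S) :
    G.next.SameCycle (Θ (inr (inl s))) (Θ (inr (inr (prevCut s)))) :=
  ⟨1, by rw [zpow_one, R.next_out']⟩

theorem exists_sameCycle_leg (hS : S.Nonempty) (j : Fin n) :
    ∃ s : S, G.next.SameCycle (Θ (inl j)) (Θ (inr (inr s))) := by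
  have key : ∀ (q : ℕ) (j : Fin n), ((finRotate n) ^ q) j ∈ S →
      ∃ s : S, G.next.SameCycle (Θ (inl j)) (Θ (inr (inr s))) := by
    intro q
    induction q with
    | zero =>
      intro j hj
      refine ⟨prevCut ⟨j, hj⟩, Equiv.Perm.SameCycle.trans ⟨1, ?_⟩ (R.sameCycle_out _)⟩
      rw [zpow_one]; exact R.next_mem ⟨j, hj⟩
    | succ q ih =>
      intro j hj
      by_cases h : j ∈ S
      · refine ⟨prevCut ⟨j, h⟩, Equiv.Perm.SameCycle.trans ⟨1, ?_⟩ (R.sameCycle_out _)⟩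
        rw [zpow_one]; exact R.next_mem ⟨j, h⟩
      · rw [pow_succ, Equiv.Perm.mul_apply] at hj
        obtain ⟨s, hs⟩ := ih _ hj
        refine ⟨s, Equiv.Perm.SameCycle.trans ⟨1, ?_⟩ hs⟩
        rw [zpow_one]; exact R.next_notMem j h
  exact key (retTime S j) j (retTime_spec hS).2

theorem exists_sameCycle (hS : S.Nonempty) (h : Fin m) :
    ∃ s : S, G.next.SameCycle h (Θ (inr (inr s))) := by
  obtain ⟨x, rfl⟩ := Θ.surjective h
  rcases x with j | s | s
  · exact R.exists_sameCycle_leg hS j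
  · exact ⟨_, R.sameCycle_out s⟩
  · exact ⟨s, Equiv.Perm.SameCycle.refl _ _⟩

theorem bijective_vertices (hS : S.Nonempty) :
    Function.Bijective fun s : S => (⟦Θ (inr (inr s))⟧ : Cycles G.next) := by
  constructor
  · intro s t h
    exact R.back_of_sameCycle (Quotient.exact h)
  · intro v
    obtain ⟨s, hs⟩ := R.exists_sameCycle hS v.out
    refine ⟨s, ?_⟩
    exact (Quotient.sound hs.symm).trans (Quotient.out_eq v)

theorem isTransversal : IsTransversal G.opp
    ((Finset.univ : Finset S).map ((Function.Embedding.inl.trans Function.Embedding.inr).trans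
      Θ.toEmbedding)) := by
  refine ⟨fun h hh => ?_, fun h hh => ?_, fun h hh => ?_⟩
  · obtain ⟨s, -, rfl⟩ := Finset.mem_map.1 hh
    simp [R.opp_out]
  · obtain ⟨s, -, rfl⟩ := Finset.mem_map.1 hh
    simp [R.opp_out]
  · obtain ⟨x, rfl⟩ := Θ.surjective h
    rcases x with j | s | s
    · exact absurd (R.opp_leg j) hh
    · simp
    · simp [R.opp_back]

theorem edges_length : G.edges.length = S.card := by
  have h1 : G.edges.length = (Finset.univ.filter fun h => h < G.opp h).card := by
    rw [NCDiagram.edges, ← List.toFinset_card_of_nodup ((List.nodup_finRange m).filter _)]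
    congr 1
    ext h
    simp
  -- With the constant factor `2` the independence of the transversal compares cardinalities as
  -- exponents.
  have h2 := G.isTransversal.prod_eq G.opp_opp R.isTransversal (p := fun _ => 2) fun _ => rfl
  rw [Finset.prod_const, Finset.prod_const, Finset.card_map, Finset.card_univ,
    Fintype.card_coe] at h2
  rw [h1]
  exact Nat.pow_right_injective le_rfl (by exact_mod_cast h2)

theorem card_vertices (hS : S.Nonempty) : Nat.card (Cycles G.next) = S.card := by
  rw [← Nat.card_eq_of_bijective _ (R.bijective_vertices hS)]
  simp

theorem face_leg_notMem {j : Fin n} (hj : j ∉ S) :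
    G.face (Θ (inl j)) = Θ (inl (finRotate n j)) := by
  rw [NCDiagram.face, Equiv.Perm.mul_apply, R.opp_leg, R.next_notMem j hj]

theorem face_leg_mem (s : S) : G.face (Θ (inl s)) = Θ (inr (inl s)) := by
  rw [NCDiagram.face, Equiv.Perm.mul_apply, R.opp_leg, R.next_mem]

theorem face_out (s : S) : G.face (Θ (inr (inl s))) = Θ (inl (finRotate n s)) := by
  rw [NCDiagram.face, Equiv.Perm.mul_apply, R.opp_out, R.next_back]

theorem face_back (s : S) : G.face (Θ (inr (inr s))) = Θ (inr (inr (prevCut s))) := by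
  rw [NCDiagram.face, Equiv.Perm.mul_apply, R.opp_back, R.next_out']

theorem face_sameCycle_leg (j : Fin n) :
    G.face.SameCycle (Θ (inl j)) (Θ (inl (finRotate n j))) := by
  by_cases h : j ∈ S
  · exact ⟨2, by
      rw [← Nat.cast_ofNat, zpow_natCast, pow_two, Equiv.Perm.mul_apply, R.face_leg_mem ⟨j, h⟩,
        R.face_out]⟩
  · exact ⟨1, by rw [zpow_one, R.face_leg_notMem h]⟩

theorem face_sameCycle_legs (i j : Fin n) : G.face.SameCycle (Θ (inl i)) (Θ (inl j)) := by
  obtain ⟨q, rfl⟩ := exists_finRotate_pow_eq i j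
  induction q with
  | zero => exact Equiv.Perm.SameCycle.refl _ _
  | succ q ih =>
    rw [pow_succ', Equiv.Perm.mul_apply]
    exact ih.trans (R.face_sameCycle_leg _)

theorem face_sameCycle_backs (s t : S) :
    G.face.SameCycle (Θ (inr (inr s))) (Θ (inr (inr t))) := by
  refine nextCut_induction (P := fun t => G.face.SameCycle (Θ (inr (inr s))) (Θ (inr (inr t)))) s
    (Equiv.Perm.SameCycle.refl _ _) (fun t ht => ht.trans (Equiv.Perm.SameCycle.symm ⟨1, ?_⟩)) t
  rw [zpow_one, R.face_back, prevCut_nextCut]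

theorem not_face_sameCycle (j : Fin n) (s : S) :
    ¬ G.face.SameCycle (Θ (inr (inr s))) (Θ (inl j)) := by
  intro h
  obtain ⟨k, hk⟩ := h.exists_nat_pow_eq
  have key : ∀ k : ℕ, ∃ t : S, (G.face ^ k) (Θ (inr (inr s))) = Θ (inr (inr t)) := by
    intro k
    induction k with
    | zero => exact ⟨s, rfl⟩
    | succ k ih =>
      obtain ⟨t, ht⟩ := ih
      exact ⟨prevCut t, by rw [pow_succ', Equiv.Perm.mul_apply, ht, R.face_back]⟩
  obtain ⟨t, ht⟩ := key k
  rw [ht, EmbeddingLike.apply_eq_iff_eq] at hk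
  simp at hk

/-- The outer face runs through all legs and the half-edges `inr (inl s)`; the inner face runs
through the half-edges `inr (inr s)`, backwards in the order of the cuts. -/
theorem card_faces (hS : S.Nonempty) : Nat.card (Cycles G.face) = 2 := by
  obtain ⟨s, hs⟩ := hS
  have h : Function.Bijective fun b : Bool =>
      (⟦if b then Θ (inl s) else Θ (inr (inr ⟨s, hs⟩))⟧ : Cycles G.face) := by
    constructor
    · intro b c hbc
      have h1 : G.face.SameCycle _ _ := Quotient.exact hbc
      cases b <;> cases c
      · rfl
      · exact absurd h1 (R.not_face_sameCycle _ _)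
      · exact absurd h1.symm (R.not_face_sameCycle _ _)
      · rfl
    · intro v
      obtain ⟨x, hx⟩ := Θ.surjective v.out
      have h1 : v = ⟦Θ x⟧ := by rw [hx]; exact (Quotient.out_eq v).symm
      rcases x with j | t | t
      · exact ⟨true, h1 ▸ Quotient.sound (R.face_sameCycle_legs s j)⟩
      · refine ⟨true, h1 ▸ Quotient.sound ((R.face_sameCycle_legs s t).trans ⟨1, ?_⟩)⟩
        rw [zpow_one, R.face_leg_mem]
      · exact ⟨false, h1 ▸ Quotient.sound (R.face_sameCycle_backs _ t)⟩
  rw [← Nat.card_eq_of_bijective _ h]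
  simp

/-- Without the edge at `s₀` the ring opens into a chain from the leg after `s₀` around to `s₀`.
Connectedness and irreducibility both follow. -/
theorem connectedVia_of_edge (s₀ : S) (keep : Fin m → Prop)
    (hkeep : ∀ s, s ≠ s₀ → keep (Θ (inr (inl s)))) : G.ConnectedVia keep := by
  set r : Fin m → Fin m → Prop := fun x y => y = G.next x ∨ (keep x ∧ y = G.opp x)
  have hstep : ∀ j : Fin n, j ≠ s₀ →
      Relation.EqvGen r (Θ (inl j)) (Θ (inl (finRotate n j))) := by
    intro j hj
    by_cases h : j ∈ S
    · have h1 : Relation.EqvGen r (Θ (inl j)) (Θ (inr (inl ⟨j, h⟩))) :=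
        .rel _ _ (Or.inl (R.next_mem ⟨j, h⟩).symm)
      have h2 : Relation.EqvGen r (Θ (inr (inl ⟨j, h⟩))) (Θ (inr (inr ⟨j, h⟩))) :=
        .rel _ _ (Or.inr ⟨hkeep _ fun h' => hj (congrArg Subtype.val h'), (R.opp_out _).symm⟩)
      have h3 : Relation.EqvGen r (Θ (inr (inr ⟨j, h⟩))) (Θ (inl (finRotate n j))) :=
        .rel _ _ (Or.inl (R.next_back ⟨j, h⟩).symm)
      exact (h1.trans _ _ _ h2).trans _ _ _ h3
    · exact .rel _ _ (Or.inl (R.next_notMem j h).symm)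
  have hpath : ∀ q : ℕ, (∀ t < q, ((finRotate n) ^ t) (finRotate n s₀) ≠ s₀) →
      Relation.EqvGen r (Θ (inl (finRotate n s₀)))
        (Θ (inl (((finRotate n) ^ q) (finRotate n s₀)))) := by
    intro q
    induction q with
    | zero => intro _; exact .refl _
    | succ q ih =>
      intro hq
      rw [pow_succ', Equiv.Perm.mul_apply]
      exact (ih fun t ht => hq t (by omega)).trans _ _ _ (hstep _ (hq q (by omega)))
  have hleg : ∀ j : Fin n, Relation.EqvGen r (Θ (inl (finRotate n s₀))) (Θ (inl j)) := by
    intro j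
    have hex := exists_finRotate_pow_eq (finRotate n s₀) j
    classical
    have h1 := Nat.find_spec hex
    -- The shortest walk to `j` does not pass through `s₀` before its end: the step after `s₀` would
    -- lead back to the starting leg, so `j` would have been reached earlier.
    have h2 := hpath (Nat.find hex) fun t ht hts => by
      refine Nat.find_min hex (m := Nat.find hex - (t + 1)) (by omega) ?_
      have h3 : Nat.find hex = (Nat.find hex - (t + 1)) + 1 + t := by omega
      rw [h3, pow_add, Equiv.Perm.mul_apply, hts, pow_add, pow_one, Equiv.Perm.mul_apply] at h1
      exact h1
    rwa [h1] at h2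
  have hall : ∀ h, Relation.EqvGen r (Θ (inl (finRotate n s₀))) h := by
    intro h
    obtain ⟨x, rfl⟩ := Θ.surjective h
    rcases x with j | t | t
    · exact hleg j
    · exact (hleg t).trans _ _ _ (.rel _ _ (Or.inl (R.next_mem t).symm))
    · exact (hleg _).trans _ _ _ (.symm _ _ (.rel _ _ (Or.inl (R.next_back t).symm)))
  exact fun h h' => (Relation.EqvGen.symm _ _ (hall h)).trans _ _ _ (hall h')

theorem relevant (hS : S.Nonempty) : G.Relevant where
  connected := by
    obtain ⟨s, hs⟩ := hS
    exact R.connectedVia_of_edge ⟨s, hs⟩ _ fun _ _ => trivial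
  planar := by
    rw [R.card_vertices hS, R.edges_length, R.card_faces hS]; simp
  oneLoop := by
    rw [NCDiagram.loopOrder, R.card_vertices hS, R.edges_length]; simp
  irreducible := by
    intro h hh
    obtain ⟨x, rfl⟩ := Θ.surjective h
    rcases x with j | s | s
    · exact absurd (R.opp_leg j) hh
    · refine R.connectedVia_of_edge s _ fun t ht => ?_
      simp [R.opp_out, ht]
    · refine R.connectedVia_of_edge s _ fun t ht => ?_
      simp [R.opp_back, ht]
  degree := by
    intro h
    have h1 : ∀ (q : ℕ) x, Function.minimalPeriod G.next ((G.next ^ q) x) =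
        Function.minimalPeriod G.next x := fun q x => by
      rw [← Equiv.Perm.iterate_eq_pow]
      exact Function.minimalPeriod_apply_iterate (G.next.injective.mem_periodicPts x) q
    obtain ⟨s, hs⟩ := R.exists_sameCycle hS h
    obtain ⟨q, hq⟩ := hs.symm.exists_nat_pow_eq
    rw [← hq, h1, R.minimalPeriod_back]
    have := (retTime_spec (S := S) (j := s) hS).1
    omega
  marked := by
    intro j
    have hrange : ∀ s : S, Θ (inr (inl s)) ∉ Set.range G.leg := by
      rintro s ⟨i, hi⟩
      rw [R.leg, EmbeddingLike.apply_eq_iff_eq] at hi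
      simp at hi
    by_cases h : j ∈ S
    · refine ⟨2, two_pos, ?_, fun s h0 h2 => ?_⟩
      · rw [R.leg, R.leg, pow_two, Equiv.Perm.mul_apply, R.face_leg_mem ⟨j, h⟩, R.face_out]
      · obtain rfl : s = 1 := by omega
        rw [R.leg, pow_one, R.face_leg_mem ⟨j, h⟩]
        exact hrange _
    · refine ⟨1, one_pos, ?_, fun s h0 h2 => by omega⟩
      rw [R.leg, R.leg, pow_one, R.face_leg_notMem h]

end IsRing

open Sum in
/-- The permutation `next` of the ring diagram with cuts `S`. -/
def ringNext {n : ℕ} (S : Finset (Fin n)) : Equiv.Perm (Fin n ⊕ (S ⊕ S)) :=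
  Equiv.ofBijective (fun x => match x with
    | inl j => if h : j ∈ S then inr (inl ⟨j, h⟩) else inl (finRotate n j)
    | inr (inl s) => inr (inr (prevCut s))
    | inr (inr s) => inl (finRotate n s)) <| Finite.injective_iff_bijective.1 <| by
  rintro (i | s | s) (j | t | t) h
  · dsimp only at h
    split_ifs at h with h1 h2 h2
    · simpa using h
    · simpa using h
  · dsimp only at h; split_ifs at h; simp at h
  · dsimp only at h
    split_ifs at h with h1
    rw [inl.injEq, EmbeddingLike.apply_eq_iff_eq] at h
    exact absurd (h ▸ t.2) h1
  · dsimp only at h; split_ifs at h; simp at h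
  · simpa using h
  · simp at h
  · dsimp only at h
    split_ifs at h with h1
    rw [inl.injEq, EmbeddingLike.apply_eq_iff_eq] at h
    exact absurd (h ▸ s.2) h1
  · simp at h
  · rw [Subtype.ext ((finRotate n).injective (inl.inj h))]

open Sum in
/-- For every set `S` of cuts there is a ring diagram. -/
theorem exists_isRing {n : ℕ} (S : Finset (Fin n)) :
    ∃ (m : ℕ) (G : NCDiagram n m) (Θ : Fin n ⊕ (S ⊕ S) ≃ Fin m), IsRing G S Θ := by
  let Θ := Fintype.equivFin (Fin n ⊕ (S ⊕ S))
  let G : NCDiagram n (Fintype.card (Fin n ⊕ (S ⊕ S))) :=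
    { next := Θ.permCongr (ringNext S)
      opp := Θ.permCongr (Equiv.sumCongr (Equiv.refl _) (Equiv.sumComm S S))
      leg := Function.Embedding.inl.trans Θ.toEmbedding
      opp_opp := fun h => by
        obtain ⟨x, rfl⟩ := Θ.surjective h
        rcases x with j | s | s <;> simp
      opp_eq_self_iff := fun h => by
        obtain ⟨x, rfl⟩ := Θ.surjective h
        rcases x with j | s | s <;> simp }
  refine ⟨_, G, Θ, ⟨fun j => rfl, fun s => ?_, fun s => ?_, fun j hj => ?_, fun s => ?_,
    fun s => ?_⟩⟩
  · simp [G]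
  · simp [G, ringNext]
  · simp [G, ringNext, hj]
  · simp [G, ringNext]
  · simp [G, ringNext, prevCut_nextCut]

open Sum in
theorem IsRing.iso {n m : ℕ} {G G' : NCDiagram n m} {S : Finset (Fin n)}
    {Θ Θ' : Fin n ⊕ (S ⊕ S) ≃ Fin m} (R : IsRing G S Θ) (R' : IsRing G' S Θ') : G.Iso G' := by
  refine ⟨Θ.symm.trans Θ', fun h => ?_, fun h => ?_, fun j => ?_⟩
  · obtain ⟨x, rfl⟩ := Θ.surjective h
    rcases x with j | s | s
    · by_cases hj : j ∈ S
      · have h1 := R.next_mem ⟨j, hj⟩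
        have h2 := R'.next_mem ⟨j, hj⟩
        dsimp only at h1 h2
        simp [h1, h2]
      · simp [R.next_notMem j hj, R'.next_notMem j hj]
    · simp [R.next_out', R'.next_out']
    · simp [R.next_back, R'.next_back]
  · obtain ⟨x, rfl⟩ := Θ.surjective h
    rcases x with j | s | s
    · simp [R.opp_leg, R'.opp_leg]
    · simp [R.opp_out, R'.opp_out]
    · simp [R.opp_back, R'.opp_back]
  · simp [R.leg, R'.leg]

/-- The cuts are expressed by `next`, `opp` and `leg` alone, which makes them an isomorphism
invariant. -/
theorem IsRing.mem_iff {n m : ℕ} {G : NCDiagram n m} {S : Finset (Fin n)}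
    {Θ : Fin n ⊕ (S ⊕ S) ≃ Fin m} (R : IsRing G S Θ) (j : Fin n) :
    j ∈ S ↔ G.opp (G.next (G.leg j)) ≠ G.next (G.leg j) := by
  by_cases hj : j ∈ S
  · have h1 := R.next_mem ⟨j, hj⟩
    dsimp only at h1
    simp [hj, R.leg, h1, R.opp_out]
  · simp [hj, R.leg, R.next_notMem j hj, R.opp_leg]

theorem IsRing.cuts_eq {n m : ℕ} {G G' : NCDiagram n m} {S S' : Finset (Fin n)}
    {Θ : Fin n ⊕ (S ⊕ S) ≃ Fin m} {Θ' : Fin n ⊕ (S' ⊕ S') ≃ Fin m} (R : IsRing G S Θ)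
    (R' : IsRing G' S' Θ') (h : G.Iso G') : S = S' := by
  obtain ⟨τ, hn, ho, hl⟩ := h
  ext j
  rw [R.mem_iff, R'.mem_iff, ← hl, ← hn, ← ho, τ.injective.ne_iff]

/-! ### Classification of the relevant diagrams -/

namespace NCDiagram

variable {n m : ℕ} {G : NCDiagram n m}

theorem next_sameCycle (x : Fin m) : G.next.SameCycle x (G.next x) := ⟨1, by simp⟩

theorem next_symm_sameCycle (x : Fin m) : G.next.SameCycle x (G.next.symm x) :=
  Equiv.Perm.SameCycle.symm ⟨1, by simp⟩

theorem card_internal (G : NCDiagram n m) :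
    (Finset.univ.filter fun h => G.opp h ≠ h).card = 2 * G.edges.length := by
  have h1 : G.edges.length = (Finset.univ.filter fun h => h < G.opp h).card := by
    rw [NCDiagram.edges, ← List.toFinset_card_of_nodup ((List.nodup_finRange m).filter _)]
    congr 1
    ext h
    simp
  have h2 : Finset.univ.filter (fun h => G.opp h ≠ h) = Finset.univ.filter (fun h => h < G.opp h) ∪
      (Finset.univ.filter fun h => h < G.opp h).map G.opp.toEmbedding := by
    ext h
    simp only [Finset.mem_filter, Finset.mem_univ, true_and, Finset.mem_union, Finset.mem_map,
      Equiv.coe_toEmbedding]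
    constructor
    · intro hh
      rcases lt_or_gt_of_ne hh with h3 | h3
      · exact Or.inr ⟨G.opp h, by rwa [G.opp_opp], G.opp_opp h⟩
      · exact Or.inl h3
    · rintro (h3 | ⟨x, h3, rfl⟩)
      · exact h3.ne'
      · rw [G.opp_opp]; exact h3.ne
  rw [h2, Finset.card_union_of_disjoint, Finset.card_map, h1, two_mul]
  rw [Finset.disjoint_left]
  intro h h3 h4
  obtain ⟨x, h5, rfl⟩ := Finset.mem_map.1 h4
  simp only [Finset.mem_filter, Finset.mem_univ, true_and, Equiv.coe_toEmbedding, G.opp_opp] at h3 h5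
  exact absurd h5 h3.not_gt

/-- The internal half-edges at a vertex. -/
def internalAt (G : NCDiagram n m) (v : Cycles G.next) : Finset (Fin m) :=
  Finset.univ.filter fun h => G.opp h ≠ h ∧ ⟦h⟧ = v

theorem mem_internalAt {v : Cycles G.next} {h : Fin m} :
    h ∈ G.internalAt v ↔ G.opp h ≠ h ∧ ⟦h⟧ = v := by simp [internalAt]

/-- If a vertex has at most one internal half-edge, removing that edge isolates the vertex. -/
theorem mem_vertex_of_connectedVia {keep : Fin m → Prop} (hc : G.ConnectedVia keep)
    {v : Cycles G.next} (hv : ∀ h, keep h → G.opp h ≠ h → (⟦h⟧ : Cycles G.next) ≠ v ∧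
      (⟦G.opp h⟧ : Cycles G.next) ≠ v) (h : Fin m) : (⟦h⟧ : Cycles G.next) = v := by
  have key : ∀ x y, Relation.EqvGen (fun x y => y = G.next x ∨ (keep x ∧ y = G.opp x)) x y →
      ((⟦x⟧ : Cycles G.next) = v ↔ (⟦y⟧ : Cycles G.next) = v) := by
    intro x y hxy
    induction hxy with
    | rel x y h =>
      rcases h with rfl | ⟨hk, rfl⟩
      · have : (⟦x⟧ : Cycles G.next) = ⟦G.next x⟧ := Quotient.sound (next_sameCycle x)
        rw [this]
      · by_cases hx : G.opp x = x
        · rw [hx]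
        · have := hv x hk hx
          simp [this.1, this.2]
    | refl x => rfl
    | symm x y _ ih => exact ih.symm
    | trans x y z _ _ ih1 ih2 => exact ih1.trans ih2
  exact (key v.out h (hc _ _)).1 (Quotient.out_eq v)

namespace Relevant

variable (hG : G.Relevant)
include hG

theorem card_vertices_eq : Fintype.card (Cycles G.next) = G.edges.length := by
  have h := hG.oneLoop
  rw [loopOrder, Nat.card_eq_fintype_card] at h
  omega

/-- A vertex without internal half-edges would be the whole diagram, although there are as many
edges as vertices. A vertex with a single one would be isolated by removing its edge, so by
irreducibility it would be everything, and the other end of the edge would be a second internal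
half-edge there. -/
theorem two_le_card_internalAt (v : Cycles G.next) : 2 ≤ (G.internalAt v).card := by
  by_contra hlt
  have hpos : 0 < G.edges.length := by
    rw [← hG.card_vertices_eq]; exact Fintype.card_pos_iff.2 ⟨v⟩
  rcases Nat.eq_zero_or_pos (G.internalAt v).card with h0 | h0
  · rw [Finset.card_eq_zero] at h0
    have hv : ∀ h, G.opp h ≠ h → (⟦h⟧ : Cycles G.next) ≠ v := fun h hh hv => by
      have : h ∈ G.internalAt v := mem_internalAt.2 ⟨hh, hv⟩
      rw [h0] at this
      exact absurd this (Finset.notMem_empty h)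
    have hall := mem_vertex_of_connectedVia hG.connected (v := v) fun h _ hh =>
      ⟨hv h hh, hv _ (by rw [G.opp_opp]; exact hh.symm)⟩
    have h1 : (Finset.univ.filter fun h => G.opp h ≠ h).card = 0 := by
      rw [Finset.card_eq_zero, Finset.filter_eq_empty_iff]
      exact fun h _ hh => hv h hh (hall h)
    rw [G.card_internal] at h1
    omega
  · obtain ⟨h, hh⟩ := Finset.card_eq_one.1 (show (G.internalAt v).card = 1 by omega)
    have hv : ∀ x, G.opp x ≠ x → (⟦x⟧ : Cycles G.next) = v → x = h := fun x hx hxv => by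
      have : x ∈ G.internalAt v := mem_internalAt.2 ⟨hx, hxv⟩
      rw [hh] at this
      exact Finset.mem_singleton.1 this
    have hmem : h ∈ G.internalAt v := by rw [hh]; exact Finset.mem_singleton_self h
    have hne := (mem_internalAt.1 hmem).1
    have hall := mem_vertex_of_connectedVia (hG.irreducible h hne) (v := v) fun x hk hx =>
      ⟨fun hxv => hk.1 (hv x hx hxv), fun hxv => hk.2 (by
        rw [← hv (G.opp x) (by rw [G.opp_opp]; exact hx.symm) hxv, G.opp_opp])⟩
    exact hne (hv (G.opp h) (by rw [G.opp_opp]; exact hne.symm) (hall _))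

/-- Double counting: there are `2E = 2V` internal half-edges and each of the `V` vertices has at
least two. -/
theorem card_internalAt (v : Cycles G.next) : (G.internalAt v).card = 2 := by
  have h1 : (Finset.univ.filter fun h => G.opp h ≠ h).card =
      ∑ v : Cycles G.next, (G.internalAt v).card := by
    rw [Finset.card_eq_sum_card_fiberwise (f := fun h => (⟦h⟧ : Cycles G.next))
      (t := Finset.univ) (fun _ _ => Finset.mem_univ _)]
    refine Finset.sum_congr rfl fun v _ => ?_
    rw [internalAt, Finset.filter_filter]
  have h2 : ∑ v : Cycles G.next, (G.internalAt v).card = ∑ _v : Cycles G.next, 2 := by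
    rw [← h1, G.card_internal, Finset.sum_const, Finset.card_univ, hG.card_vertices_eq,
      smul_eq_mul, mul_comm]
  exact ((Finset.sum_eq_sum_iff_of_le fun v _ => hG.two_le_card_internalAt v).1 h2.symm v
    (Finset.mem_univ v)).symm

theorem not_three_internal {x y z : Fin m} (hx : G.opp x ≠ x) (hy : G.opp y ≠ y)
    (hz : G.opp z ≠ z) (hxy : G.next.SameCycle x y) (hxz : G.next.SameCycle x z) (h1 : x ≠ y)
    (h2 : y ≠ z) (h3 : x ≠ z) : False := by
  have hsub : ({x, y, z} : Finset (Fin m)) ⊆ G.internalAt ⟦x⟧ := by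
    intro w hw
    simp only [Finset.mem_insert, Finset.mem_singleton] at hw
    rcases hw with rfl | rfl | rfl
    · exact mem_internalAt.2 ⟨hx, rfl⟩
    · exact mem_internalAt.2 ⟨hy, Quotient.sound hxy.symm⟩
    · exact mem_internalAt.2 ⟨hz, Quotient.sound hxz.symm⟩
  have := Finset.card_le_card hsub
  rw [hG.card_internalAt, Finset.card_eq_three.2 ⟨x, y, z, h1, h3, h2, rfl⟩] at this
  omega

theorem next_ne (x : Fin m) : G.next x ≠ x := fun h => by
  have h1 : Function.IsPeriodicPt G.next 1 x := h
  have := hG.degree x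
  have := h1.minimalPeriod_le one_pos
  omega

theorem next_symm_ne (x : Fin m) : G.next.symm x ≠ x := fun h => by
  refine hG.next_ne x ?_
  conv_lhs => rw [← h, Equiv.apply_symm_apply]

theorem next_symm_ne_next (x : Fin m) : G.next.symm x ≠ G.next x := fun h => by
  have h1 : Function.IsPeriodicPt G.next 2 x := by
    change G.next (G.next x) = x
    rw [← h, Equiv.apply_symm_apply]
  have := hG.degree x
  have := h1.minimalPeriod_le two_pos
  omega

/-- Since the degree is at least `3`, three consecutive half-edges are distinct, while a vertex has
only two internal ones. Most of the local structure below is deduced from this. -/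
theorem not_three_consecutive {x : Fin m} (h1 : G.opp (G.next.symm x) ≠ G.next.symm x)
    (h2 : G.opp x ≠ x) (h3 : G.opp (G.next x) ≠ G.next x) : False :=
  hG.not_three_internal h2 h1 h3 (next_symm_sameCycle x) (next_sameCycle x)
    (hG.next_symm_ne x).symm (hG.next_symm_ne_next x) (hG.next_ne x).symm

/-- Without legs every half-edge would be internal, against `not_three_consecutive`; that there is a
half-edge at all follows from the existence of faces. -/
theorem legs_pos : 0 < n := by
  by_contra hn
  have hn0 : n = 0 := by omega
  subst hn0
  have hint : ∀ h, G.opp h ≠ h := fun h hh => by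
    obtain ⟨j, -⟩ := (G.opp_eq_self_iff h).1 hh
    exact j.elim0
  have hp := hG.planar
  have h1 := hG.card_vertices_eq
  rw [Nat.card_eq_fintype_card, h1, sub_self, zero_add] at hp
  have h2 : 0 < Nat.card (Cycles G.face) := by omega
  obtain ⟨v⟩ := (Nat.card_pos_iff.1 h2).1
  exact hG.not_three_consecutive (hint _) (hint v.out) (hint _)

/-- The half-edges on the boundary of the inside of the loop. -/
def Inner (j₀ : Fin n) (h : Fin m) : Prop := ¬ G.face.SameCycle (G.leg j₀) h

variable (j₀ : Fin n)

theorem not_inner_leg (j : Fin n) : ¬ Inner (G := G) j₀ (G.leg j) := by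
  rw [Inner, not_not]
  obtain ⟨q, rfl⟩ := exists_finRotate_pow_eq j₀ j
  induction q with
  | zero => exact Equiv.Perm.SameCycle.refl _ _
  | succ q ih =>
    refine ih.trans ?_
    obtain ⟨r, -, hr, -⟩ := hG.marked (((finRotate n) ^ q) j₀)
    rw [pow_succ', Equiv.Perm.mul_apply, ← hr]
    exact ⟨r, by rw [zpow_natCast]⟩

variable {j₀}

theorem internal_of_inner {h : Fin m} (hh : Inner (G := G) j₀ h) : G.opp h ≠ h := fun h1 => by
  obtain ⟨j, rfl⟩ := (G.opp_eq_self_iff h).1 h1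
  exact hG.not_inner_leg j₀ j hh

omit hG in
theorem inner_face {h : Fin m} : Inner (G := G) j₀ (G.face h) ↔ Inner (G := G) j₀ h := by
  rw [Inner, Inner, Equiv.Perm.sameCycle_apply_right]

/-- Euler's formula with `V = E` leaves exactly two faces, so there is one besides the face of the
leg `j₀`. -/
theorem exists_inner (j₀ : Fin n) : ∃ h, Inner (G := G) j₀ h := by
  have hp := hG.planar
  have h1 := hG.card_vertices_eq
  rw [Nat.card_eq_fintype_card, h1, sub_self, zero_add] at hp
  have h2 : 1 < Nat.card (Cycles G.face) := by omega
  have : Nontrivial (Cycles G.face) := Finite.one_lt_card_iff_nontrivial.1 h2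
  obtain ⟨v, hv⟩ := exists_ne (⟦G.leg j₀⟧ : Cycles G.face)
  refine ⟨v.out, fun h => hv ?_⟩
  exact ((Quotient.sound h).trans (Quotient.out_eq v)).symm

omit hG in
theorem inner_opp_next_symm {h : Fin m} (hh : Inner (G := G) j₀ h) :
    Inner (G := G) j₀ (G.opp (G.next.symm h)) := by
  rw [← inner_face, face, Equiv.Perm.mul_apply, G.opp_opp, Equiv.apply_symm_apply]
  exact hh

theorem internal_next_symm {h : Fin m} (hh : Inner (G := G) j₀ h) :
    G.opp (G.next.symm h) ≠ G.next.symm h := by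
  have := hG.internal_of_inner (inner_opp_next_symm hh)
  rw [G.opp_opp] at this
  exact this.symm

/-- If both halves of an edge were inner, then the predecessor of `opp h`, `opp h` itself and its
successor `face h` would all be internal. -/
theorem not_inner_opp {h : Fin m} (hh : Inner (G := G) j₀ h) : ¬ Inner (G := G) j₀ (G.opp h) := by
  intro hx
  refine hG.not_three_consecutive (hG.internal_next_symm hx) (hG.internal_of_inner hx)
    (hG.internal_of_inner (j₀ := j₀) ?_)
  exact inner_face.2 hh

/-- An inner half-edge and its predecessor are both internal, so they exhaust the internal
half-edges at their vertex. -/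
theorem eq_or_eq_of_sameCycle {x y : Fin m} (hx : G.opp x ≠ x) (hy : Inner (G := G) j₀ y)
    (h : G.next.SameCycle x y) : x = y ∨ x = G.next.symm y := by
  by_contra hne
  rw [not_or] at hne
  exact hG.not_three_internal hx (hG.internal_of_inner hy) (hG.internal_next_symm hy) h
    (h.trans (next_symm_sameCycle y)) hne.1 (hG.next_symm_ne y).symm hne.2

/-- The inside touches every vertex: crossing an edge from a vertex with an inner half-edge leads to
another such vertex, and the diagram is connected. -/
theorem exists_inner_sameCycle (j₀ : Fin n) (h : Fin m) :
    ∃ y, Inner (G := G) j₀ y ∧ G.next.SameCycle h y := by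
  have hopp : ∀ x, (∃ y, Inner (G := G) j₀ y ∧ G.next.SameCycle x y) →
      ∃ y, Inner (G := G) j₀ y ∧ G.next.SameCycle (G.opp x) y := by
    rintro x ⟨y, hy, hxy⟩
    by_cases hx : G.opp x = x
    · exact ⟨y, hy, by rwa [hx]⟩
    rcases hG.eq_or_eq_of_sameCycle hx hy hxy with rfl | rfl
    · exact ⟨G.face x, inner_face.2 hy, next_sameCycle _⟩
    · exact ⟨_, inner_opp_next_symm hy, Equiv.Perm.SameCycle.refl _ _⟩
  have key : ∀ x y, Relation.EqvGen (fun x y => y = G.next x ∨ (True ∧ y = G.opp x)) x y →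
      ((∃ z, Inner (G := G) j₀ z ∧ G.next.SameCycle x z) ↔
        ∃ z, Inner (G := G) j₀ z ∧ G.next.SameCycle y z) := by
    intro x y hxy
    induction hxy with
    | rel x y h =>
      rcases h with rfl | ⟨-, rfl⟩
      · simp only [Equiv.Perm.sameCycle_apply_left]
      · exact ⟨hopp x, fun h => by simpa only [G.opp_opp] using hopp _ h⟩
    | refl x => rfl
    | symm x y _ ih => exact ih.symm
    | trans x y z _ _ ih1 ih2 => exact ih1.trans ih2
  obtain ⟨y, hy⟩ := hG.exists_inner j₀
  exact (key y h (hG.connected y h)).1 ⟨y, hy, Equiv.Perm.SameCycle.refl _ _⟩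

theorem inner_next {x : Fin m} (hx : G.opp x ≠ x) (hx' : ¬ Inner (G := G) j₀ x) :
    Inner (G := G) j₀ (G.next x) := by
  obtain ⟨y, hy, hxy⟩ := hG.exists_inner_sameCycle j₀ x
  rcases hG.eq_or_eq_of_sameCycle hx hy hxy with rfl | rfl
  · exact absurd hy hx'
  · rwa [Equiv.apply_symm_apply]

theorem inner_opp {x : Fin m} (hx : G.opp x ≠ x) (hx' : ¬ Inner (G := G) j₀ x) :
    Inner (G := G) j₀ (G.opp x) := by
  have := inner_opp_next_symm (hG.inner_next hx hx')
  rwa [Equiv.symm_apply_apply] at this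

/-- The legs that are followed by an internal half-edge. -/
def cuts (G : NCDiagram n m) : Finset (Fin n) :=
  Finset.univ.filter fun j => G.opp (G.next (G.leg j)) ≠ G.next (G.leg j)

omit hG in
theorem mem_cuts {j : Fin n} : j ∈ cuts G ↔ G.opp (G.next (G.leg j)) ≠ G.next (G.leg j) := by
  simp [cuts]

omit hG in
theorem opp_leg (j : Fin n) : G.opp (G.leg j) = G.leg j := (G.opp_eq_self_iff _).2 ⟨j, rfl⟩

omit hG in
theorem face_leg (j : Fin n) : G.face (G.leg j) = G.next (G.leg j) := by
  rw [face, Equiv.Perm.mul_apply, opp_leg]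

theorem next_leg_of_notMem {j : Fin n} (hj : j ∉ cuts G) :
    G.next (G.leg j) = G.leg (finRotate n j) := by
  rw [mem_cuts, not_not, G.opp_eq_self_iff] at hj
  obtain ⟨r, h0, hr, hlt⟩ := hG.marked j
  rcases Nat.lt_or_ge 1 r with h1 | h1
  · refine absurd hj ?_
    have := hlt 1 one_pos h1
    rwa [pow_one, face_leg] at this
  · obtain rfl : r = 1 := by omega
    rwa [pow_one, face_leg] at hr

theorem not_inner_next_leg (j : Fin n) : ¬ Inner (G := G) j₀ (G.next (G.leg j)) := by
  rw [← face_leg, inner_face]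
  exact hG.not_inner_leg j₀ j

/-- Across the edge behind a cut one arrives at an inner half-edge, whose predecessor is internal
too. The next half-edge must then be a leg, and the marking says which one. -/
theorem next_opp_next_leg {j : Fin n} (hj : j ∈ cuts G) :
    G.next (G.opp (G.next (G.leg j))) = G.leg (finRotate n j) := by
  have hint := mem_cuts.1 hj
  have hinner := hG.inner_opp hint (hG.not_inner_next_leg (j₀ := j) j)
  have h2 : G.next (G.opp (G.next (G.leg j))) ∈ Set.range G.leg := by
    rw [← G.opp_eq_self_iff]
    by_contra h
    exact hG.not_three_consecutive (hG.internal_next_symm hinner) (hG.internal_of_inner hinner) h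
  have hf : (G.face ^ 2) (G.leg j) = G.next (G.opp (G.next (G.leg j))) := by
    rw [pow_two, Equiv.Perm.mul_apply, face_leg, face, Equiv.Perm.mul_apply]
  obtain ⟨r, h0, hr, hlt⟩ := hG.marked j
  have hr1 : r ≠ 1 := by
    rintro rfl
    rw [pow_one, face_leg] at hr
    exact hint ((G.opp_eq_self_iff _).2 ⟨_, hr.symm⟩)
  rcases Nat.lt_or_ge 2 r with h1 | h1
  · exact absurd (hf ▸ h2) (hlt 2 two_pos h1)
  · obtain rfl : r = 2 := by omega
    rw [← hf, hr]

theorem exists_next_leg_eq {x : Fin m} (hx : G.opp x ≠ x) (hx' : ¬ Inner (G := G) j₀ x) :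
    ∃ j ∈ cuts G, G.next (G.leg j) = x := by
  have h1 : G.next.symm x ∈ Set.range G.leg := by
    rw [← G.opp_eq_self_iff]
    by_contra h
    exact hG.not_three_consecutive h hx (hG.internal_of_inner (hG.inner_next hx hx'))
  obtain ⟨j, hj⟩ := h1
  have h2 : G.next (G.leg j) = x := by rw [hj, Equiv.apply_symm_apply]
  exact ⟨j, mem_cuts.2 (h2 ▸ hx), h2⟩

theorem cuts_nonempty : (cuts G).Nonempty := by
  obtain ⟨y, hy⟩ := hG.exists_inner ⟨0, hG.legs_pos⟩
  obtain ⟨j, hj, -⟩ := hG.exists_next_leg_eq (j₀ := ⟨0, hG.legs_pos⟩) (x := G.opp y)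
    (by rw [G.opp_opp]; exact (hG.internal_of_inner hy).symm) (hG.not_inner_opp hy)
  exact ⟨j, hj⟩

open Sum in
/-- The identification of the half-edges of a relevant diagram. -/
def ringEquiv : Fin n ⊕ (cuts G ⊕ cuts G) ≃ Fin m :=
  Equiv.ofBijective (Sum.elim G.leg (Sum.elim (fun s => G.next (G.leg s))
    fun s => G.opp (G.next (G.leg s)))) <| by
  have hint : ∀ s : cuts G, G.opp (G.next (G.leg s)) ≠ G.next (G.leg s) :=
    fun s => mem_cuts.1 s.2
  have hinner : ∀ s : cuts G, Inner (G := G) ⟨0, hG.legs_pos⟩ (G.opp (G.next (G.leg s))) :=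
    fun s => hG.inner_opp (hint s) (hG.not_inner_next_leg _)
  constructor
  · rintro (i | s | s) (j | t | t) h
    · simpa using h
    · simp only [elim_inl, elim_inr] at h
      exact absurd (h ▸ opp_leg i) (hint t)
    · simp only [elim_inl, elim_inr] at h
      exact absurd (h ▸ hinner t) (hG.not_inner_leg _ i)
    · simp only [elim_inl, elim_inr] at h
      exact absurd (h ▸ opp_leg j) (hint s)
    · rw [Subtype.ext (G.leg.injective (G.next.injective h))]
    · simp only [elim_inl, elim_inr] at h
      exact absurd (h ▸ hinner t) (hG.not_inner_next_leg _)
    · simp only [elim_inl, elim_inr] at h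
      exact absurd (h ▸ hinner s) (hG.not_inner_leg _ j)
    · simp only [elim_inl, elim_inr] at h
      exact absurd (h ▸ hinner s) (hG.not_inner_next_leg _)
    · rw [Subtype.ext (G.leg.injective (G.next.injective (G.opp.injective h)))]
  · intro x
    by_cases hx : G.opp x = x
    · obtain ⟨j, rfl⟩ := (G.opp_eq_self_iff x).1 hx
      exact ⟨inl j, rfl⟩
    by_cases hx' : Inner (G := G) ⟨0, hG.legs_pos⟩ x
    · obtain ⟨j, hj, h⟩ := hG.exists_next_leg_eq (j₀ := ⟨0, hG.legs_pos⟩) (x := G.opp x)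
        (by rw [G.opp_opp]; exact fun h => hx h.symm) (hG.not_inner_opp hx')
      refine ⟨inr (inr ⟨j, hj⟩), ?_⟩
      simp only [elim_inr, h, G.opp_opp]
    · obtain ⟨j, hj, h⟩ := hG.exists_next_leg_eq hx hx'
      exact ⟨inr (inl ⟨j, hj⟩), h⟩

/-- Every relevant diagram is a ring diagram. -/
theorem isRing : IsRing G (cuts G) hG.ringEquiv where
  leg _ := rfl
  opp_out _ := rfl
  next_mem _ := rfl
  next_notMem _ hj := hG.next_leg_of_notMem hj
  next_back s := hG.next_opp_next_leg s.2
  next_out s := by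
    change G.next (G.next (G.leg (nextCut s))) = G.opp (G.next (G.leg s))
    have hy : Inner (G := G) ⟨0, hG.legs_pos⟩ (G.opp (G.next (G.leg s))) :=
      hG.inner_opp (mem_cuts.1 s.2) (hG.not_inner_next_leg _)
    -- Between two cuts the legs follow one another at the same vertex. Hence the edge leaving at
    -- the next cut shares its vertex with the inner half-edge `opp (next (leg s))`, and it has to
    -- be the predecessor of that half-edge.
    have hwalk : ∀ t : ℕ, 0 < t → t ≤ retTime (cuts G) s →
        G.next.SameCycle (G.opp (G.next (G.leg s))) (G.leg (((finRotate n) ^ t) (s : Fin n))) := by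
      intro t
      induction t with
      | zero => intro h; exact absurd h (lt_irrefl _)
      | succ t ih =>
        intro _ ht
        rw [pow_succ', Equiv.Perm.mul_apply]
        rcases Nat.eq_zero_or_pos t with h1 | h1
        · subst h1
          rw [pow_zero, Equiv.Perm.one_apply, ← hG.next_opp_next_leg s.2]
          exact next_sameCycle _
        · refine (ih h1 (by omega)).trans ?_
          rw [← hG.next_leg_of_notMem (notMem_of_lt_retTime h1 (by omega))]
          exact next_sameCycle _
    have h1 := (hwalk _ (retTime_spec ⟨s, s.2⟩).1 le_rfl).trans (next_sameCycle _)
    rcases hG.eq_or_eq_of_sameCycle (mem_cuts.1 (nextCut s).2) hy h1.symm with h | h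
    · exact absurd (h ▸ hy) (hG.not_inner_next_leg _)
    · rw [h, Equiv.apply_symm_apply]

end Relevant

end NCDiagram

/-! ### Sums over cuts of a cyclic word -/

section Words

variable {ι : Type*} (w : ι → ℂ) (D : List ι → ℂ)

/-- The sum over all ways to cut the word `acc ++ xs ++ zs` at letters of `xs`. A piece contains
both of its end points and contributes its value under `D`, a cut at `x` contributes `w x`. -/
def chainSum : List ι → List ι → List ι → ℂ
  | acc, [], zs => D (acc ++ zs)
  | acc, x :: xs, zs => chainSum (acc ++ [x]) xs zs + D (acc ++ [x]) * w x * chainSum [x] xs zs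

/-- The sum over all ways to cut the cyclic word `pre ++ xs ++ suf` at one or more letters
of `xs`. -/
def loopSum : List ι → List ι → List ι → ℂ
  | _, [], _ => 0
  | pre, x :: xs, suf =>
    w x * chainSum w D [x] xs (suf ++ pre ++ [x]) + loopSum (pre ++ [x]) xs suf

/-- The recursion expands at the first letter; expanding at the last one as well is what invariance
under rotation needs. -/
theorem chainSum_append_singleton (acc xs zs : List ι) (y : ι) :
    chainSum w D acc (xs ++ [y]) zs =
      chainSum w D acc xs (y :: zs) + chainSum w D acc xs [y] * w y * D (y :: zs) := by
  induction xs generalizing acc with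
  | nil => simp [chainSum]
  | cons x xs ih => simp only [List.cons_append, chainSum, ih]; ring

theorem loopSum_append_singleton (pre xs suf : List ι) (y : ι) :
    loopSum w D pre (xs ++ [y]) suf =
      loopSum w D pre xs (y :: suf) + w y * chainSum w D (y :: (suf ++ pre)) xs [y] := by
  induction xs generalizing pre with
  | nil => simp [loopSum, chainSum]
  | cons x xs ih =>
    simp only [List.cons_append, loopSum, chainSum, ih, chainSum_append_singleton, List.append_assoc]
    ring

/-- In the cyclic word the part outside `xs` is read as `suf ++ pre`, and no term depends on how it
is divided. -/
theorem loopSum_cons_of_pre (pre xs suf : List ι) :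
    loopSum w D pre xs suf = loopSum w D [] xs (suf ++ pre) := by
  have key : ∀ (xs pre suf pre' suf' : List ι), suf ++ pre = suf' ++ pre' →
      loopSum w D pre xs suf = loopSum w D pre' xs suf' := by
    intro xs
    induction xs with
    | nil => intros; rfl
    | cons x xs ih =>
      intro pre suf pre' suf' h
      simp only [loopSum, h]
      rw [ih (pre ++ [x]) suf (pre' ++ [x]) suf' (by
        rw [← List.append_assoc, h, List.append_assoc])]
  exact key xs pre suf [] (suf ++ pre) (by simp)

theorem loopSum_cons (xs : List ι) (x : ι) :
    loopSum w D [] (x :: xs) [] = w x * chainSum w D [x] xs [x] + loopSum w D [] xs [x] := by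
  rw [loopSum, loopSum_cons_of_pre w D ([] ++ [x])]
  simp

theorem loopSum_rotate (xs : List ι) (x : ι) :
    loopSum w D [] (xs ++ [x]) [] = loopSum w D [] (x :: xs) [] := by
  rw [loopSum_append_singleton, loopSum_cons]
  simp only [List.append_nil]
  ring

variable {w D} {lam : ι → ℂ}
  (hD : ∀ (l₁ l₂ : List ι) (x y : ι), (lam x - lam y) * D (l₁ ++ x :: y :: l₂) =
    D (l₁ ++ x :: l₂) - D (l₁ ++ y :: l₂))
include hD

/-- Adjacent letters in a stretch without cuts lie in a single piece of each term, and the recursion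
`hD` applies to that piece. The next two lemmas treat the other positions in the same way. -/
theorem sub_mul_chainSum_tail (acc xs zs : List ι) (y x : ι) :
    (lam y - lam x) * chainSum w D acc xs (y :: x :: zs) =
      chainSum w D acc xs (y :: zs) - chainSum w D acc xs (x :: zs) := by
  induction xs generalizing acc with
  | nil => exact hD _ _ _ _
  | cons z xs ih =>
    simp only [chainSum]
    linear_combination ih (acc ++ [z]) + D (acc ++ [z]) * w z * ih [z]

theorem sub_mul_chainSum_head (acc xs zs : List ι) (y x : ι) :
    (lam y - lam x) * chainSum w D (y :: x :: acc) xs zs =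
      chainSum w D (y :: acc) xs zs - chainSum w D (x :: acc) xs zs := by
  induction xs generalizing acc with
  | nil => simpa [chainSum] using hD [] (acc ++ zs) y x
  | cons z xs ih =>
    have h1 := ih (acc ++ [z])
    have h2 := hD [] (acc ++ [z]) y x
    simp only [chainSum, List.cons_append, List.nil_append] at h1 h2 ⊢
    linear_combination h1 + h2 * w z * chainSum w D [z] xs zs

theorem sub_mul_loopSum (pre xs suf : List ι) (y x : ι) :
    (lam y - lam x) * loopSum w D pre xs (y :: x :: suf) =
      loopSum w D pre xs (y :: suf) - loopSum w D pre xs (x :: suf) := by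
  induction xs generalizing pre with
  | nil => simp [loopSum]
  | cons z xs ih =>
    have h1 := sub_mul_chainSum_tail (w := w) hD [z] xs (suf ++ pre ++ [z]) y x
    simp only [loopSum, List.cons_append] at h1 ⊢
    linear_combination w z * h1 + ih (pre ++ [z])

/-- The Ward identity for sums over cuts of a cyclic word. -/
theorem ward_loopSum (L : List ι) (x y : ι)
    (hw : w x * w y * (D [y] - D [x]) = w y - w x) :
    (lam y - lam x) * loopSum w D [] (x :: (L ++ [y])) [] =
      loopSum w D [] (y :: L) [] - loopSum w D [] (x :: L) [] := by
  -- The four terms have cuts at `x` only, at both letters, at `y` only, and at neither. After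
  -- multiplication by `λ_y - λ_x` they telescope, up to multiples of `chainSum w D [x] L [y]` that
  -- cancel by `hw`.
  have e : loopSum w D [] (x :: (L ++ [y])) [] = w x * chainSum w D [x] L [y, x] +
      w x * chainSum w D [x] L [y] * w y * D [y, x] + w y * chainSum w D [y, x] L [y] +
      loopSum w D [] L [y, x] := by
    rw [loopSum_cons, chainSum_append_singleton, loopSum_append_singleton]
    simp only [List.append_nil]
    ring
  have h1 := sub_mul_chainSum_tail (w := w) hD [x] L [] y x
  have h2 := hD [] [] y x
  have h3 := sub_mul_chainSum_head (w := w) hD [] L [y] y x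
  have h4 := sub_mul_loopSum (w := w) hD [] L [] y x
  simp only [List.nil_append] at h2
  rw [e, loopSum_cons, loopSum_cons]
  linear_combination w x * h1 + w x * chainSum w D [x] L [y] * w y * h2 + w y * h3 + h4 +
    chainSum w D [x] L [y] * hw

end Words

/-! ### Cuts of a cyclic word as sets of positions -/

section Positions

variable {ι : Type*} (w : ι → ℂ) (D : List ι → ℂ) (Y : ℕ → ι)

/-- The first element of `T` after `u`. -/
def nextIn (T : Finset ℕ) (u : ℕ) : ℕ := sInf {t | t ∈ T ∧ u < t}

theorem nextIn_spec {T : Finset ℕ} {u : ℕ} (h : ∃ t ∈ T, u < t) :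
    nextIn T u ∈ T ∧ u < nextIn T u :=
  Nat.sInf_mem (s := {t | t ∈ T ∧ u < t}) h

theorem nextIn_le {T : Finset ℕ} {u t : ℕ} (ht : t ∈ T) (h : u < t) : nextIn T u ≤ t :=
  Nat.sInf_le ⟨ht, h⟩

theorem nextIn_eq {T : Finset ℕ} {u t : ℕ} (ht : t ∈ T) (h : u < t)
    (h' : ∀ s ∈ T, u < s → t ≤ s) : nextIn T u = t :=
  le_antisymm (nextIn_le ht h) (h' _ (nextIn_spec ⟨t, ht, h⟩).1 (nextIn_spec ⟨t, ht, h⟩).2)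

/-- The letters `Y u, …, Y (t - 1)`. -/
def seg (u t : ℕ) : List ι := (List.range' u (t - u)).map Y

/-- The factor of the piece that begins at `u`. -/
def pieceAt (T : Finset ℕ) (u : ℕ) : ℂ := D (seg Y u (nextIn T u + 1))

theorem seg_self (u : ℕ) : seg Y u u = [] := by simp [seg]

theorem seg_append {a b c : ℕ} (h1 : a ≤ b) (h2 : b ≤ c) : seg Y a b ++ seg Y b c = seg Y a c := by
  obtain ⟨p, rfl⟩ := Nat.exists_eq_add_of_le h1
  obtain ⟨q, rfl⟩ := Nat.exists_eq_add_of_le h2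
  have e1 : a + p + q - a = p + q := by omega
  have e2 : a + p + q - (a + p) = q := by omega
  rw [seg, seg, seg, ← List.map_append, e1, e2, Nat.add_sub_cancel_left]
  have := @List.range'_append a p q 1
  rw [one_mul] at this
  rw [this]

theorem seg_succ (a : ℕ) : seg Y a (a + 1) = [Y a] := by simp [seg]

theorem seg_cons {a b : ℕ} (h : a < b) : seg Y a b = Y a :: seg Y (a + 1) b := by
  rw [← seg_append Y (Nat.le_succ a) h, seg_succ]; rfl

theorem seg_concat {a b : ℕ} (h : a ≤ b) : seg Y a b ++ [Y b] = seg Y a (b + 1) := by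
  rw [← seg_succ, seg_append Y h (Nat.le_succ b)]

/-- The recursion branches on whether the letter at `b` is cut, and so does the sum over subsets of
`Ico b c`. The sentinel `d` marks the end of the last piece and keeps `nextIn` from being the
infimum of an empty set. -/
theorem chainSum_eq_sum_powerset (a b c d : ℕ) (h1 : a < b) (h2 : b ≤ c) (h3 : c ≤ d) :
    chainSum w D (seg Y a b) (seg Y b c) (seg Y c (d + 1)) =
      ∑ U ∈ (Finset.Ico b c).powerset, pieceAt D Y (insert d U) a *
        ∏ u ∈ U, w (Y u) * pieceAt D Y (insert d U) u := by
  obtain ⟨q, rfl⟩ := Nat.exists_eq_add_of_le h2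
  induction q generalizing a b with
  | zero =>
    simp only [add_zero, seg_self, chainSum, Finset.Ico_self, Finset.powerset_empty,
      Finset.sum_singleton, Finset.prod_empty, mul_one, pieceAt]
    rw [seg_append Y h1.le (by omega), nextIn_eq (t := d) (by simp) (by omega) (by simp)]
  | succ q ih =>
    have hI : Finset.Ico b (b + (q + 1)) = insert b (Finset.Ico (b + 1) (b + 1 + q)) := by
      ext t; simp only [Finset.mem_Ico, Finset.mem_insert]; omega
    have hb : b ∉ Finset.Ico (b + 1) (b + 1 + q) := by simp
    have ih1 := ih a (b + 1) (by omega) (by omega) (by omega)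
    have ih2 := ih b (b + 1) (by omega) (by omega) (by omega)
    rw [seg_succ] at ih2
    have hq : b + (q + 1) = b + 1 + q := by omega
    rw [seg_cons Y (show b < b + (q + 1) by omega), chainSum, hI, Finset.sum_powerset_insert hb,
      seg_concat Y h1.le, hq, ih1, ih2]
    congr 1
    rw [Finset.mul_sum]
    refine Finset.sum_congr rfl fun U hU => ?_
    rw [Finset.mem_powerset] at hU
    have hbU : b ∉ U := fun h => hb (hU h)
    have hle : ∀ u ∈ U, b < u := fun u hu => by
      have := Finset.mem_Ico.1 (hU hu); omega
    have e1 : nextIn (insert d (insert b U)) a = b := by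
      refine nextIn_eq (by simp) h1 fun s hs _ => ?_
      simp only [Finset.mem_insert] at hs
      rcases hs with rfl | rfl | hs
      · omega
      · exact le_rfl
      · exact (hle s hs).le
    -- Pieces that begin at `b` or later do not notice whether `b` is a cut.
    have e2 : ∀ u, b ≤ u → nextIn (insert d (insert b U)) u = nextIn (insert d U) u := by
      intro u hu
      unfold nextIn
      congr 1
      ext t
      simp only [Set.mem_ofPred_eq, Finset.mem_insert]
      constructor
      · rintro ⟨rfl | rfl | h, h'⟩
        · exact ⟨Or.inl rfl, h'⟩
        · omega
        · exact ⟨Or.inr h, h'⟩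
      · rintro ⟨rfl | h, h'⟩
        · exact ⟨Or.inl rfl, h'⟩
        · exact ⟨Or.inr (Or.inr h), h'⟩
    rw [Finset.prod_insert hbU]
    have e3 : ∏ u ∈ U, w (Y u) * pieceAt D Y (insert d (insert b U)) u =
        ∏ u ∈ U, w (Y u) * pieceAt D Y (insert d U) u :=
      Finset.prod_congr rfl fun u hu => by rw [pieceAt, e2 u (hle u hu).le, pieceAt]
    rw [e3, pieceAt, pieceAt, pieceAt, e1, e2 b le_rfl]
    ring

/-- The contribution of the cyclic word `Y 0, …, Y (n - 1)` cut at the positions in `U`. -/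
def cutTerm (n : ℕ) (U : Finset ℕ) : ℂ :=
  ∏ u ∈ U, w (Y u) * pieceAt D Y (insert (sInf (U : Set ℕ) + n) U) u

/-- `loopSum` sorts the nonempty sets of cuts by their first cut. From there the word is read
linearly for one period, and the sentinel in `cutTerm` is that same cut one period later. -/
theorem loopSum_eq_sum_powerset {n : ℕ} (hY : ∀ t, Y (t + n) = Y t) (a : ℕ) (ha : a ≤ n) :
    loopSum w D (seg Y 0 a) (seg Y a n) [] =
      ∑ U ∈ (Finset.Ico a n).powerset.filter Finset.Nonempty, cutTerm w D Y n U := by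
  obtain ⟨q, rfl⟩ := Nat.exists_eq_add_of_le ha
  induction q generalizing a with
  | zero =>
    simp only [add_zero, seg_self, loopSum]
    symm
    refine Finset.sum_eq_zero fun U hU => ?_
    simp only [Finset.Ico_self, Finset.powerset_empty, Finset.mem_filter,
      Finset.mem_singleton] at hU
    exact absurd hU.2 (by rw [hU.1]; exact Finset.not_nonempty_empty)
  | succ q ih =>
    have hI : Finset.Ico a (a + (q + 1)) = insert a (Finset.Ico (a + 1) (a + 1 + q)) := by
      ext t; simp only [Finset.mem_Ico, Finset.mem_insert]; omega
    have hb : a ∉ Finset.Ico (a + 1) (a + 1 + q) := by simp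
    have hq : a + 1 + q = a + (q + 1) := by omega
    have ih1 := ih (a + 1) (by rwa [hq]) (by omega)
    rw [hq] at ih1
    rw [seg_cons Y (show a < a + (q + 1) by omega), loopSum, seg_concat Y (Nat.zero_le a), ih1, hI,
      Finset.sum_filter (s := (insert a _ : Finset ℕ).powerset), Finset.sum_powerset_insert hb,
      ← Finset.sum_filter, add_comm, hq]
    congr 1
    -- By periodicity the letters up to and including position `a` are repeated one period later, so
    -- the closing piece is an ordinary segment.
    have hzs : ([] : List ι) ++ seg Y 0 a ++ [Y a] =
        seg Y (a + (q + 1)) (a + (a + (q + 1)) + 1) := by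
      rw [List.nil_append, seg_concat Y (Nat.zero_le a), seg, seg]
      have e : a + (a + (q + 1)) + 1 - (a + (q + 1)) = a + 1 := by omega
      rw [e, Nat.sub_zero, List.range'_eq_map_range, List.range'_eq_map_range, List.map_map,
        List.map_map]
      refine List.map_congr_left fun t _ => ?_
      simp only [Function.comp_apply, zero_add]
      rw [add_comm (a + (q + 1)) t, hY]
    have h1 := chainSum_eq_sum_powerset w D Y a (a + 1) (a + (q + 1)) (a + (a + (q + 1)))
      (by omega) (by omega) (by omega)
    rw [seg_succ] at h1
    rw [hzs, h1, Finset.mul_sum]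
    refine Finset.sum_congr rfl fun U hU => ?_
    rw [Finset.mem_powerset] at hU
    have haU : a ∉ U := fun h => by have := Finset.mem_Ico.1 (hU h); omega
    rw [if_pos (Finset.insert_nonempty a U), cutTerm]
    have hmin : sInf ((insert a U : Finset ℕ) : Set ℕ) = a := by
      refine le_antisymm (Nat.sInf_le (by simp)) (le_csInf ⟨a, by simp⟩ fun t ht => ?_)
      rw [Finset.mem_coe, Finset.mem_insert] at ht
      rcases ht with rfl | ht
      · exact le_rfl
      · have := Finset.mem_Ico.1 (hU ht); omega
    have e2 : ∀ u, a ≤ u → pieceAt D Y (insert (a + (a + (q + 1))) (insert a U)) u =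
        pieceAt D Y (insert (a + (a + (q + 1))) U) u := by
      intro u hu
      unfold pieceAt nextIn
      congr 4
      ext t
      simp only [Set.mem_ofPred_eq, Finset.mem_insert]
      constructor
      · rintro ⟨rfl | rfl | h, h'⟩
        · exact ⟨Or.inl rfl, h'⟩
        · omega
        · exact ⟨Or.inr h, h'⟩
      · rintro ⟨rfl | h, h'⟩
        · exact ⟨Or.inl rfl, h'⟩
        · exact ⟨Or.inr (Or.inr h), h'⟩
    rw [hmin, Finset.prod_insert haU, e2 a le_rfl, mul_assoc]
    congr 2
    refine Finset.prod_congr rfl fun u hu => ?_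
    have := Finset.mem_Ico.1 (hU hu)
    rw [e2 u (by omega)]

end Positions

/-! ### Cyclic cuts as subsets of `Fin n` -/

section RingTerm

variable {ι : Type*} (w : ι → ℂ) (D : List ι → ℂ)

/-- The contribution of the cyclic word `y` cut at the letters in `S`. -/
def ringTerm {n : ℕ} (S : Finset (Fin n)) (y : Fin n → ι) : ℂ :=
  ∏ s ∈ S, w (y s) * D ((List.range (retTime S s + 1)).map fun t => y (((finRotate n) ^ t) s))

/-- The next cut is a later position or, behind the largest cut, the smallest one shifted by a
period. Counted cyclically, both distances are the return time. -/
theorem nextIn_eq_add_retTime {n : ℕ} (S : Finset (Fin (n + 1))) (s : Fin (n + 1)) (hs : s ∈ S) :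
    nextIn (insert (sInf ((S.map Fin.valEmbedding : Finset ℕ) : Set ℕ) + (n + 1))
      (S.map Fin.valEmbedding)) s = s + retTime S s := by
  have hper : ∀ t, ((finRotate (n + 1)) ^ (t + (n + 1))) 0 = ((finRotate (n + 1)) ^ t) 0 := by
    intro t
    rw [pow_add, Equiv.Perm.mul_apply, pow_succ', Equiv.Perm.mul_apply,
      finRotate_pow_zero n (by omega)]
    congr 1
    exact finRotate_last
  have hpow : ∀ t, ((finRotate (n + 1)) ^ t) s = ((finRotate (n + 1)) ^ ((s : ℕ) + t)) 0 := by
    intro t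
    rw [add_comm (s : ℕ) t, pow_add, Equiv.Perm.mul_apply, finRotate_pow_zero _ s.2]
  set U := S.map Fin.valEmbedding with hU
  have hmemU : ∀ t, t ∈ U ↔ ∃ h : t < n + 1, (⟨t, h⟩ : Fin (n + 1)) ∈ S := by
    intro t
    simp only [hU, Finset.mem_map, Fin.valEmbedding_apply]
    constructor
    · rintro ⟨x, hx, rfl⟩; exact ⟨x.2, hx⟩
    · rintro ⟨h, hx⟩; exact ⟨_, hx, rfl⟩
  have hne : (U : Set ℕ).Nonempty := ⟨s, (hmemU _).2 ⟨s.2, hs⟩⟩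
  have hmin : sInf (U : Set ℕ) ∈ U := Nat.sInf_mem hne
  have hminle : ∀ t ∈ U, sInf (U : Set ℕ) ≤ t := fun t ht => Nat.sInf_le ht
  set μ := sInf (U : Set ℕ)
  have hs2 := s.2
  have hspec := nextIn_spec (T := insert (μ + (n + 1)) U) (u := s)
    ⟨μ + (n + 1), Finset.mem_insert_self _ _, by omega⟩
  set ν := nextIn (insert (μ + (n + 1)) U) s with hν
  obtain ⟨r, hr⟩ := Nat.exists_eq_add_of_le hspec.2.le
  rw [hr]
  congr 1
  symm
  refine retTime_eq (by omega) ?_ fun t h0 ht hmem => ?_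
  · rw [hpow, ← hr]
    rcases Finset.mem_insert.1 hspec.1 with h | h
    · rw [h, hper]
      obtain ⟨h1, h2⟩ := (hmemU _).1 hmin
      rwa [finRotate_pow_zero _ h1]
    · obtain ⟨h1, h2⟩ := (hmemU _).1 h
      rwa [finRotate_pow_zero _ h1]
  · rw [hpow] at hmem
    have hle : ν ≤ μ + (n + 1) := nextIn_le (Finset.mem_insert_self _ _) (by omega)
    obtain ⟨hμ, -⟩ := (hmemU _).1 hmin
    rcases Nat.lt_or_ge ((s : ℕ) + t) (n + 1) with h1 | h1
    · rw [finRotate_pow_zero _ h1] at hmem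
      have : ν ≤ s + t := nextIn_le (Finset.mem_insert_of_mem ((hmemU _).2 ⟨h1, hmem⟩)) (by omega)
      omega
    · obtain ⟨p, hp⟩ := Nat.exists_eq_add_of_le h1
      rw [hp, add_comm (n + 1) p, hper, finRotate_pow_zero _ (show p < n + 1 by omega)] at hmem
      have := hminle p ((hmemU _).2 ⟨by omega, hmem⟩)
      omega

/-- The bridge from ring diagrams, given by sets of cuts, to the recursion `loopSum`, where the Ward
identity can be proved by induction along the word. -/
theorem sum_ringTerm {n : ℕ} (y : Fin n → ι) :
    ∑ S ∈ Finset.univ.filter Finset.Nonempty, ringTerm w D S y =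
      loopSum w D [] (List.ofFn y) [] := by
  cases n with
  | zero =>
    rw [List.ofFn_zero, loopSum]
    refine Finset.sum_eq_zero fun S hS => ?_
    simp only [Finset.mem_filter, Finset.mem_univ, true_and] at hS
    obtain ⟨s, -⟩ := hS
    exact s.elim0
  | succ n =>
    set Y : ℕ → ι := fun t => y (((finRotate (n + 1)) ^ t) 0) with hYdef
    have hper : ∀ t, Y (t + (n + 1)) = Y t := by
      intro t
      simp only [hYdef]
      rw [pow_add, Equiv.Perm.mul_apply, pow_succ', Equiv.Perm.mul_apply,
        finRotate_pow_zero n (by omega)]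
      congr 2
      exact finRotate_last
    have hY : ∀ (s : Fin (n + 1)) t, y (((finRotate (n + 1)) ^ t) s) = Y ((s : ℕ) + t) := by
      intro s t
      simp only [hYdef]
      rw [add_comm (s : ℕ) t, pow_add, Equiv.Perm.mul_apply, finRotate_pow_zero _ s.2]
    have hofFn : List.ofFn y = seg Y 0 (n + 1) := by
      rw [seg, Nat.sub_zero, ← List.range_eq_range']
      refine List.ext_getElem (by simp) fun i h1 h2 => ?_
      have h3 : i < n + 1 := by simpa using h1
      have := hY ⟨i, h3⟩ 0
      rw [pow_zero, Equiv.Perm.one_apply, add_zero] at this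
      simp only [List.getElem_ofFn, List.getElem_map, List.getElem_range, this]
    have h := loopSum_eq_sum_powerset w D Y hper 0 (Nat.zero_le _)
    rw [seg_self] at h
    rw [hofFn, h]
    refine Finset.sum_nbij' (fun S => S.map Fin.valEmbedding)
      (fun U => Finset.univ.filter fun s : Fin (n + 1) => (s : ℕ) ∈ U) ?_ ?_ ?_ ?_ ?_
    · intro S hS
      simp only [Finset.mem_filter, Finset.mem_univ, true_and, Finset.mem_powerset,
        Finset.map_nonempty] at hS ⊢
      refine ⟨fun t ht => ?_, hS⟩
      obtain ⟨s, -, rfl⟩ := Finset.mem_map.1 ht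
      simp only [Fin.valEmbedding_apply, Finset.mem_Ico]
      exact ⟨Nat.zero_le _, s.2⟩
    · intro U hU
      simp only [Finset.mem_filter, Finset.mem_univ, true_and, Finset.mem_powerset] at hU ⊢
      obtain ⟨hsub, u, hu⟩ := hU
      have := Finset.mem_Ico.1 (hsub hu)
      exact ⟨⟨u, this.2⟩, by simpa using hu⟩
    · intro S _
      ext s
      simp only [Finset.mem_filter, Finset.mem_univ, true_and, Finset.mem_map,
        Fin.valEmbedding_apply]
      exact ⟨fun ⟨a, ha, h⟩ => Fin.ext h ▸ ha, fun h => ⟨s, h, rfl⟩⟩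
    · intro U hU
      simp only [Finset.mem_filter, Finset.mem_powerset] at hU
      ext t
      simp only [Finset.mem_map, Finset.mem_filter, Finset.mem_univ, true_and,
        Fin.valEmbedding_apply]
      constructor
      · rintro ⟨s, hs, rfl⟩; exact hs
      · intro ht
        exact ⟨⟨t, (Finset.mem_Ico.1 (hU.1 ht)).2⟩, ht, rfl⟩
    · intro S _
      rw [ringTerm, cutTerm, Finset.prod_map]
      refine Finset.prod_congr rfl fun s hs => ?_
      have h0 := hY s 0
      rw [pow_zero, Equiv.Perm.one_apply, add_zero] at h0
      rw [Fin.valEmbedding_apply, pieceAt, nextIn_eq_add_retTime S s hs, ← h0]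
      congr 2
      have e : (s : ℕ) + retTime S s + 1 - s = retTime S s + 1 := by omega
      rw [seg, e, List.range'_eq_map_range, List.map_map]
      exact List.map_congr_left fun t _ => hY s t

end RingTerm

/-! ### The amplitude of a ring diagram -/

section RingAmplitude

open Sum

variable {ι : Type*} {n m : ℕ} {S : Finset (Fin n)} (Θ : Fin n ⊕ (S ⊕ S) ≃ Fin m)

/-- The indices at the half-edges of a ring with index `k` inside and `x j` before leg `j`. -/
def ringIndex (k : ι) (x : Fin n → ι) (h : Fin m) : ι :=
  Sum.elim x (Sum.elim (fun s : S => x (finRotate n s)) fun _ => k) (Θ.symm h)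

@[simp] theorem ringIndex_leg (k : ι) (x : Fin n → ι) (j : Fin n) :
    ringIndex Θ k x (Θ (inl j)) = x j := by simp [ringIndex]

@[simp] theorem ringIndex_out (k : ι) (x : Fin n → ι) (s : S) :
    ringIndex Θ k x (Θ (inr (inl s))) = x (finRotate n s) := by simp [ringIndex]

@[simp] theorem ringIndex_back (k : ι) (x : Fin n → ι) (s : S) :
    ringIndex Θ k x (Θ (inr (inr s))) = k := by simp [ringIndex]

variable [DecidableEq ι] {N : ℕ} (e : Fin N ↪ ι) (f : ℝ → ℂ) (lam : ι → ℝ)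

/-- The propagator between the inner index `k` and the outer index `y`, with the sign of an
edge. -/
def loopWeight (k y : ι) : ℂ := -propagator e f lam y k

/-- The factor of a vertex on a loop with inner index `k` and outer indices `l`. -/
def loopVertex (k : ι) (l : List ι) : ℂ := divDiff (lam k :: l.map lam) (deriv f)

variable {f} {Θ}

namespace IsRing

variable {G : NCDiagram n m} (R : IsRing G S Θ)
include R

omit [DecidableEq ι] in
-- The vertex behind the cut `s` sees the inner index once, then the indices before its legs, and
-- finally the index behind the next cut. The last one also begins the next piece, so neighbouring
-- pieces share an end point.
theorem cycleDiff_ringIndex (k : ι) (x : Fin n → ι) (s : S) :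
    cycleDiff f lam G.next (ringIndex Θ k x) (Θ (inr (inr s))) =
      loopVertex f lam k ((List.range (retTime S s + 1)).map fun t =>
        x (finRotate n (((finRotate n) ^ t) (s : Fin n)))) := by
  have h1 : ∀ t < retTime S s + 1, ringIndex Θ k x ((G.next ^ (t + 1)) (Θ (inr (inr s)))) =
      x (finRotate n (((finRotate n) ^ t) (s : Fin n))) := by
    intro t ht
    rcases Nat.lt_or_ge t (retTime S s) with h | h
    · rw [R.next_pow_of_le s (Nat.succ_pos t) h, ringIndex_leg, pow_succ', Equiv.Perm.mul_apply]
    · obtain rfl : t = retTime S s := by omega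
      rw [R.next_pow_succ, ringIndex_out]; rfl
  rw [cycleDiff, loopVertex, R.minimalPeriod_back]
  congr 1
  rw [List.ofFn_succ]
  congr 1
  · simp
  · rw [List.map_map]
    refine List.ext_getElem (by simp) fun t h2 h3 => ?_
    have h4 : t < retTime S s + 1 := by simpa using h2
    simp only [List.getElem_ofFn, List.getElem_map, List.getElem_range, Function.comp_apply,
      Fin.val_succ, h1 t h4]

theorem edgeFactor_ringIndex (k : ι) (x : Fin n → ι) (s : S) :
    edgeFactor f lam e G.next G.opp (ringIndex Θ k x) (Θ (inr (inl s))) =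
      loopWeight e f lam k (x (finRotate n s)) := by
  rw [edgeFactor, R.opp_out, R.next_back, R.next_out']
  simp [loopWeight]

omit [DecidableEq ι] in
theorem ringIndex_next_leg (k : ι) (x : Fin n → ι) (j : Fin n) :
    ringIndex Θ k x (G.next (G.leg j)) = x (finRotate n j) := by
  rw [R.leg]
  by_cases hj : j ∈ S
  · have := R.next_mem ⟨j, hj⟩
    dsimp only at this
    rw [this, ringIndex_out]
  · rw [R.next_notMem j hj, ringIndex_leg]

/-- The Kronecker deltas on the edges carry one index around the inside of the ring and leave one
free index for each leg. -/
theorem exists_ringIndex_eq (hS : S.Nonempty) {i : Fin m → ι}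
    (hi : ∀ s : S, edgeFactor f lam e G.next G.opp i (Θ (inr (inl s))) ≠ 0) :
    ∃ k ∈ Set.range i, i = ringIndex Θ k fun j => i (Θ (inl j)) := by
  have h1 : ∀ s : S, i (Θ (inr (inl s))) = i (Θ (inl (finRotate n s))) ∧
      i (Θ (inr (inr (prevCut s)))) = i (Θ (inr (inr s))) := by
    intro s
    by_contra hne
    refine hi s ?_
    rw [edgeFactor, R.opp_out, R.next_back, R.next_out', if_neg hne, neg_zero]
  obtain ⟨s, hs⟩ := hS
  refine ⟨i (Θ (inr (inr ⟨s, hs⟩))), ⟨_, rfl⟩, funext fun h => ?_⟩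
  obtain ⟨z, rfl⟩ := Θ.surjective h
  rcases z with j | t | t
  · simp
  · rw [ringIndex_out]; exact (h1 t).1
  · rw [ringIndex_back]
    refine nextCut_induction (P := fun t => i (Θ (inr (inr t))) = i (Θ (inr (inr ⟨s, hs⟩))))
      ⟨s, hs⟩ rfl (fun t ht => ?_) t
    rw [← (h1 (nextCut t)).2, prevCut_nextCut]
    exact ht

/-- Only assignments of the form `ringIndex` survive. The shift by `finRotate n` appears because the
letter at a cut `s` is the index behind the leg `s`, not the one before it. -/
theorem amplitude_eq (hS : S.Nonempty) (hf : ContDiff ℝ (⊤ : ℕ∞) (deriv f))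
    (hpos : ∀ k l : Fin N, ∃ s : ℝ, 0 < s ∧ divDiff [lam (e k), lam (e l)] (deriv f) = (s : ℂ))
    {A : Finset ι} (hA : ∀ k, e k ∈ A) {V : Fin n → ι → ι → ℂ} (hV : ∀ j, SupportedIn A (V j)) :
    G.amplitude f lam e V = ∑ k ∈ A, ∑ x ∈ Fintype.piFinset (fun _ : Fin n => A),
      ringTerm (loopWeight e f lam k) (loopVertex f lam k) S (x ∘ finRotate n) *
        ∏ j, V j (x j) (x (finRotate n j)) := by
  rw [amplitude_eq_ampSum G e hpos hA hV, ampSum, ← Finset.sum_product', eq_comm]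
  have hedge : ∀ i : Fin m → ι,
      ∏ h ∈ Finset.univ.filter (fun h => h < G.opp h), edgeFactor f lam e G.next G.opp i h =
        ∏ s : S, edgeFactor f lam e G.next G.opp i (Θ (inr (inl s))) := by
    intro i
    rw [G.isTransversal.prod_eq G.opp_opp R.isTransversal
      fun h => edgeFactor_opp lam e f G.next G.opp i (G.opp_opp h), Finset.prod_map]
    rfl
  have hvert : ∀ i : Fin m → ι, ∏ v : Cycles G.next, cycleDiff f lam G.next i v.out =
      ∏ s : S, cycleDiff f lam G.next i (Θ (inr (inr s))) :=
    fun i => prod_cycleDiff lam hf G.next _ (R.bijective_vertices hS) i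
  refine Finset.sum_of_injOn (fun p : ι × (Fin n → ι) => ringIndex Θ p.1 p.2) ?_ ?_ ?_ ?_
  · rintro ⟨k, x⟩ - ⟨k', x'⟩ - h
    obtain ⟨s, hs⟩ := hS
    have h1 := congrFun h (Θ (inr (inr ⟨s, hs⟩)))
    simp only [ringIndex_back] at h1
    refine Prod.ext h1 (funext fun j => ?_)
    have h2 := congrFun h (Θ (inl j))
    simpa using h2
  · rintro ⟨k, x⟩ hkx
    simp only [Finset.coe_product, Set.mem_prod, Finset.mem_coe, Fintype.mem_piFinset] at hkx ⊢
    intro h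
    obtain ⟨z, rfl⟩ := Θ.surjective h
    rcases z with j | t | t
    · rw [ringIndex_leg]; exact hkx.2 _
    · rw [ringIndex_out]; exact hkx.2 _
    · rw [ringIndex_back]; exact hkx.1
  · intro i hi hne
    by_cases h : ∀ s : S, edgeFactor f lam e G.next G.opp i (Θ (inr (inl s))) ≠ 0
    · obtain ⟨k, ⟨h0, rfl⟩, hk⟩ := R.exists_ringIndex_eq e lam hS h
      rw [Fintype.mem_piFinset] at hi
      refine absurd ⟨(i h0, fun j => i (Θ (inl j))), ?_, hk.symm⟩ hne
      simp only [Finset.coe_product, Set.mem_prod, Finset.mem_coe, Fintype.mem_piFinset]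
      exact ⟨hi _, fun j => hi _⟩
    · push Not at h
      obtain ⟨s, hs⟩ := h
      rw [hedge, Finset.prod_eq_zero (Finset.mem_univ s) hs]
      simp
  · rintro ⟨k, x⟩ -
    rw [hedge, hvert, ← Finset.prod_mul_distrib, ringTerm]
    congr 1
    · rw [← Finset.prod_coe_sort]
      refine Finset.prod_congr rfl fun s _ => ?_
      rw [R.cycleDiff_ringIndex lam, R.edgeFactor_ringIndex e lam, mul_comm]
      rfl
    · refine Finset.prod_congr rfl fun j _ => ?_
      rw [R.ringIndex_next_leg, R.leg, ringIndex_leg]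

end IsRing

end RingAmplitude

/-! ### The one-loop bracket as a sum over cuts -/

section Bracket

variable {n : ℕ}

/-- The cuts of a class of relevant diagrams. -/
def RelevantClass.cuts (c : RelevantClass n) : {S : Finset (Fin n) // S.Nonempty} :=
  ⟨NCDiagram.Relevant.cuts c.2.out.1, c.2.out.2.cuts_nonempty⟩

/-- Injectivity: relevant diagrams are rings, equal cuts force the same number of half-edges, and
rings with equal cuts are isomorphic. Surjectivity: every nonempty set of cuts has a ring, which is
relevant. -/
theorem RelevantClass.cuts_bijective : Function.Bijective (RelevantClass.cuts (n := n)) := by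
  constructor
  · rintro ⟨m, c⟩ ⟨m', c'⟩ h
    have h1 : NCDiagram.Relevant.cuts c.out.1 = NCDiagram.Relevant.cuts c'.out.1 :=
      congrArg Subtype.val h
    have R := c.out.2.isRing
    obtain ⟨Θ', R'⟩ : ∃ Θ', IsRing c'.out.1 (NCDiagram.Relevant.cuts c.out.1) Θ' := by
      rw [h1]; exact ⟨_, c'.out.2.isRing⟩
    generalize c.out.2.ringEquiv = Θ at R
    obtain rfl : m = m' := by simpa using Fintype.card_congr (Θ.symm.trans Θ')
    have h2 : c = c' := by
      rw [← Quotient.out_equiv_out]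
      exact R.iso R'
    rw [h2]
  · rintro ⟨S, hS⟩
    obtain ⟨m, G, Θ, R⟩ := exists_isRing S
    refine ⟨⟨m, ⟦⟨G, R.relevant hS⟩⟧⟩, Subtype.ext ?_⟩
    have h : NCDiagram.Iso _ _ := Quotient.mk_out (s := relevantSetoid n m) ⟨G, R.relevant hS⟩
    exact IsRing.cuts_eq
      (NCDiagram.Relevant.isRing (Quotient.out (⟦⟨G, R.relevant hS⟩⟧ : Quotient (relevantSetoid n m))).2)
      R h

instance : Finite (RelevantClass n) :=
  Finite.of_injective _ RelevantClass.cuts_bijective.1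

variable {ι : Type*} [DecidableEq ι] {N : ℕ} (e : Fin N ↪ ι) (f : ℝ → ℂ) (lam : ι → ℝ)

/-- The sum over the cuts of a cyclic word, and over the inner index. -/
def loopCoeff (l : List ι) : ℂ :=
  ∑ k : Fin N, loopSum (loopWeight e f lam (e k)) (loopVertex f lam (e k)) [] l []

variable {f}

omit [DecidableEq ι] in
theorem loopSum_eq_zero {w : ι → ℂ} (hw : ∀ y, w y = 0) (D : List ι → ℂ) (pre l suf : List ι) :
    loopSum w D pre l suf = 0 := by
  induction l generalizing pre with
  | nil => rfl
  | cons x l ih => rw [loopSum, hw, zero_mul, ih, zero_add]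

/-- Every term of `loopSum` has at least one cut, hence a propagator to the inner index, which
vanishes outside the cutoff. -/
theorem sum_loopSum {A : Finset ι} (hA : ∀ k, e k ∈ A) (l : List ι) :
    ∑ k ∈ A, loopSum (loopWeight e f lam k) (loopVertex f lam k) [] l [] = loopCoeff e f lam l := by
  rw [loopCoeff]
  have : ∑ k : Fin N, loopSum (loopWeight e f lam (e k)) (loopVertex f lam (e k)) [] l [] =
      ∑ k ∈ Finset.univ.map e, loopSum (loopWeight e f lam k) (loopVertex f lam k) [] l [] := by
    rw [Finset.sum_map]
  rw [this]
  symm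
  refine Finset.sum_subset ?_ fun k _ hk => loopSum_eq_zero (fun y => ?_) _ _ _ _
  · intro k hk
    obtain ⟨j, -, rfl⟩ := Finset.mem_map.1 hk
    exact hA j
  · rw [loopWeight, propagator, if_neg, neg_zero]
    rintro ⟨-, l, rfl⟩
    exact hk (Finset.mem_map_of_mem _ (Finset.mem_univ _))

theorem loopCoeff_rotate (l : List ι) (x : ι) :
    loopCoeff e f lam (l ++ [x]) = loopCoeff e f lam (x :: l) := by
  simp only [loopCoeff, loopSum_rotate]

theorem loopCoeff_comp_finRotate (x : Fin n → ι) :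
    loopCoeff e f lam (List.ofFn (x ∘ finRotate n)) = loopCoeff e f lam (List.ofFn x) := by
  cases n with
  | zero => rfl
  | succ n =>
    rw [List.ofFn_succ', List.concat_eq_append, List.ofFn_succ, loopCoeff_rotate]
    simp only [Function.comp_apply, finRotate_last]
    congr 3
    funext j
    rw [finRotate_apply, Fin.coeSucc_eq_succ]

/-- After an exchange of sums, the sum over diagrams becomes the sum over all cuts of the word of
outer indices. Diagrams do not occur in the proofs of cyclicity and of the Ward identity beyond this
point. -/
theorem oneLoopBracket_eq (hf : ContDiff ℝ (⊤ : ℕ∞) (deriv f))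
    (hpos : ∀ k l : Fin N, ∃ s : ℝ, 0 < s ∧ divDiff [lam (e k), lam (e l)] (deriv f) = (s : ℂ))
    {A : Finset ι} (hA : ∀ k, e k ∈ A) {V : Fin n → ι → ι → ℂ} (hV : ∀ j, SupportedIn A (V j)) :
    oneLoopBracket f lam e V = ∑ x ∈ Fintype.piFinset (fun _ : Fin n => A),
      loopCoeff e f lam (List.ofFn x) * ∏ j, V j (x j) (x (finRotate n j)) := by
  classical
  have h1 : ∀ c : RelevantClass n, NCDiagram.amplitude c.2.out.1 f lam e V =
      ∑ k ∈ A, ∑ x ∈ Fintype.piFinset (fun _ : Fin n => A),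
        ringTerm (loopWeight e f lam k) (loopVertex f lam k) c.cuts.1 (x ∘ finRotate n) *
          ∏ j, V j (x j) (x (finRotate n j)) := fun c =>
    (NCDiagram.Relevant.isRing c.2.out.2).amplitude_eq e lam c.cuts.2 hf hpos hA hV
  have h2 : oneLoopBracket f lam e V = ∑ S : {S : Finset (Fin n) // S.Nonempty},
      ∑ k ∈ A, ∑ x ∈ Fintype.piFinset (fun _ : Fin n => A),
        ringTerm (loopWeight e f lam k) (loopVertex f lam k) S.1 (x ∘ finRotate n) *
          ∏ j, V j (x j) (x (finRotate n j)) := by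
    rw [oneLoopBracket, ← finsum_eq_sum_of_fintype]
    exact finsum_eq_of_bijective _ RelevantClass.cuts_bijective h1
  rw [h2, Finset.sum_comm]
  simp only [Finset.sum_comm (s := Finset.univ) (t := Fintype.piFinset fun _ : Fin n => A)]
  rw [Finset.sum_comm]
  refine Finset.sum_congr rfl fun x _ => ?_
  simp only [← Finset.sum_mul]
  rw [← loopCoeff_comp_finRotate, ← sum_loopSum e lam hA]
  congr 1
  refine Finset.sum_congr rfl fun k _ => ?_
  rw [← sum_ringTerm, Finset.sum_subtype (p := Finset.Nonempty) _ (by simp)]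

end Bracket

/-! ### Matrices of operators -/

section MatrixElements

variable {H : Type*} [NormedAddCommGroup H] [InnerProductSpace ℂ H] {ι : Type*}
  (φ : HilbertBasis ι ℂ H)

theorem eq_of_inner_basis {x y : H} (h : ∀ i, inner ℂ (φ i) x = inner ℂ (φ i) y) : x = y := by
  refine φ.repr.injective (lp.ext (funext fun i => ?_))
  rw [φ.repr_apply_apply, φ.repr_apply_apply, h]

theorem eq_of_apply_basis {V W : H →L[ℂ] H} (h : ∀ i, V (φ i) = W (φ i)) : V = W := by
  refine ContinuousLinearMap.ext_on (s := Set.range φ) ?_ ?_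
  · rw [Submodule.dense_iff_topologicalClosure_eq_top]
    exact φ.dense_span
  · rintro _ ⟨i, rfl⟩
    exact h i

theorem matrixElt_add (V W : H →L[ℂ] H) (i j : ι) :
    matrixElt φ (V + W) i j = matrixElt φ V i j + matrixElt φ W i j := by
  simp [matrixElt]

theorem matrixElt_smul (c : ℂ) (V : H →L[ℂ] H) (i j : ι) :
    matrixElt φ (c • V) i j = c * matrixElt φ V i j := by
  simp [matrixElt]

/-- Parseval's identity, with a series that the hypothesis makes finite. -/
theorem matrixElt_mul [CompleteSpace H] {V W : H →L[ℂ] H} {i j : ι} {A : Finset ι}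
    (h : ∀ k, k ∉ A → matrixElt φ V i k * matrixElt φ W k j = 0) :
    matrixElt φ (V * W) i j = ∑ k ∈ A, matrixElt φ V i k * matrixElt φ W k j := by
  have h1 := φ.hasSum_inner_mul_inner (ContinuousLinearMap.adjoint V (φ i)) (W (φ j))
  simp only [ContinuousLinearMap.adjoint_inner_left] at h1
  exact h1.unique (hasSum_sum_of_ne_finset_zero h)

theorem IsFiniteMatrix.add {V W : H →L[ℂ] H} (hV : IsFiniteMatrix φ V) (hW : IsFiniteMatrix φ W) :
    IsFiniteMatrix φ (V + W) := by
  refine (Set.Finite.union hV hW).subset fun p hp => ?_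
  by_contra h
  simp only [Set.mem_union, Set.mem_ofPred_eq, not_or, not_not] at h
  exact hp (by rw [matrixElt_add, h.1, h.2, add_zero])

theorem IsFiniteMatrix.smul (c : ℂ) {V : H →L[ℂ] H} (hV : IsFiniteMatrix φ V) :
    IsFiniteMatrix φ (c • V) := by
  refine hV.subset fun p hp h => hp ?_
  rw [matrixElt_smul, h, mul_zero]

theorem IsFiniteMatrix.zero : IsFiniteMatrix φ (0 : H →L[ℂ] H) := by
  simp [IsFiniteMatrix, matrixElt]

variable (H) in
/-- The space `ℳ` of finite matrices. -/
def finiteMatrices : Submodule ℂ (H →L[ℂ] H) where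
  carrier := {V | IsFiniteMatrix φ V}
  add_mem' := IsFiniteMatrix.add φ
  zero_mem' := IsFiniteMatrix.zero φ
  smul_mem' c _ := IsFiniteMatrix.smul φ c

variable {φ}

theorem IsFiniteMatrix.exists_supportedIn {n : ℕ} {W : Fin n → H →L[ℂ] H}
    (hW : ∀ j, IsFiniteMatrix φ (W j)) (B : Finset ι) :
    ∃ A : Finset ι, B ⊆ A ∧ ∀ j, SupportedIn A (matrixElt φ (W j)) := by
  classical
  refine ⟨B ∪ Finset.univ.biUnion fun j => (hW j).toFinset.image Prod.fst ∪
    (hW j).toFinset.image Prod.snd, Finset.subset_union_left, fun j a b hab => ?_⟩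
  have h : (a, b) ∈ (hW j).toFinset := (hW j).mem_toFinset.2 hab
  constructor <;> refine Finset.mem_union_right _ (Finset.mem_biUnion.2 ⟨j, Finset.mem_univ _, ?_⟩)
  · exact Finset.mem_union_left _ (Finset.mem_image_of_mem Prod.fst h)
  · exact Finset.mem_union_right _ (Finset.mem_image_of_mem Prod.snd h)

theorem IsFiniteMatrix.mul_left [CompleteSpace H] {a V : H →L[ℂ] H} (hV : IsFiniteMatrix φ V)
    (ha : ∀ j, {i | matrixElt φ a i j ≠ 0}.Finite) : IsFiniteMatrix φ (a * V) := by
  obtain ⟨A, -, hA⟩ := IsFiniteMatrix.exists_supportedIn (W := fun _ : Fin 1 => V)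
    (fun _ => hV) ∅
  replace hA := hA 0
  have h1 : (⋃ k ∈ A, {i | matrixElt φ a i k ≠ 0}).Finite :=
    A.finite_toSet.biUnion fun k _ => ha k
  refine (h1.prod A.finite_toSet).subset ?_
  rintro ⟨i, j⟩ hij
  simp only [Set.mem_ofPred_eq] at hij
  rw [matrixElt_mul φ (A := A) fun k hk => by
    by_contra h; exact hk (hA _ _ (right_ne_zero_of_mul h)).1] at hij
  obtain ⟨k, hk, h⟩ := Finset.exists_ne_zero_of_sum_ne_zero hij
  exact ⟨Set.mem_biUnion (Finset.mem_coe.2 hk) (left_ne_zero_of_mul h),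
    (hA _ _ (right_ne_zero_of_mul h)).2⟩

theorem IsFiniteMatrix.mul_right [CompleteSpace H] {a V : H →L[ℂ] H} (hV : IsFiniteMatrix φ V)
    (ha : ∀ i, {j | matrixElt φ a i j ≠ 0}.Finite) : IsFiniteMatrix φ (V * a) := by
  obtain ⟨A, -, hA⟩ := IsFiniteMatrix.exists_supportedIn (W := fun _ : Fin 1 => V)
    (fun _ => hV) ∅
  replace hA := hA 0
  have h1 : (⋃ k ∈ A, {j | matrixElt φ a k j ≠ 0}).Finite :=
    A.finite_toSet.biUnion fun k _ => ha k
  refine (A.finite_toSet.prod h1).subset ?_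
  rintro ⟨i, j⟩ hij
  simp only [Set.mem_ofPred_eq] at hij
  rw [matrixElt_mul φ (A := A) fun k hk => by
    by_contra h; exact hk (hA _ _ (left_ne_zero_of_mul h)).2] at hij
  obtain ⟨k, hk, h⟩ := Finset.exists_ne_zero_of_sum_ne_zero hij
  exact ⟨(hA _ _ (left_ne_zero_of_mul h)).1,
    Set.mem_biUnion (Finset.mem_coe.2 hk) (right_ne_zero_of_mul h)⟩

end MatrixElements

/-! ### Commutators with `D` -/

namespace SpectralTriple

variable {𝒜 : Type*} [Ring 𝒜] [StarRing 𝒜] [Algebra ℂ 𝒜] {H : Type*}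
  [NormedAddCommGroup H] [InnerProductSpace ℂ H] [CompleteSpace H] (T : SpectralTriple 𝒜 H)

theorem comm_apply (a : 𝒜) (x : T.D.domain) :
    T.comm a x = T.D ⟨T.rep a x, T.rep_mem a x⟩ - T.rep a (T.D x) := (T.boundedComm a).choose_spec x

theorem inner_D_left (x y : T.D.domain) : inner ℂ (T.D x) (y : H) = inner ℂ (x : H) (T.D y) := by
  have h := LinearPMap.adjoint_isFormalAdjoint (T := T.D) T.selfAdjoint.dense_domain
  rw [LinearPMap.isSelfAdjoint_def.1 T.selfAdjoint] at h
  exact h x y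

variable {ι : Type*} {φ : HilbertBasis ι ℂ H} {lam : ι → ℝ}
  (hφ : ∀ i, ∃ h : φ i ∈ T.D.domain, T.D ⟨φ i, h⟩ = (lam i : ℂ) • φ i)
include hφ

theorem comm_add (a b : 𝒜) : T.comm (a + b) = T.comm a + T.comm b := by
  refine eq_of_apply_basis φ fun i => ?_
  obtain ⟨h, -⟩ := hφ i
  have h1 := T.comm_apply (a + b) ⟨φ i, h⟩
  have h2 := T.comm_apply a ⟨φ i, h⟩
  have h3 := T.comm_apply b ⟨φ i, h⟩
  have e : (⟨T.rep (a + b) (φ i), T.rep_mem (a + b) ⟨φ i, h⟩⟩ : T.D.domain) =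
      ⟨T.rep a (φ i), T.rep_mem a ⟨φ i, h⟩⟩ + ⟨T.rep b (φ i), T.rep_mem b ⟨φ i, h⟩⟩ :=
    Subtype.ext (by simp)
  rw [_root_.add_apply, h1, h2, h3, e, LinearPMap.map_add, map_add,
    _root_.add_apply]
  abel

theorem comm_smul (c : ℂ) (a : 𝒜) : T.comm (c • a) = c • T.comm a := by
  refine eq_of_apply_basis φ fun i => ?_
  obtain ⟨h, -⟩ := hφ i
  have h1 := T.comm_apply (c • a) ⟨φ i, h⟩
  have h2 := T.comm_apply a ⟨φ i, h⟩
  have e : (⟨T.rep (c • a) (φ i), T.rep_mem (c • a) ⟨φ i, h⟩⟩ : T.D.domain) =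
      c • ⟨T.rep a (φ i), T.rep_mem a ⟨φ i, h⟩⟩ :=
    Subtype.ext (by simp)
  rw [_root_.smul_apply, h1, h2, e, LinearPMap.map_smul, map_smul,
    _root_.smul_apply, smul_sub]

theorem comm_mul (a b : 𝒜) :
    T.comm (a * b) = T.rep a * T.comm b + T.comm a * T.rep b := by
  refine eq_of_apply_basis φ fun i => ?_
  obtain ⟨h, -⟩ := hφ i
  have h1 := T.comm_apply (a * b) ⟨φ i, h⟩
  have h2 := T.comm_apply b ⟨φ i, h⟩
  have h3 := T.comm_apply a ⟨T.rep b (φ i), T.rep_mem b ⟨φ i, h⟩⟩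
  have e : (⟨T.rep (a * b) (φ i), T.rep_mem (a * b) ⟨φ i, h⟩⟩ : T.D.domain) =
      ⟨T.rep a (T.rep b (φ i)), T.rep_mem a ⟨T.rep b (φ i), T.rep_mem b ⟨φ i, h⟩⟩⟩ :=
    Subtype.ext (by simp)
  dsimp only at h1 h2 h3
  rw [_root_.add_apply, mul_apply_eq_comp, mul_apply_eq_comp,
    h1, h2, h3, e, map_mul, mul_apply_eq_comp, map_sub]
  abel

theorem matrixElt_comm (a : 𝒜) (i j : ι) :
    matrixElt φ (T.comm a) i j = ((lam i : ℂ) - lam j) * matrixElt φ (T.rep a) i j := by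
  obtain ⟨hi, hi'⟩ := hφ i
  obtain ⟨hj, hj'⟩ := hφ j
  have h1 := T.comm_apply a ⟨φ j, hj⟩
  have h2 := T.inner_D_left ⟨φ i, hi⟩ ⟨T.rep a (φ j), T.rep_mem a ⟨φ j, hj⟩⟩
  dsimp only at h1 h2
  rw [matrixElt, matrixElt, h1, hj', inner_sub_right, ← h2, hi', map_smul, inner_smul_left,
    inner_smul_right, Complex.conj_ofReal]
  ring

/-- The resolvent acts on the eigenbasis by the nonzero numbers `(i - λ_j)⁻¹`, and the eigenspace of
a compact operator for a nonzero eigenvalue is finite-dimensional. -/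
theorem finite_eigenvalue (μ : ℝ) : {i | lam i = μ}.Finite := by
  classical
  obtain ⟨R, hR, hR'⟩ := T.compactResolvent
  have hne : ∀ t : ℝ, Complex.I - (t : ℂ) ≠ 0 := fun t h => by
    have := congrArg Complex.im h
    simp at this
  have key : ∀ j, R (φ j) = (Complex.I - lam j)⁻¹ • φ j := by
    intro j
    refine eq_of_inner_basis φ fun i => ?_
    obtain ⟨h, hx⟩ := hR' (φ j)
    obtain ⟨hi, hi'⟩ := hφ i
    have h1 := congrArg (inner ℂ (φ i)) hx
    have h2 := T.inner_D_left ⟨φ i, hi⟩ ⟨R (φ j), h⟩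
    dsimp only at h2
    rw [inner_sub_right, ← h2, hi', inner_smul_left, inner_smul_right, Complex.conj_ofReal,
      ← sub_mul] at h1
    rw [inner_smul_right]
    by_cases hij : i = j
    · subst hij
      rw [← h1, ← mul_assoc, inv_mul_cancel₀ (hne _), one_mul]
    · rw [orthonormal_iff_ite.1 φ.orthonormal, if_neg hij] at h1 ⊢
      rw [mul_zero]
      exact (mul_eq_zero.1 h1).resolve_left (hne _)
  have := ContinuousLinearMap.finite_dimensional_eigenspace hR (Complex.I - μ)⁻¹
    (inv_ne_zero (hne μ))
  have hmem : ∀ i : {i | lam i = μ}, φ i ∈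
      Module.End.eigenspace R.toLinearMap (Complex.I - μ)⁻¹ := by
    rintro ⟨i, rfl⟩
    rw [Module.End.mem_eigenspace_iff]
    exact key i
  have hli : LinearIndependent ℂ fun i : {i | lam i = μ} =>
      (⟨φ i, hmem i⟩ : Module.End.eigenspace R.toLinearMap (Complex.I - μ)⁻¹) := by
    refine LinearIndependent.of_comp (Submodule.subtype _) ?_
    exact φ.orthonormal.linearIndependent.comp _ Subtype.val_injective
  exact Set.finite_coe_iff.1 hli.finite

variable (hfin : ∀ x y : 𝒜, IsFiniteMatrix φ (T.rep x * T.comm y))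

omit hφ in
include hfin in
theorem isFiniteMatrix_comm (a : 𝒜) : IsFiniteMatrix φ (T.comm a) := by
  simpa using hfin 1 a

include hfin

/-- Entries of `a` between different eigenvalues are detected by the finite matrix `[D, a]`; those
with equal eigenvalues are finitely many by the compact resolvent. Thus multiplication by `a`
preserves finite matrices although `a` itself need not be one. -/
theorem finite_row (a : 𝒜) (i : ι) : {j | matrixElt φ (T.rep a) i j ≠ 0}.Finite := by
  refine ((T.finite_eigenvalue hφ (lam i)).union
    ((T.isFiniteMatrix_comm hfin a).image Prod.snd)).subset fun j hj => ?_
  by_cases h : lam j = lam i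
  · exact Or.inl h
  · refine Or.inr ⟨(i, j), ?_, rfl⟩
    simp only [Set.mem_ofPred_eq, T.matrixElt_comm hφ]
    refine mul_ne_zero (sub_ne_zero.2 fun h' => h ?_) hj
    exact_mod_cast h'.symm

theorem finite_col (a : 𝒜) (j : ι) : {i | matrixElt φ (T.rep a) i j ≠ 0}.Finite := by
  refine ((T.finite_eigenvalue hφ (lam j)).union
    ((T.isFiniteMatrix_comm hfin a).image Prod.fst)).subset fun i hi => ?_
  by_cases h : lam i = lam j
  · exact Or.inl h
  · refine Or.inr ⟨(i, j), ?_, rfl⟩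
    simp only [Set.mem_ofPred_eq, T.matrixElt_comm hφ]
    refine mul_ne_zero (sub_ne_zero.2 fun h' => h ?_) hi
    exact_mod_cast h'

theorem isFiniteMatrix_rep_mul (a : 𝒜) {V : H →L[ℂ] H} (hV : IsFiniteMatrix φ V) :
    IsFiniteMatrix φ (T.rep a * V) := hV.mul_left (T.finite_col hφ hfin a)

theorem isFiniteMatrix_mul_rep (a : 𝒜) {V : H →L[ℂ] H} (hV : IsFiniteMatrix φ V) :
    IsFiniteMatrix φ (V * T.rep a) := hV.mul_right (T.finite_row hφ hfin a)

omit hφ hfin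

/-- Invariance of the span under both `a` and `a*` makes `a` block diagonal with respect to the
cutoff. -/
theorem mem_range_iff {N : ℕ} {e : Fin N ↪ ι}
    (hinv : ∀ (x : 𝒜) (k : Fin N), T.rep x (φ (e k)) ∈ Submodule.span ℂ (Set.range fun l => φ (e l)))
    {a : 𝒜} {i j : ι} (h : matrixElt φ (T.rep a) i j ≠ 0) :
    (∃ k, e k = i) ↔ ∃ k, e k = j := by
  classical
  have key : ∀ (b : 𝒜) (i j : ι), matrixElt φ (T.rep b) i j ≠ 0 → (∃ k, e k = j) →
      ∃ k, e k = i := by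
    rintro b i _ hb ⟨k, rfl⟩
    by_contra hi
    refine hb ?_
    have h0 : ∀ x ∈ Submodule.span ℂ (Set.range fun l => φ (e l)), inner ℂ (φ i) x = 0 := by
      intro x hx
      induction hx using Submodule.span_induction with
      | mem x hx =>
        obtain ⟨l, rfl⟩ := hx
        rw [orthonormal_iff_ite.1 φ.orthonormal, if_neg fun h' => hi ⟨l, h'.symm⟩]
      | zero => exact inner_zero_right _
      | add x y _ _ hx hy => rw [inner_add_right, hx, hy, add_zero]
      | smul c x _ hx => rw [inner_smul_right, hx, mul_zero]
    exact h0 _ (hinv b k)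
  refine ⟨key (star a) j i fun h0 => h ?_, key a i j h⟩
  rw [matrixElt, map_star, ContinuousLinearMap.star_eq_adjoint,
    ContinuousLinearMap.adjoint_inner_right, ← inner_conj_symm] at h0
  exact (map_eq_zero _).1 h0

end SpectralTriple

/-! ### The one-loop bracket of finite matrices -/

section WardCoeff

variable {ι : Type*} [DecidableEq ι] {N : ℕ} (e : Fin N ↪ ι) {f : ℝ → ℂ} (lam : ι → ℝ)

/-- Inside the cutoff the weight is `-1 / f'[λ_k, ·]` and the identity subtracts two fractions;
outside both weights vanish. With one index on each side it would fail. -/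
theorem loopWeight_mul_loopWeight
    (hpos : ∀ k l : Fin N, ∃ s : ℝ, 0 < s ∧ divDiff [lam (e k), lam (e l)] (deriv f) = (s : ℂ))
    (k : Fin N) {x y : ι} (hxy : (∃ l, e l = x) ↔ ∃ l, e l = y) :
    loopWeight e f lam (e k) x * loopWeight e f lam (e k) y *
        (loopVertex f lam (e k) [y] - loopVertex f lam (e k) [x]) =
      loopWeight e f lam (e k) y - loopWeight e f lam (e k) x := by
  by_cases hx : ∃ l, e l = x
  · obtain ⟨p, rfl⟩ := hx
    obtain ⟨q, rfl⟩ := hxy.1 ⟨p, rfl⟩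
    have h : ∀ l, loopWeight e f lam (e k) (e l) = -(1 / loopVertex f lam (e k) [e l]) := by
      intro l
      rw [loopWeight, propagator_symm, propagator, if_pos ⟨⟨k, rfl⟩, l, rfl⟩]
      rfl
    have hne : ∀ l, loopVertex f lam (e k) [e l] ≠ 0 := by
      intro l
      obtain ⟨s, hs, hs'⟩ := hpos k l
      have h1 : loopVertex f lam (e k) [e l] = s := hs'
      rw [h1]
      exact_mod_cast hs.ne'
    rw [h, h]
    have := hne p
    have := hne q
    field_simp
    ring
  · have hy : ¬ ∃ l, e l = y := fun h => hx (hxy.2 h)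
    have h : ∀ z, (¬ ∃ l, e l = z) → loopWeight e f lam (e k) z = 0 := fun z hz => by
      rw [loopWeight, propagator, if_neg fun h => hz h.1, neg_zero]
    rw [h x hx, h y hy]
    ring

theorem ward_loopCoeff (hf : ContDiff ℝ (⊤ : ℕ∞) (deriv f))
    (hpos : ∀ k l : Fin N, ∃ s : ℝ, 0 < s ∧ divDiff [lam (e k), lam (e l)] (deriv f) = (s : ℂ))
    (L : List ι) {x y : ι} (hxy : (∃ l, e l = x) ↔ ∃ l, e l = y) :
    ((lam y : ℂ) - lam x) * loopCoeff e f lam (x :: (L ++ [y])) =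
      loopCoeff e f lam (L ++ [y]) - loopCoeff e f lam (x :: L) := by
  rw [loopCoeff_rotate]
  simp only [loopCoeff, Finset.mul_sum, ← Finset.sum_sub_distrib]
  refine Finset.sum_congr rfl fun k _ => ?_
  refine ward_loopSum (lam := fun i => (lam i : ℂ)) (fun l₁ l₂ x y => ?_) L x y
    (loopWeight_mul_loopWeight e lam hpos k hxy)
  have := sub_mul_divDiff hf (lam (e k) :: l₁.map lam) (l₂.map lam) (lam x) (lam y)
  simpa [loopVertex] using this

end WardCoeff

theorem finRotate_castSucc {n : ℕ} (j : Fin n) : finRotate (n + 1) j.castSucc = j.succ := by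
  rw [finRotate_apply, Fin.coeSucc_eq_succ]

section OpBracket

variable {H : Type*} [NormedAddCommGroup H] [InnerProductSpace ℂ H] {ι : Type*} [DecidableEq ι]
  {φ : HilbertBasis ι ℂ H} {f : ℝ → ℂ} {lam : ι → ℝ} {N : ℕ} {e : Fin N ↪ ι}
  (hf : ContDiff ℝ (⊤ : ℕ∞) (deriv f))
  (hpos : ∀ k l : Fin N, ∃ s : ℝ, 0 < s ∧ divDiff [lam (e k), lam (e l)] (deriv f) = (s : ℂ))
include hf hpos

theorem opBracket_eq {A : Finset ι} (hA : Finset.univ.map e ⊆ A) {n : ℕ} {W : Fin n → H →L[ℂ] H}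
    (hW : ∀ j, SupportedIn A (matrixElt φ (W j))) :
    opBracket φ f lam e W = ∑ x ∈ Fintype.piFinset (fun _ : Fin n => A),
      loopCoeff e f lam (List.ofFn x) * ∏ j, matrixElt φ (W j) (x j) (x (finRotate n j)) :=
  oneLoopBracket_eq e lam hf hpos (fun k => hA (Finset.mem_map_of_mem _ (Finset.mem_univ k))) hW

theorem opBracket_rotate {n : ℕ} {W : Fin n → H →L[ℂ] H} (hW : ∀ j, IsFiniteMatrix φ (W j)) :
    opBracket φ f lam e (fun j => W (finRotate n j)) = opBracket φ f lam e W := by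
  obtain ⟨A, hA, hA'⟩ := IsFiniteMatrix.exists_supportedIn hW (Finset.univ.map e)
  rw [opBracket_eq hf hpos hA hA', opBracket_eq hf hpos hA fun j => hA' _]
  refine Finset.sum_nbij' (fun x => x ∘ (finRotate n).symm) (fun x => x ∘ finRotate n) ?_ ?_ ?_ ?_ ?_
  · intro x hx
    rw [Fintype.mem_piFinset] at hx ⊢
    exact fun j => hx _
  · intro x hx
    rw [Fintype.mem_piFinset] at hx ⊢
    exact fun j => hx _
  · intro x _
    funext j
    simp only [Function.comp_apply, Equiv.symm_apply_apply]
  · intro x _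
    funext j
    simp only [Function.comp_apply, Equiv.apply_symm_apply]
  · intro x _
    rw [← loopCoeff_comp_finRotate (x := x ∘ (finRotate n).symm)]
    congr 1
    · congr 2
      funext j
      simp only [Function.comp_apply, Equiv.symm_apply_apply]
    · rw [← Equiv.prod_comp (finRotate n)
        fun j => matrixElt φ (W j) ((x ∘ (finRotate n).symm) j)
          ((x ∘ (finRotate n).symm) (finRotate n j))]
      simp only [Function.comp_apply, Equiv.symm_apply_apply]

theorem opBracket_update_add {n : ℕ} {W : Fin n → H →L[ℂ] H} (hW : ∀ j, IsFiniteMatrix φ (W j))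
    (j : Fin n) {X Y : H →L[ℂ] H} (hX : IsFiniteMatrix φ X) (hY : IsFiniteMatrix φ Y) :
    opBracket φ f lam e (Function.update W j (X + Y)) =
      opBracket φ f lam e (Function.update W j X) + opBracket φ f lam e (Function.update W j Y) := by
  obtain ⟨A, hA, hAW⟩ := IsFiniteMatrix.exists_supportedIn hW (Finset.univ.map e)
  obtain ⟨B, hB, hBX⟩ := IsFiniteMatrix.exists_supportedIn (W := ![X, Y])
    (by intro i; fin_cases i <;> assumption) A
  have hX' : SupportedIn B (matrixElt φ X) := hBX 0
  have hY' : SupportedIn B (matrixElt φ Y) := hBX 1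
  have hs : ∀ Z, SupportedIn B (matrixElt φ Z) →
      ∀ i, SupportedIn B (matrixElt φ (Function.update W j Z i)) := by
    intro Z hZ i
    by_cases h : i = j
    · subst h; rwa [Function.update_self]
    · rw [Function.update_of_ne h]; exact (hAW i).mono hB
  have hXY : SupportedIn B (matrixElt φ (X + Y)) := by
    intro a b h
    by_contra hab
    have h1 : matrixElt φ X a b = 0 := by_contra fun h' => hab (hX' a b h')
    have h2 : matrixElt φ Y a b = 0 := by_contra fun h' => hab (hY' a b h')
    exact h (by rw [matrixElt_add, h1, h2, add_zero])
  rw [opBracket_eq hf hpos (hA.trans hB) (hs _ hXY), opBracket_eq hf hpos (hA.trans hB) (hs _ hX'),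
    opBracket_eq hf hpos (hA.trans hB) (hs _ hY'), ← Finset.sum_add_distrib]
  refine Finset.sum_congr rfl fun x _ => ?_
  rw [← mul_add]
  congr 1
  have hprod : ∀ Z, ∏ i, matrixElt φ (Function.update W j Z i) (x i) (x (finRotate n i)) =
      matrixElt φ Z (x j) (x (finRotate n j)) *
        ∏ i ∈ Finset.univ.erase j, matrixElt φ (W i) (x i) (x (finRotate n i)) := by
    intro Z
    rw [← Finset.mul_prod_erase _ _ (Finset.mem_univ j), Function.update_self]
    congr 1
    refine Finset.prod_congr rfl fun i hi => ?_
    rw [Function.update_of_ne (Finset.ne_of_mem_erase hi)]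
  rw [hprod, hprod, hprod, matrixElt_add, add_mul]

theorem opBracket_update_smul {n : ℕ} {W : Fin n → H →L[ℂ] H} (hW : ∀ j, IsFiniteMatrix φ (W j))
    (j : Fin n) (c : ℂ) {X : H →L[ℂ] H} (hX : IsFiniteMatrix φ X) :
    opBracket φ f lam e (Function.update W j (c • X)) =
      c * opBracket φ f lam e (Function.update W j X) := by
  have hfin : ∀ Z, IsFiniteMatrix φ Z → ∀ i, IsFiniteMatrix φ (Function.update W j Z i) := by
    intro Z hZ i
    by_cases h : i = j
    · subst h; rwa [Function.update_self]
    · rw [Function.update_of_ne h]; exact hW i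
  obtain ⟨A, hA, hAW⟩ := IsFiniteMatrix.exists_supportedIn (hfin X hX) (Finset.univ.map e)
  have hs : ∀ i, SupportedIn A (matrixElt φ (Function.update W j (c • X) i)) := by
    intro i a b h
    refine hAW i a b fun h' => h ?_
    by_cases hi : i = j
    · subst hi
      rw [Function.update_self] at h' ⊢
      rw [matrixElt_smul, h', mul_zero]
    · rw [Function.update_of_ne hi] at h' ⊢
      exact h'
  rw [opBracket_eq hf hpos hA hs, opBracket_eq hf hpos hA hAW, Finset.mul_sum]
  refine Finset.sum_congr rfl fun x _ => ?_
  have hprod : ∀ Z, ∏ i, matrixElt φ (Function.update W j Z i) (x i) (x (finRotate n i)) =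
      matrixElt φ Z (x j) (x (finRotate n j)) *
        ∏ i ∈ Finset.univ.erase j, matrixElt φ (W i) (x i) (x (finRotate n i)) := by
    intro Z
    rw [← Finset.mul_prod_erase _ _ (Finset.mem_univ j), Function.update_self]
    congr 1
    refine Finset.prod_congr rfl fun i hi => ?_
    rw [Function.update_of_ne (Finset.ne_of_mem_erase hi)]
  rw [hprod, hprod, matrixElt_smul]
  ring

omit hf hpos [DecidableEq ι] in
theorem sum_piFinset_cons {n : ℕ} (A : Finset ι) (g : (Fin (n + 1) → ι) → ℂ) :
    ∑ y ∈ Fintype.piFinset (fun _ : Fin (n + 1) => A), g y =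
      ∑ u ∈ Fintype.piFinset (fun _ : Fin n => A), ∑ k ∈ A, g (Fin.cons k u) := by
  rw [← Finset.sum_product']
  refine Finset.sum_nbij' (fun y => (Fin.tail y, y 0))
    (fun p => Fin.cons (α := fun _ => ι) p.2 p.1) ?_ ?_ ?_ ?_ ?_
  · intro y hy
    rw [Fintype.mem_piFinset] at hy
    exact Finset.mem_product.2 ⟨Fintype.mem_piFinset.2 fun j => hy _, hy 0⟩
  · rintro ⟨u, k⟩ h
    rw [Finset.mem_product, Fintype.mem_piFinset] at h
    rw [Fintype.mem_piFinset]
    exact fun j => Fin.cases h.2 h.1 j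
  · intro y _; exact Fin.cons_self_tail y
  · rintro ⟨u, k⟩ _; simp
  · intro y _; simp only [Fin.cons_self_tail]

omit hf hpos [DecidableEq ι] in
theorem sum_piFinset_snoc {n : ℕ} (A : Finset ι) (g : (Fin (n + 1) → ι) → ℂ) :
    ∑ y ∈ Fintype.piFinset (fun _ : Fin (n + 1) => A), g y =
      ∑ u ∈ Fintype.piFinset (fun _ : Fin n => A), ∑ k ∈ A, g (Fin.snoc u k) := by
  rw [← Finset.sum_product']
  refine Finset.sum_nbij' (fun y => (Fin.init y, y (Fin.last n)))
    (fun p => Fin.snoc (α := fun _ => ι) p.1 p.2) ?_ ?_ ?_ ?_ ?_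
  · intro y hy
    rw [Fintype.mem_piFinset] at hy
    exact Finset.mem_product.2 ⟨Fintype.mem_piFinset.2 fun j => hy _, hy _⟩
  · rintro ⟨u, k⟩ h
    rw [Finset.mem_product, Fintype.mem_piFinset] at h
    rw [Fintype.mem_piFinset]
    refine fun j => Fin.lastCases ?_ (fun j => ?_) j
    · simpa using h.2
    · simpa using h.1 j
  · intro y _; exact Fin.snoc_init_self y
  · rintro ⟨u, k⟩ _; simp
  · intro y _; simp only [Fin.snoc_init_self]

variable [CompleteSpace H] {𝒜 : Type*} [Ring 𝒜] [StarRing 𝒜] [Algebra ℂ 𝒜]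
  {T : SpectralTriple 𝒜 H}
  (hφ : ∀ i, ∃ h : φ i ∈ T.D.domain, T.D ⟨φ i, h⟩ = (lam i : ℂ) • φ i)
  (hfin : ∀ x y : 𝒜, IsFiniteMatrix φ (T.rep x * T.comm y))
  (hinv : ∀ (x : 𝒜) (k : Fin N), T.rep x (φ (e k)) ∈ Submodule.span ℂ (Set.range fun l => φ (e l)))
include hφ hfin hinv

/-- The quantum Ward identity. -/
theorem opBracket_ward {n : ℕ} {W : Fin (n + 1) → H →L[ℂ] H} (hW : ∀ j, IsFiniteMatrix φ (W j))
    (a : 𝒜) :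
    opBracket φ f lam e (Function.update W 0 (T.rep a * W 0)) -
        opBracket φ f lam e (Function.update W (Fin.last n) (W (Fin.last n) * T.rep a)) =
      opBracket φ f lam e (Fin.snoc (α := fun _ => H →L[ℂ] H) W (T.comm a)) := by
  have hupd : ∀ j Z, IsFiniteMatrix φ Z → ∀ i, IsFiniteMatrix φ (Function.update W j Z i) := by
    intro j Z hZ i
    by_cases h : i = j
    · subst h; rwa [Function.update_self]
    · rw [Function.update_of_ne h]; exact hW i
  have hsnoc : ∀ j, IsFiniteMatrix φ (Fin.snoc (α := fun _ => H →L[ℂ] H) W (T.comm a) j) := by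
    intro j
    refine Fin.lastCases ?_ (fun j => ?_) j
    · simpa using T.isFiniteMatrix_comm hfin a
    · simpa using hW j
  obtain ⟨A₁, h₁, hA₁⟩ := IsFiniteMatrix.exists_supportedIn hsnoc (Finset.univ.map e)
  obtain ⟨A₂, h₂, hA₂⟩ := IsFiniteMatrix.exists_supportedIn
    (hupd 0 _ (T.isFiniteMatrix_rep_mul hφ hfin a (hW 0))) A₁
  obtain ⟨A, h₃, hA₃⟩ := IsFiniteMatrix.exists_supportedIn
    (hupd (Fin.last n) _ (T.isFiniteMatrix_mul_rep hφ hfin a (hW (Fin.last n)))) A₂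
  have hA := h₁.trans (h₂.trans h₃)
  have hWA : ∀ j, SupportedIn A (matrixElt φ (W j)) := fun j => by
    have := hA₁ j.castSucc
    rw [Fin.snoc_castSucc] at this
    exact this.mono (h₂.trans h₃)
  rw [opBracket_eq hf hpos hA hA₃, opBracket_eq hf hpos hA fun j => (hA₂ j).mono h₃,
    opBracket_eq hf hpos hA fun j => (hA₁ j).mono (h₂.trans h₃)]
  set α := matrixElt φ (T.rep a)
  set w : (j : Fin (n + 1)) → ι → ι → ℂ := fun j => matrixElt φ (W j) with hw
  -- The entry of `[D, a]` is an eigenvalue difference times an entry of `a`. The coefficient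
  -- absorbs the difference, by dropping the first or the last index.
  have hright : ∀ y : Fin (n + 2) → ι,
      loopCoeff e f lam (List.ofFn y) * ∏ j, matrixElt φ
        (Fin.snoc (α := fun _ => H →L[ℂ] H) W (T.comm a) j) (y j) (y (finRotate (n + 2) j)) =
      loopCoeff e f lam (List.ofFn fun j : Fin (n + 1) => y j.succ) *
          ((∏ j : Fin (n + 1), w j (y j.castSucc) (y j.succ)) * α (y (Fin.last (n + 1))) (y 0)) -
        loopCoeff e f lam (List.ofFn fun j : Fin (n + 1) => y j.castSucc) *
          ((∏ j : Fin (n + 1), w j (y j.castSucc) (y j.succ)) * α (y (Fin.last (n + 1))) (y 0)) := by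
    intro y
    rw [Fin.prod_univ_castSucc]
    simp only [Fin.snoc_castSucc, Fin.snoc_last, finRotate_castSucc, finRotate_last,
      T.matrixElt_comm hφ]
    -- Where the entry of `a` vanishes both sides are zero; elsewhere its indices lie on the same
    -- side of the cutoff.
    by_cases h0 : α (y (Fin.last (n + 1))) (y 0) = 0
    · simp only [α] at h0 ⊢
      rw [h0]; ring
    have h1 := ward_loopCoeff e lam hf hpos (List.ofFn fun j : Fin n => y j.succ.castSucc)
      (T.mem_range_iff hinv h0).symm
    have e1 : List.ofFn y = y 0 :: ((List.ofFn fun j : Fin n => y j.succ.castSucc) ++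
        [y (Fin.last (n + 1))]) := by
      rw [List.ofFn_succ, List.ofFn_succ', List.concat_eq_append]; rfl
    have e2 : (List.ofFn fun j : Fin (n + 1) => y j.succ) =
        (List.ofFn fun j : Fin n => y j.succ.castSucc) ++ [y (Fin.last (n + 1))] := by
      rw [List.ofFn_succ', List.concat_eq_append]; rfl
    have e3 : (List.ofFn fun j : Fin (n + 1) => y j.castSucc) =
        y 0 :: (List.ofFn fun j : Fin n => y j.succ.castSucc) := by
      rw [List.ofFn_succ]; rfl
    rw [e1, e2, e3]
    linear_combination (∏ j : Fin (n + 1), w j (y j.castSucc) (y j.succ)) *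
      α (y (Fin.last (n + 1))) (y 0) * h1
  rw [Finset.sum_congr rfl fun y _ => hright y, Finset.sum_sub_distrib]
  congr 1
  -- The coefficient no longer contains the first index, and summing over it forms the matrix
  -- product `a W 0`, up to a rotation of the other indices.
  · rw [sum_piFinset_cons (n := n + 1)]
    refine Finset.sum_nbij' (fun x => x ∘ finRotate (n + 1)) (fun x => x ∘ (finRotate (n + 1)).symm)
      ?_ ?_ ?_ ?_ ?_
    · intro x hx
      rw [Fintype.mem_piFinset] at hx ⊢
      exact fun j => hx _
    · intro x hx
      rw [Fintype.mem_piFinset] at hx ⊢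
      exact fun j => hx _
    · intro x _
      funext j
      simp only [Function.comp_apply, Equiv.apply_symm_apply]
    · intro x _
      funext j
      simp only [Function.comp_apply, Equiv.symm_apply_apply]
    · intro x _
      have e0 : matrixElt φ (T.rep a * W 0) (x 0) (x (finRotate (n + 1) 0)) =
          ∑ k ∈ A, α (x 0) k * w 0 k (x (finRotate (n + 1) 0)) :=
        matrixElt_mul φ fun k hk => by
          by_contra h; exact hk (hWA 0 _ _ (right_ne_zero_of_mul h)).1
      rw [Fin.prod_univ_succ, Function.update_self, e0, Finset.sum_mul, Finset.mul_sum]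
      refine Finset.sum_congr rfl fun k _ => ?_
      rw [Fin.prod_univ_succ]
      simp only [Fin.cons_succ, Fin.castSucc_zero, Fin.cons_zero, ← Fin.succ_castSucc,
        Function.comp_apply, ← Fin.succ_last, finRotate_last, finRotate_castSucc]
      have e1 : loopCoeff e f lam (List.ofFn fun j => x (finRotate (n + 1) j)) =
          loopCoeff e f lam (List.ofFn x) := loopCoeff_comp_finRotate e lam x
      have e2 : ∏ j : Fin n, matrixElt φ (Function.update W 0 (T.rep a * W 0) j.succ) (x j.succ)
          (x (finRotate (n + 1) j.succ)) =
          ∏ j : Fin n, w j.succ (x j.succ) (x (finRotate (n + 1) j.succ)) :=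
        Finset.prod_congr rfl fun j _ => by rw [Function.update_of_ne (Fin.succ_ne_zero j)]
      rw [e1, e2]
      ring
  -- Here the last index is free, and summing over it forms the product of the last field with `a`.
  · rw [sum_piFinset_snoc (n := n + 1)]
    refine Finset.sum_congr rfl fun x _ => ?_
    have e0 : matrixElt φ (W (Fin.last n) * T.rep a) (x (Fin.last n)) (x (finRotate (n + 1) (Fin.last n))) =
        ∑ k ∈ A, w (Fin.last n) (x (Fin.last n)) k * α k (x (finRotate (n + 1) (Fin.last n))) :=
      matrixElt_mul φ fun k hk => by
        by_contra h; exact hk (hWA _ _ _ (left_ne_zero_of_mul h)).2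
    rw [Fin.prod_univ_castSucc, Function.update_self, e0, Finset.mul_sum, Finset.mul_sum]
    refine Finset.sum_congr rfl fun k _ => ?_
    rw [Fin.prod_univ_castSucc]
    have e2 : ∏ j : Fin n, matrixElt φ (Function.update W (Fin.last n) (W (Fin.last n) * T.rep a)
          j.castSucc) (x j.castSucc) (x (finRotate (n + 1) j.castSucc)) =
          ∏ j : Fin n, w j.castSucc (x j.castSucc) (x j.succ) :=
        Finset.prod_congr rfl fun j _ => by
          rw [Function.update_of_ne (Fin.castSucc_lt_last j).ne, finRotate_castSucc]
    have e3 : (Fin.snoc x k : Fin (n + 2) → ι) 0 = x 0 := by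
      rw [← Fin.castSucc_zero, Fin.snoc_castSucc]
    simp only [Fin.snoc_castSucc, Fin.succ_last, Fin.snoc_last, e3, e2, finRotate_last,
      Fin.succ_castSucc]
    ring

end OpBracket

/-! ### Cyclic brackets with Ward identity -/

/-- A cyclic multilinear bracket on an `𝒜`-bimodule `M` with a derivation `der : 𝒜 → M`, for which
the Ward identity holds. -/
structure WardBracket (𝒜 M : Type*) [Ring 𝒜] [Algebra ℂ 𝒜] [AddCommGroup M] [Module ℂ M] where
  lmul : 𝒜 →ₗ[ℂ] M →ₗ[ℂ] M
  rmul : 𝒜 →ₗ[ℂ] M →ₗ[ℂ] M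
  der : 𝒜 →ₗ[ℂ] M
  brk : List M → ℂ
  one_lmul : ∀ V, lmul 1 V = V
  one_rmul : ∀ V, rmul 1 V = V
  lmul_lmul : ∀ a b V, lmul a (lmul b V) = lmul (a * b) V
  lmul_rmul : ∀ a b V, lmul a (rmul b V) = rmul b (lmul a V)
  der_mul : ∀ a b, der (a * b) = lmul a (der b) + rmul b (der a)
  brk_add_head : ∀ V W l, brk ((V + W) :: l) = brk (V :: l) + brk (W :: l)
  brk_smul_head : ∀ (c : ℂ) V l, brk ((c • V) :: l) = c * brk (V :: l)
  brk_rotate : ∀ l V, brk (l ++ [V]) = brk (V :: l)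
  ward_cons : ∀ a V l W, brk (lmul a V :: (l ++ [W])) - brk (V :: (l ++ [rmul a W])) =
    brk (V :: (l ++ [W, der a]))
  ward_single : ∀ a V, brk [lmul a V] - brk [rmul a V] = brk [V, der a]
  -- A substitute for the Ward identity of an empty list of fields. It is what makes `B ψ₁` vanish.
  brk_der : ∀ a, brk [der a] = 0

theorem ofFn_snoc {α : Type*} {n : ℕ} (W : Fin n → α) (x : α) :
    List.ofFn (Fin.snoc (α := fun _ => α) W x) = List.ofFn W ++ [x] := by
  rw [List.ofFn_succ', List.concat_eq_append]
  simp

namespace WardBracket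

variable {𝒜 M : Type*} [Ring 𝒜] [Algebra ℂ 𝒜] [AddCommGroup M] [Module ℂ M]
  (β : WardBracket 𝒜 M)

theorem brk_append_comm (l₁ l₂ : List M) : β.brk (l₁ ++ l₂) = β.brk (l₂ ++ l₁) := by
  induction l₂ generalizing l₁ with
  | nil => simp
  | cons x l ih =>
    have h := ih (l₁ ++ [x])
    rw [List.append_assoc, List.singleton_append] at h
    rw [h, ← List.append_assoc, β.brk_rotate]
    rfl

theorem brk_add (l₁ l₂ : List M) (V W : M) :
    β.brk (l₁ ++ (V + W) :: l₂) = β.brk (l₁ ++ V :: l₂) + β.brk (l₁ ++ W :: l₂) := by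
  simp only [β.brk_append_comm l₁, List.cons_append, β.brk_add_head]

theorem brk_smul (l₁ l₂ : List M) (c : ℂ) (V : M) :
    β.brk (l₁ ++ (c • V) :: l₂) = c * β.brk (l₁ ++ V :: l₂) := by
  simp only [β.brk_append_comm l₁, List.cons_append, β.brk_smul_head]

theorem brk_zero (l₁ l₂ : List M) : β.brk (l₁ ++ 0 :: l₂) = 0 := by
  have := β.brk_smul l₁ l₂ 0 0
  simpa using this

/-- The Ward identity at an inner position. -/
theorem ward (a : 𝒜) (l₁ l₂ : List M) (V W : M) :
    β.brk (l₁ ++ V :: β.lmul a W :: l₂) =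
      β.brk (l₁ ++ β.rmul a V :: W :: l₂) + β.brk (l₁ ++ V :: β.der a :: W :: l₂) := by
  have h := β.ward_cons a W (l₂ ++ l₁) V
  have e1 : β.brk (l₁ ++ V :: β.lmul a W :: l₂) = β.brk (β.lmul a W :: (l₂ ++ l₁ ++ [V])) := by
    have := β.brk_append_comm (l₁ ++ [V]) (β.lmul a W :: l₂)
    simpa using this
  have e2 : β.brk (l₁ ++ β.rmul a V :: W :: l₂) = β.brk (W :: (l₂ ++ l₁ ++ [β.rmul a V])) := by
    have := β.brk_append_comm (l₁ ++ [β.rmul a V]) (W :: l₂)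
    simpa using this
  have e3 : β.brk (l₁ ++ V :: β.der a :: W :: l₂) = β.brk (W :: (l₂ ++ l₁ ++ [V, β.der a])) := by
    have := β.brk_append_comm (l₁ ++ [V, β.der a]) (W :: l₂)
    simpa using this
  rw [e1, e2, e3, ← h]
  ring

theorem der_one : β.der 1 = 0 := by
  have h := β.der_mul 1 1
  rw [one_mul, β.one_lmul] at h
  simpa [β.one_rmul] using h

end WardBracket

/-! ### The one-loop bracket of finite matrices as a Ward bracket -/

section OpWard

variable {H : Type*} [NormedAddCommGroup H] [InnerProductSpace ℂ H] {ι : Type*} [DecidableEq ι]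
  {φ : HilbertBasis ι ℂ H} {f : ℝ → ℂ} {lam : ι → ℝ} {N : ℕ} {e : Fin N ↪ ι}
  (hf : ContDiff ℝ (⊤ : ℕ∞) (deriv f))
  (hpos : ∀ k l : Fin N, ∃ s : ℝ, 0 < s ∧ divDiff [lam (e k), lam (e l)] (deriv f) = (s : ℂ))

variable (φ f lam e) in
/-- The one-loop bracket of a list of finite matrices. -/
def listBracket (l : List (finiteMatrices H φ)) : ℂ :=
  opBracket φ f lam e fun j : Fin l.length => (l.get j : H →L[ℂ] H)

omit [DecidableEq ι] in
theorem apply_get_ofFn {α : Type*} (g : ∀ n, (Fin n → α) → ℂ) {n : ℕ} (W : Fin n → α) :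
    g _ (List.ofFn W).get = g n W := by
  have key : ∀ {n'} (h : n' = n) (W' : Fin n' → α), (∀ j, W' j = W (Fin.cast h j)) →
      g n' W' = g n W := by
    rintro _ rfl W' h
    exact congrArg _ (funext h)
  exact key (List.length_ofFn) _ fun j => by simp; rfl

theorem listBracket_ofFn {n : ℕ} (W : Fin n → finiteMatrices H φ) :
    listBracket φ f lam e (List.ofFn W) = opBracket φ f lam e fun j => (W j : H →L[ℂ] H) :=
  apply_get_ofFn (fun n W => opBracket φ f lam e fun j : Fin n => ((W j : finiteMatrices H φ) : H →L[ℂ] H)) W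

include hf hpos

theorem listBracket_rotate (l : List (finiteMatrices H φ)) (V : finiteMatrices H φ) :
    listBracket φ f lam e (l ++ [V]) = listBracket φ f lam e (V :: l) := by
  have h := opBracket_rotate hf hpos (φ := φ) (lam := lam) (e := e)
    (W := fun j => ((V :: l).get j : H →L[ℂ] H)) fun j => ((V :: l).get j).2
  have e1 : l ++ [V] = List.ofFn fun j => (V :: l).get (finRotate _ j) := by
    change _ = List.ofFn fun j : Fin (l.length + 1) => (V :: l).get (finRotate (l.length + 1) j)
    rw [List.ofFn_succ', List.concat_eq_append]
    simp only [finRotate_castSucc, finRotate_last]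
    simp
  rw [e1, listBracket_ofFn, h]
  rfl

variable [CompleteSpace H] {𝒜 : Type*} [Ring 𝒜] [StarRing 𝒜] [Algebra ℂ 𝒜]
  (T : SpectralTriple 𝒜 H)
  (hφ : ∀ i, ∃ h : φ i ∈ T.D.domain, T.D ⟨φ i, h⟩ = (lam i : ℂ) • φ i)
  (hfin : ∀ x y : 𝒜, IsFiniteMatrix φ (T.rep x * T.comm y))
  (hinv : ∀ (x : 𝒜) (k : Fin N), T.rep x (φ (e k)) ∈ Submodule.span ℂ (Set.range fun l => φ (e l)))

/-- The one-loop bracket on the bimodule of finite matrices. -/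
def opWard : WardBracket 𝒜 (finiteMatrices H φ) where
  lmul := LinearMap.mk₂ ℂ
    (fun a V => ⟨T.rep a * V, T.isFiniteMatrix_rep_mul hφ hfin a V.2⟩)
    (fun a b V => Subtype.ext (by simp [add_mul])) (fun c a V => Subtype.ext (by simp))
    (fun a V W => Subtype.ext (by simp [mul_add])) (fun c a V => Subtype.ext (by simp))
  rmul := LinearMap.mk₂ ℂ
    (fun a V => ⟨V * T.rep a, T.isFiniteMatrix_mul_rep hφ hfin a V.2⟩)
    (fun a b V => Subtype.ext (by simp [mul_add])) (fun c a V => Subtype.ext (by simp))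
    (fun a V W => Subtype.ext (by simp [add_mul])) (fun c a V => Subtype.ext (by simp))
  der :=
    { toFun := fun a => ⟨T.comm a, T.isFiniteMatrix_comm hfin a⟩
      map_add' := fun a b => Subtype.ext (T.comm_add hφ a b)
      map_smul' := fun c a => Subtype.ext (T.comm_smul hφ c a) }
  brk := listBracket φ f lam e
  one_lmul V := Subtype.ext (by simp)
  one_rmul V := Subtype.ext (by simp)
  lmul_lmul a b V := Subtype.ext (by simp [mul_assoc])
  lmul_rmul a b V := Subtype.ext (by simp [mul_assoc])
  der_mul a b := Subtype.ext (T.comm_mul hφ a b)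
  brk_add_head V W l := by
    have h := opBracket_update_add hf hpos (lam := lam) (e := e)
      (W := fun j => ((V :: l).get j : H →L[ℂ] H)) (fun j => ((V :: l).get j).2)
      (0 : Fin (l.length + 1)) V.2 W.2
    have e1 : ∀ X : finiteMatrices H φ, listBracket φ f lam e (X :: l) = opBracket φ f lam e
        (Function.update (fun j => ((V :: l).get j : H →L[ℂ] H)) (0 : Fin (l.length + 1)) X) := by
      intro X
      rw [listBracket]
      congr 1
      funext j
      exact Fin.cases rfl (fun _ => rfl) j
    rw [e1, e1, e1]
    exact h
  brk_smul_head c V l := by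
    have h := opBracket_update_smul hf hpos (lam := lam) (e := e)
      (W := fun j => ((V :: l).get j : H →L[ℂ] H)) (fun j => ((V :: l).get j).2)
      (0 : Fin (l.length + 1)) c V.2
    have e1 : ∀ X : finiteMatrices H φ, listBracket φ f lam e (X :: l) = opBracket φ f lam e
        (Function.update (fun j => ((V :: l).get j : H →L[ℂ] H)) (0 : Fin (l.length + 1)) X) := by
      intro X
      rw [listBracket]
      congr 1
      funext j
      exact Fin.cases rfl (fun _ => rfl) j
    rw [e1, e1]
    exact h
  brk_rotate := listBracket_rotate hf hpos
  ward_cons a V l W := by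
    have h := opBracket_ward hf hpos hφ hfin hinv (W := fun j => ((Fin.cons
      (α := fun _ => finiteMatrices H φ) V (Fin.snoc (α := fun _ => finiteMatrices H φ) l.get W) j :
        finiteMatrices H φ) : H →L[ℂ] H)) (fun j => Subtype.property _) a
    have hlist : ∀ X Y : finiteMatrices H φ, listBracket φ f lam e (X :: (l ++ [Y])) =
        opBracket φ f lam e fun j => ((Fin.cons (α := fun _ => finiteMatrices H φ) X
          (Fin.snoc (α := fun _ => finiteMatrices H φ) l.get Y) j : finiteMatrices H φ) :
            H →L[ℂ] H) := by
      intro X Y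
      rw [← listBracket_ofFn, List.ofFn_cons, ofFn_snoc, List.ofFn_get]
    have hlist' : ∀ X Y Z : finiteMatrices H φ, listBracket φ f lam e (X :: (l ++ [Y, Z])) =
        opBracket φ f lam e fun j => ((Fin.snoc (α := fun _ => finiteMatrices H φ)
          (Fin.cons (α := fun _ => finiteMatrices H φ) X
          (Fin.snoc (α := fun _ => finiteMatrices H φ) l.get Y)) Z j : finiteMatrices H φ) :
            H →L[ℂ] H) := by
      intro X Y Z
      rw [← listBracket_ofFn, ofFn_snoc, List.ofFn_cons, ofFn_snoc, List.ofFn_get]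
      simp
    rw [hlist, hlist, hlist']
    convert h using 3
    · funext j
      refine Fin.cases ?_ (fun j => ?_) j
      · simp
      · simp [Function.update_of_ne]
    · funext j
      refine Fin.lastCases ?_ (fun j => ?_) j
      · rw [← Fin.succ_last]; simp
      · rw [Function.update_of_ne (Fin.castSucc_lt_last j).ne]
        refine Fin.cases ?_ (fun j => ?_) j
        · simp
        · simp
    · rename_i j
      refine Fin.lastCases ?_ (fun j => ?_) j
      · simp
      · simp
  ward_single a V := by
    have h := opBracket_ward hf hpos hφ hfin hinv (W := fun _ : Fin 1 => (V : H →L[ℂ] H))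
      (fun _ => V.2) a
    convert h using 2
    · rw [listBracket]
      congr 1
      funext j
      exact Fin.cases rfl (fun j => j.elim0) j
    · rw [listBracket]
      congr 1
      funext j
      exact Fin.cases rfl (fun j => j.elim0) j
    · rw [listBracket]
      congr 1
      funext j
      exact Fin.cases rfl (fun j => Fin.cases rfl (fun j => j.elim0) j) j
  brk_der a := by
    obtain ⟨A, hA, hA'⟩ := IsFiniteMatrix.exists_supportedIn (W := fun _ : Fin 1 => T.comm a)
      (fun _ => T.isFiniteMatrix_comm hfin a) (Finset.univ.map e)
    have h := opBracket_eq hf hpos hA hA'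
    have h1 : listBracket φ f lam e [⟨T.comm a, T.isFiniteMatrix_comm hfin a⟩] =
        opBracket φ f lam e fun _ : Fin 1 => T.comm a := by
      rw [listBracket]
      congr 1
      funext j
      exact Fin.cases rfl (fun j => j.elim0) j
    -- A one-point bracket sees only diagonal entries, and those of `[D, a]` are zero.
    refine h1.trans (h.trans (Finset.sum_eq_zero fun x _ => ?_))
    rw [Fin.prod_univ_one, T.matrixElt_comm hφ]
    have : finRotate 1 0 = 0 := rfl
    rw [this]
    ring

end OpWard

/-! ### Differential graded structure of universal forms -/

namespace Forms

variable {𝒜 : Type*} [Ring 𝒜] [Algebra ℂ 𝒜]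

theorem induction {P : Forms 𝒜 → Prop} (of : ∀ a, P (Forms.of a)) (dOf : ∀ a, P (Forms.dOf a))
    (add : ∀ x y, P x → P y → P (x + y)) (mul : ∀ x y, P x → P y → P (x * y)) (x : Forms 𝒜) :
    P x := by
  obtain ⟨y, rfl⟩ : ∃ y, Forms.mk 𝒜 y = x := RingQuot.mkAlgHom_surjective ℂ (FormRel 𝒜) x
  induction y using FreeAlgebra.induction with
  | grade0 c =>
    have h : Forms.mk 𝒜 (algebraMap ℂ _ c) = Forms.of (c • 1) := by
      rw [AlgHom.commutes, Forms.of_smul, Forms.of_one, Algebra.algebraMap_eq_smul_one]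
    rw [h]
    exact of _
  | grade1 s =>
    rcases s with a | a
    · exact of a
    · exact dOf a
  | mul x y hx hy => rw [map_mul]; exact mul _ _ hx hy
  | add x y hx hy => rw [map_add]; exact add _ _ hx hy

theorem dBlock_of (a : 𝒜) :
    dBlock 𝒜 (of a) = !![Forms.of a, Forms.dOf a; 0, Forms.of a] := by
  simp [dBlock, of, lift_mk]

theorem dBlock_dOf (a : 𝒜) :
    dBlock 𝒜 (dOf a) = !![-Forms.dOf a, 0; 0, Forms.dOf a] := by
  simp [dBlock, dOf, lift_mk]

/-- Once the lower row is known, multiplicativity of `dBlock` says that the parity is multiplicative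
and that `d` satisfies the graded Leibniz rule. -/
theorem dBlock_lower (x : Forms 𝒜) : dBlock 𝒜 x 1 0 = 0 ∧ dBlock 𝒜 x 1 1 = x := by
  induction x using Forms.induction with
  | of a => simp [dBlock_of]
  | dOf a => simp [dBlock_dOf]
  | add x y hx hy => simp [hx, hy]
  | mul x y hx hy => simp [Matrix.mul_apply, hx, hy]

/-- The parity automorphism. -/
def parity : Forms 𝒜 →ₗ[ℂ] Forms 𝒜 where
  toFun ω := dBlock 𝒜 ω 0 0
  map_add' _ _ := by simp
  map_smul' _ _ := by simp

theorem parity_of (a : 𝒜) : parity (of a) = of a := by simp [parity, dBlock_of]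

theorem parity_dOf (a : 𝒜) : parity (dOf a) = -dOf a := by simp [parity, dBlock_dOf]

theorem d_dOf (a : 𝒜) : d (dOf a) = 0 := by simp [d, dBlock_dOf]

theorem parity_mul (x y : Forms 𝒜) : parity (x * y) = parity x * parity y := by
  change dBlock 𝒜 (x * y) 0 0 = dBlock 𝒜 x 0 0 * dBlock 𝒜 y 0 0
  rw [map_mul, Matrix.mul_apply, Fin.sum_univ_two, (dBlock_lower y).1, mul_zero, add_zero]

theorem d_mul (x y : Forms 𝒜) : d (x * y) = d x * y + parity x * d y := by
  change dBlock 𝒜 (x * y) 0 1 = dBlock 𝒜 x 0 1 * y + dBlock 𝒜 x 0 0 * dBlock 𝒜 y 0 1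
  rw [map_mul, Matrix.mul_apply, Fin.sum_univ_two, (dBlock_lower y).2, add_comm]

theorem parity_parity (x : Forms 𝒜) : parity (parity x) = x := by
  induction x using Forms.induction with
  | of a => simp [parity_of]
  | dOf a => simp [parity_dOf]
  | add x y hx hy => rw [map_add, map_add, hx, hy]
  | mul x y hx hy => rw [parity_mul, parity_mul, hx, hy]

theorem parity_d (x : Forms 𝒜) : parity (d x) = -d (parity x) := by
  induction x using Forms.induction with
  | of a => simp [parity_of, d_of, parity_dOf]
  | dOf a => simp [parity_dOf, d_dOf]
  | add x y hx hy => simp only [map_add, hx, hy]; abel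
  | mul x y hx hy =>
    rw [parity_mul, d_mul, d_mul, map_add, parity_mul, parity_mul, hx, hy]
    noncomm_ring

theorem d_d (x : Forms 𝒜) : d (d x) = 0 := by
  induction x using Forms.induction with
  | of a => rw [d_of, d_dOf]
  | dOf a => rw [d_dOf, map_zero]
  | add x y hx hy => rw [map_add, map_add, hx, hy, add_zero]
  | mul x y hx hy =>
    rw [d_mul, map_add, d_mul, d_mul, hx, hy, parity_d, parity_parity]
    noncomm_ring

theorem d_one : d (1 : Forms 𝒜) = 0 := by
  have h := d_mul (1 : Forms 𝒜) 1
  rw [← of_one, parity_of, of_one, mul_one, mul_one, one_mul] at h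
  simpa using h

/-- The odd part of a form. -/
def odd : Forms 𝒜 →ₗ[ℂ] Forms 𝒜 := (1 / 2 : ℂ) • (LinearMap.id - parity)

theorem parity_eq (x : Forms 𝒜) : parity x = x - (odd x + odd x) := by
  have h : odd x + odd x = x - parity x := by
    simp only [odd, LinearMap.smul_apply, LinearMap.sub_apply, LinearMap.id_apply, ← add_smul]
    norm_num
  rw [h]
  abel

theorem odd_eq_of_parity {x z : Forms 𝒜} (hz : parity x = x - (z + z)) : odd x = z := by
  have h1 : z + z = x - parity x := by rw [hz]; abel
  rw [odd, LinearMap.smul_apply, LinearMap.sub_apply, LinearMap.id_apply, ← h1, ← two_smul ℂ z,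
    smul_smul]
  norm_num

theorem odd_mul (x y : Forms 𝒜) :
    odd (x * y) = (x - odd x) * odd y + odd x * (y - odd y) := by
  refine odd_eq_of_parity ?_
  rw [parity_mul, parity_eq, parity_eq]
  noncomm_ring

theorem odd_odd (x : Forms 𝒜) : odd (odd x) = odd x := by
  refine odd_eq_of_parity ?_
  have h := parity_parity x
  rw [parity_eq x, map_sub, map_add, parity_eq x] at h
  have h2 : (2 : ℂ) • parity (odd x) = (2 : ℂ) • (odd x - (odd x + odd x)) := by
    rw [two_smul, two_smul]
    have h3 : parity (odd x) + parity (odd x) = x - (odd x + odd x) - x := by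
      rw [eq_sub_iff_add_eq]
      nth_rewrite 3 [← h]
      abel
    rw [h3]
    abel
  exact (smul_right_injective _ (two_ne_zero : (2 : ℂ) ≠ 0)) h2

theorem odd_d (x : Forms 𝒜) : odd (d x) = d x - d (odd x) := by
  refine odd_eq_of_parity ?_
  rw [parity_d, parity_eq, map_sub, map_add]
  abel

theorem odd_of (a : 𝒜) : odd (of a) = 0 := odd_eq_of_parity (by simp [parity_of])

theorem odd_dOf (a : 𝒜) : odd (dOf a) = dOf a :=
  odd_eq_of_parity (by rw [parity_dOf]; abel)

theorem odd_one : odd (1 : Forms 𝒜) = 0 := by rw [← of_one, odd_of]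

/-! ### Monomials and degrees -/

theorem monomial_cons {n : ℕ} (x : 𝒜) (w : Fin n → 𝒜) :
    monomial (Fin.cons x w : Fin (n + 1) → 𝒜) = of x * (List.ofFn fun j => dOf (w j)).prod := by
  simp [monomial]

theorem d_prod_dOf (l : List 𝒜) : d (l.map dOf).prod = 0 := by
  induction l with
  | nil => exact d_one
  | cons a l ih => rw [List.map_cons, List.prod_cons, d_mul, ih, d_dOf]; simp

theorem d_ofFn_prod {n : ℕ} (w : Fin n → 𝒜) : d (List.ofFn fun j => dOf (w j)).prod = 0 := by
  have h := d_prod_dOf (List.ofFn w)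
  rwa [List.map_ofFn] at h

theorem d_monomial {n : ℕ} (v : Fin (n + 1) → 𝒜) :
    d (monomial v) = monomial (Fin.cons 1 v : Fin (n + 2) → 𝒜) := by
  rw [monomial_cons, monomial, d_mul, d_ofFn_prod, d_of, of_one, List.ofFn_succ, List.prod_cons]
  simp

theorem of_mul_monomial {n : ℕ} (b x : 𝒜) (w : Fin n → 𝒜) :
    of b * monomial (Fin.cons x w : Fin (n + 1) → 𝒜) =
      monomial (Fin.cons (b * x) w : Fin (n + 1) → 𝒜) := by
  rw [monomial_cons, monomial_cons, of_mul, mul_assoc]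

/-- Normal ordering by `db x = d(bx) - b dx`. It is the reason why the monomials span and the
degrees add. -/
theorem dOf_mul_monomial {n : ℕ} (b x : 𝒜) (w : Fin n → 𝒜) :
    dOf b * monomial (Fin.cons x w : Fin (n + 1) → 𝒜) =
      monomial (Fin.cons 1 (Fin.cons (b * x) w) : Fin (n + 2) → 𝒜) -
        monomial (Fin.cons b (Fin.cons x w) : Fin (n + 2) → 𝒜) := by
  have h1 : ∀ y, (List.ofFn fun j => dOf ((Fin.cons y w : Fin (n + 1) → 𝒜) j)).prod =
      dOf y * (List.ofFn fun j => dOf (w j)).prod := by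
    intro y
    rw [List.ofFn_succ, List.prod_cons]
    simp
  rw [monomial_cons, monomial_cons, monomial_cons, h1, h1, dOf_mul, of_one]
  noncomm_ring

theorem monomial_mem_degree {n : ℕ} (v : Fin (n + 1) → 𝒜) : monomial v ∈ degree 𝒜 n :=
  Submodule.subset_span ⟨v, rfl⟩

theorem of_mul_mem_degree (b : 𝒜) {n : ℕ} {x : Forms 𝒜} (hx : x ∈ degree 𝒜 n) :
    of b * x ∈ degree 𝒜 n := by
  induction hx using Submodule.span_induction with
  | mem x hx =>
    obtain ⟨v, rfl⟩ := hx
    rw [← Fin.cons_self_tail v, of_mul_monomial]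
    exact monomial_mem_degree _
  | zero => rw [mul_zero]; exact Submodule.zero_mem _
  | add x y _ _ hx hy => rw [mul_add]; exact Submodule.add_mem _ hx hy
  | smul c x _ hx => rw [mul_smul_comm]; exact Submodule.smul_mem _ _ hx

theorem dOf_mul_mem_degree (b : 𝒜) {n : ℕ} {x : Forms 𝒜} (hx : x ∈ degree 𝒜 n) :
    dOf b * x ∈ degree 𝒜 (n + 1) := by
  induction hx using Submodule.span_induction with
  | mem x hx =>
    obtain ⟨v, rfl⟩ := hx
    rw [← Fin.cons_self_tail v, dOf_mul_monomial]
    exact Submodule.sub_mem _ (monomial_mem_degree _) (monomial_mem_degree _)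
  | zero => rw [mul_zero]; exact Submodule.zero_mem _
  | add x y _ _ hx hy => rw [mul_add]; exact Submodule.add_mem _ hx hy
  | smul c x _ hx => rw [mul_smul_comm]; exact Submodule.smul_mem _ _ hx

theorem d_mem_degree {n : ℕ} {x : Forms 𝒜} (hx : x ∈ degree 𝒜 n) : d x ∈ degree 𝒜 (n + 1) := by
  induction hx using Submodule.span_induction with
  | mem x hx =>
    obtain ⟨v, rfl⟩ := hx
    rw [d_monomial]
    exact monomial_mem_degree _
  | zero => rw [map_zero]; exact Submodule.zero_mem _
  | add x y _ _ hx hy => rw [map_add]; exact Submodule.add_mem _ hx hy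
  | smul c x _ hx => rw [map_smul]; exact Submodule.smul_mem _ _ hx

theorem mul_mem_degree {m n : ℕ} {x y : Forms 𝒜} (hx : x ∈ degree 𝒜 m) (hy : y ∈ degree 𝒜 n) :
    x * y ∈ degree 𝒜 (m + n) := by
  have key : ∀ l : List 𝒜, (l.map dOf).prod * y ∈ degree 𝒜 (l.length + n) := by
    intro l
    induction l with
    | nil => simpa using hy
    | cons a l ih =>
      rw [List.map_cons, List.prod_cons, mul_assoc, List.length_cons, Nat.add_right_comm]
      exact dOf_mul_mem_degree a ih
  induction hx using Submodule.span_induction with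
  | mem x hx =>
    obtain ⟨v, rfl⟩ := hx
    have h := key (List.ofFn fun j => v j.succ)
    rw [List.map_ofFn, List.length_ofFn] at h
    rw [monomial, mul_assoc]
    exact of_mul_mem_degree _ h
  | zero => rw [zero_mul]; exact Submodule.zero_mem _
  | add x y _ _ hx hy => rw [add_mul]; exact Submodule.add_mem _ hx hy
  | smul c x _ hx => rw [smul_mul_assoc]; exact Submodule.smul_mem _ _ hx

theorem one_mem_degree : (1 : Forms 𝒜) ∈ degree 𝒜 0 := by
  have : (1 : Forms 𝒜) = monomial (Fin.cons 1 Fin.elim0 : Fin 1 → 𝒜) := by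
    rw [monomial_cons, of_one]; simp
  rw [this]
  exact monomial_mem_degree _

theorem iSup_degree : ⨆ n, degree 𝒜 n = ⊤ := by
  rw [eq_top_iff]
  have key : ∀ x y : Forms 𝒜, y ∈ ⨆ n, degree 𝒜 n → x * y ∈ ⨆ n, degree 𝒜 n := by
    intro x
    induction x using Forms.induction with
    | of a =>
      intro y hy
      induction hy using Submodule.iSup_induction' with
      | mem n y hy => exact Submodule.mem_iSup_of_mem n (of_mul_mem_degree a hy)
      | zero => rw [mul_zero]; exact Submodule.zero_mem _
      | add x y _ _ hx hy => rw [mul_add]; exact Submodule.add_mem _ hx hy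
    | dOf a =>
      intro y hy
      induction hy using Submodule.iSup_induction' with
      | mem n y hy => exact Submodule.mem_iSup_of_mem (n + 1) (dOf_mul_mem_degree a hy)
      | zero => rw [mul_zero]; exact Submodule.zero_mem _
      | add x y _ _ hx hy => rw [mul_add]; exact Submodule.add_mem _ hx hy
    | add x x' hx hx' => intro y hy; rw [add_mul]; exact Submodule.add_mem _ (hx y hy) (hx' y hy)
    | mul x x' hx hx' => intro y hy; rw [mul_assoc]; exact hx _ (hx' y hy)
  intro x _
  rw [← mul_one x]
  exact key x 1 (Submodule.mem_iSup_of_mem 0 one_mem_degree)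

/-- To prove a linear property of forms, it suffices to check it on monomials. -/
theorem linear_induction {P : Forms 𝒜 → Prop} (mono : ∀ n (v : Fin (n + 1) → 𝒜), P (monomial v))
    (zero : P 0) (add : ∀ x y, P x → P y → P (x + y)) (smul : ∀ (c : ℂ) x, P x → P (c • x))
    (x : Forms 𝒜) : P x := by
  have hx : x ∈ ⨆ n, degree 𝒜 n := by rw [iSup_degree]; trivial
  induction hx using Submodule.iSup_induction' with
  | mem n x hx =>
    induction hx using Submodule.span_induction with
    | mem x hx =>
      obtain ⟨v, rfl⟩ := hx
      exact mono _ v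
    | zero => exact zero
    | add x y _ _ hx hy => exact add _ _ hx hy
    | smul c x _ hx => exact smul c x hx
  | zero => exact zero
  | add x y _ _ hx hy => exact add _ _ hx hy

end Forms

/-! ### A second product on forms -/

/-- The space of forms with the product `x y + x₋ dy`, where `x₋` is the odd part of `x`. -/
def LoopForms (𝒜 : Type*) [Ring 𝒜] [Algebra ℂ 𝒜] : Type _ := Forms 𝒜

namespace LoopForms

open Forms

variable {𝒜 : Type*} [Ring 𝒜] [Algebra ℂ 𝒜]

/-- A form as an element of `LoopForms`. -/
def mk (x : Forms 𝒜) : LoopForms 𝒜 := x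

/-- The underlying form. -/
def val (x : LoopForms 𝒜) : Forms 𝒜 := x

instance : AddCommGroup (LoopForms 𝒜) := inferInstanceAs (AddCommGroup (Forms 𝒜))

instance : Mul (LoopForms 𝒜) := ⟨fun x y => mk (x.val * y.val + odd x.val * d y.val)⟩

instance : One (LoopForms 𝒜) := ⟨mk 1⟩

theorem val_mul (x y : LoopForms 𝒜) : (x * y).val = x.val * y.val + odd x.val * d y.val := rfl

theorem val_one : (1 : LoopForms 𝒜).val = 1 := rfl

theorem val_add (x y : LoopForms 𝒜) : (x + y).val = x.val + y.val := rfl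

theorem val_zero : (0 : LoopForms 𝒜).val = 0 := rfl

theorem val_mk (x : Forms 𝒜) : (mk x).val = x := rfl

theorem val_injective : Function.Injective (val (𝒜 := 𝒜)) := fun _ _ h => h

/-- Associativity: with `y₊` the even part of `y`, the odd part of `x y + x₋ dy` is `x₊ y₋ + x₋ y₊ +
x₋ d(y₋)`. The two bracketings then agree by `d(yz) = dy z + (y₊ - y₋) dz` and `d² = 0`. -/
instance : Ring (LoopForms 𝒜) :=
  { (inferInstance : AddCommGroup (LoopForms 𝒜)), (inferInstance : Mul (LoopForms 𝒜)),
    (inferInstance : One (LoopForms 𝒜)) with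
    left_distrib := fun x y z => val_injective (by
      simp only [val_mul, val_add, map_add]; noncomm_ring)
    right_distrib := fun x y z => val_injective (by
      simp only [val_mul, val_add, map_add]; noncomm_ring)
    zero_mul := fun x => val_injective (by simp only [val_mul, val_zero, map_zero]; simp)
    mul_zero := fun x => val_injective (by simp only [val_mul, val_zero, map_zero]; simp)
    one_mul := fun x => val_injective (by simp only [val_mul, val_one, Forms.odd_one]; simp)
    mul_one := fun x => val_injective (by simp only [val_mul, val_one, d_one]; simp)
    mul_assoc := fun x y z => val_injective (by
      simp only [val_mul, map_add, d_mul, odd_mul, odd_odd, odd_d, d_d, parity_eq]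
      noncomm_ring) }

end LoopForms

/-! ### The functional on forms defined by a bracket -/

section Integral

variable {𝒜 : Type*} [Ring 𝒜] [Algebra ℂ 𝒜]

theorem formIntegral_eq_zero {n m : ℕ} {φ : Cochain 𝒜 n} (hφ : IsHochschildCochain φ) (hm : m ≠ n)
    {x : Forms 𝒜} (hx : x ∈ Forms.degree 𝒜 m) : formIntegral φ x = 0 := by
  induction hx using Submodule.span_induction with
  | mem x hx =>
    obtain ⟨v, rfl⟩ := hx
    exact (formIntegral_spec hφ).2 m hm v
  | zero => exact map_zero _
  | add x y _ _ hx hy => rw [map_add, hx, hy, add_zero]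
  | smul c x _ hx => rw [map_smul, hx, smul_zero]

theorem finite_support_formIntegral {φ : ∀ n, Cochain 𝒜 n} (hφ : ∀ n, IsHochschildCochain (φ n))
    (x : Forms 𝒜) : (Function.support fun n => formIntegral (φ n) x).Finite := by
  induction x using Forms.linear_induction with
  | mono m v =>
    refine (Set.finite_singleton m).subset fun n hn => ?_
    by_contra h
    exact hn (formIntegral_eq_zero (hφ n) (fun h' => h h'.symm) (Forms.monomial_mem_degree v))
  | zero => simp
  | add x y hx hy =>
    refine (hx.union hy).subset fun n hn => ?_
    by_contra h
    simp only [Set.mem_union, Function.mem_support, not_or, not_not] at h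
    exact hn (by simp only [map_add, h.1, h.2, add_zero])
  | smul c x hx =>
    refine hx.subset fun n hn h => hn ?_
    simp only [map_smul, h, smul_zero]

/-- The functional on all forms given by a family of cochains. -/
def totalIntegral {φ : ∀ n, Cochain 𝒜 n} (hφ : ∀ n, IsHochschildCochain (φ n)) :
    Forms 𝒜 →ₗ[ℂ] ℂ where
  toFun x := ∑ᶠ n, formIntegral (φ n) x
  map_add' x y := by
    simp only [map_add]
    exact finsum_add_distrib (finite_support_formIntegral hφ x) (finite_support_formIntegral hφ y)
  map_smul' c x := by
    simp only [map_smul, RingHom.id_apply]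
    exact (smul_finsum' c (finite_support_formIntegral hφ x)).symm

theorem totalIntegral_of_mem {φ : ∀ n, Cochain 𝒜 n} (hφ : ∀ n, IsHochschildCochain (φ n)) {n : ℕ}
    {x : Forms 𝒜} (hx : x ∈ Forms.degree 𝒜 n) : totalIntegral hφ x = formIntegral (φ n) x :=
  finsum_eq_single _ n fun m hm => formIntegral_eq_zero (hφ m) hm.symm hx

theorem totalIntegral_monomial {φ : ∀ n, Cochain 𝒜 n} (hφ : ∀ n, IsHochschildCochain (φ n)) {n : ℕ}
    (v : Fin (n + 1) → 𝒜) : totalIntegral hφ (Forms.monomial v) = φ n v := by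
  rw [totalIntegral_of_mem hφ (Forms.monomial_mem_degree v)]
  exact (formIntegral_spec (hφ n)).1 v

end Integral

theorem exists_ofFn_update {M : Type*} {n : ℕ} (W : Fin n → M) (i : Fin n) :
    ∃ l₁ l₂, ∀ x, List.ofFn (Function.update W i x) = l₁ ++ x :: l₂ := by
  induction n with
  | zero => exact i.elim0
  | succ n ih =>
    refine Fin.cases ⟨[], List.ofFn (Fin.tail W), fun x => ?_⟩ (fun i => ?_) i
    · rw [List.ofFn_succ]
      simp
      rfl
    · obtain ⟨l₁, l₂, h⟩ := ih (Fin.tail W) i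
      refine ⟨W 0 :: l₁, l₂, fun x => ?_⟩
      rw [List.ofFn_succ, Function.update_of_ne (Fin.succ_ne_zero i).symm, List.cons_append, ← h]
      congr 2
      funext j
      by_cases hj : j = i
      · subst hj; simp
      · rw [Function.update_of_ne hj, Function.update_of_ne (by simpa using hj)]
        rfl

namespace WardBracket

open Forms

variable {𝒜 M : Type*} [Ring 𝒜] [Algebra ℂ 𝒜] [AddCommGroup M] [Module ℂ M]
  (β : WardBracket 𝒜 M)

/-- The word `a₀ δa₁, δa₂, …, δaₙ`. -/
def word {n : ℕ} (v : Fin (n + 2) → 𝒜) : List M :=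
  β.lmul (v 0) (β.der (v 1)) :: List.ofFn fun j : Fin n => β.der (v j.succ.succ)

/-- The cochain `⟨L, a₀ δa₁, δa₂, …, δaₙ⟩`, and `⟨a₀ L⟩` for `n = 0`. -/
def cochain (L : List M) : ∀ n, Cochain 𝒜 n
  | 0 => fun v => match L with
    | [] => 0
    | V :: l => β.brk (β.lmul (v 0) V :: l)
  | _ + 1 => fun v => β.brk (L ++ β.word v)

/-- The slots of a word, as linear functions of each argument. -/
theorem exists_word_update {n : ℕ} (v : Fin (n + 2) → 𝒜) (i : Fin (n + 2)) :
    ∃ (l₁ l₂ : List M) (g : 𝒜 →ₗ[ℂ] M), ∀ x, β.word (Function.update v i x) = l₁ ++ g x :: l₂ := by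
  refine Fin.cases ?_ (fun i => Fin.cases ?_ (fun i => ?_) i) i
  · refine ⟨[], List.ofFn fun j : Fin n => β.der (v j.succ.succ), β.lmul.flip (β.der (v 1)),
      fun x => ?_⟩
    simp [word, Function.update_of_ne]
  · refine ⟨[], List.ofFn fun j : Fin n => β.der (v j.succ.succ), β.lmul (v 0) ∘ₗ β.der,
      fun x => ?_⟩
    have h1 : ∀ j : Fin n, j.succ.succ ≠ (1 : Fin (n + 2)) := fun j => by
      rw [← Fin.succ_zero_eq_one, Ne, Fin.succ_inj]
      exact Fin.succ_ne_zero _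
    change β.lmul (Function.update v 1 x 0) (β.der (Function.update v 1 x 1)) :: _ = _
    have h2 : (fun j : Fin n => β.der (Function.update v 1 x j.succ.succ)) =
        fun j => β.der (v j.succ.succ) :=
      funext fun j => by rw [Function.update_of_ne (h1 j)]
    rw [Function.update_self, Function.update_of_ne (by simp)]
    exact congrArg (fun g => β.lmul (v 0) (β.der x) :: List.ofFn g) h2
  · obtain ⟨l₁, l₂, h⟩ := exists_ofFn_update (fun j : Fin n => β.der (v j.succ.succ)) i
    refine ⟨β.lmul (v 0) (β.der (v 1)) :: l₁, l₂, β.der, fun x => ?_⟩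
    rw [List.cons_append, ← h, word]
    have h0 : (0 : Fin (n + 2)) ≠ i.succ.succ := (Fin.succ_ne_zero _).symm
    have h1 : (1 : Fin (n + 2)) ≠ i.succ.succ := by
      rw [← Fin.succ_zero_eq_one, Ne, Fin.succ_inj]
      exact (Fin.succ_ne_zero _).symm
    rw [Function.update_of_ne h0, Function.update_of_ne h1]
    congr 2
    funext j
    by_cases hj : j = i
    · subst hj; simp
    · rw [Function.update_of_ne hj, Function.update_of_ne (by simpa using hj)]

theorem isHochschildCochain (L : List M) (n : ℕ) : IsHochschildCochain (β.cochain L n) := by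
  cases n with
  | zero =>
    refine ⟨?_, fun _ j => j.elim0⟩
    cases L with
    | nil => exact ⟨0, fun _ => rfl⟩
    | cons V l =>
      let g : 𝒜 →ₗ[ℂ] ℂ :=
        { toFun := fun x => β.brk (β.lmul x V :: l)
          map_add' := fun x y => by rw [map_add, LinearMap.add_apply, β.brk_add_head]
          map_smul' := fun c x => by
            rw [map_smul, LinearMap.smul_apply, β.brk_smul_head, RingHom.id_apply, smul_eq_mul] }
      exact ⟨MultilinearMap.ofSubsingleton ℂ 𝒜 ℂ (0 : Fin 1) g, fun _ => rfl⟩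
  | succ n =>
    refine ⟨⟨⟨β.cochain L (n + 1), ?_, ?_⟩, fun _ => rfl⟩, ?_⟩
    · intro inst v i x y
      obtain rfl : inst = instDecidableEqFin _ := Subsingleton.elim _ _
      obtain ⟨l₁, l₂, g, h⟩ := β.exists_word_update v i
      simp only [cochain, h, map_add, ← List.append_assoc, β.brk_add]
    · intro inst v i c x
      obtain rfl : inst = instDecidableEqFin _ := Subsingleton.elim _ _
      obtain ⟨l₁, l₂, g, h⟩ := β.exists_word_update v i
      simp only [cochain, h, map_smul, ← List.append_assoc, β.brk_smul, smul_eq_mul]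
    · intro v j hj
      refine Fin.cases (fun hj => ?_) (fun j hj => ?_) j hj
      · have h1 : v 1 = 1 := hj
        simp only [cochain, word, h1, β.der_one, map_zero]
        exact β.brk_zero _ _
      · obtain ⟨l₁, l₂, h⟩ := exists_ofFn_update (fun j : Fin n => β.der (v j.succ.succ)) j
        have h1 := h (β.der (v j.succ.succ))
        rw [Function.update_eq_self, hj, β.der_one] at h1
        simp only [cochain, word, h1]
        have := β.brk_zero (L ++ β.lmul (v 0) (β.der (v 1)) :: l₁) l₂
        simpa using this

/-- The functional on forms with `a₀ da₁ ⋯ daₙ ↦ ⟨L, a₀ δa₁, δa₂, …, δaₙ⟩`. -/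
def functional (L : List M) : Forms 𝒜 →ₗ[ℂ] ℂ := totalIntegral (β.isHochschildCochain L)

theorem functional_monomial (L : List M) {n : ℕ} (v : Fin (n + 1) → 𝒜) :
    β.functional L (monomial v) = β.cochain L n v := totalIntegral_monomial _ v

theorem functional_one {L : List M} (hL : L ≠ []) : β.functional L 1 = β.brk L := by
  have h1 : (1 : Forms 𝒜) = monomial (Fin.cons 1 Fin.elim0 : Fin 1 → 𝒜) := by
    rw [monomial_cons, of_one]; simp
  rw [h1, functional_monomial]
  cases L with
  | nil => exact absurd rfl hL
  | cons V l => simp [cochain, β.one_lmul]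

theorem functional_append_add (L : List M) (V W : M) (x : Forms 𝒜) :
    β.functional (L ++ [V + W]) x = β.functional (L ++ [V]) x + β.functional (L ++ [W]) x := by
  induction x using Forms.linear_induction with
  | mono n v =>
    rw [functional_monomial, functional_monomial, functional_monomial]
    cases n with
    | zero =>
      cases L with
      | nil => simp [cochain, β.brk_add_head]
      | cons U l =>
        simp only [cochain, List.cons_append]
        exact β.brk_add (_ :: l) [] V W
    | succ n =>
      simp only [cochain, List.append_assoc, List.singleton_append]
      exact β.brk_add _ _ V W
  | zero => simp
  | add x y hx hy => rw [map_add, map_add, map_add, hx, hy]; ring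
  | smul c x hx => rw [map_smul, map_smul, map_smul, hx, smul_add]

theorem functional_append_zero (L : List M) (x : Forms 𝒜) : β.functional (L ++ [0]) x = 0 := by
  have h := β.functional_append_add L 0 0 x
  rw [add_zero] at h
  simpa using h

/-- Multiplication by a one-form inserts a field into the bracket. -/
theorem functional_one_form_mul (L : List M) (a b : 𝒜) (η : LoopForms 𝒜) :
    β.functional L (LoopForms.mk (of a * dOf b) * η).val =
      β.functional (L ++ [β.lmul a (β.der b)]) η.val := by
  have hodd : odd (of a * dOf b) = of a * dOf b := by rw [odd_mul, odd_of, odd_dOf]; simp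
  rw [LoopForms.val_mul, LoopForms.val_mk, hodd]
  generalize η.val = x
  induction x using Forms.linear_induction with
  | mono n v =>
    obtain ⟨x, w, rfl⟩ : ∃ (x : 𝒜) (w : Fin n → 𝒜), v = Fin.cons x w :=
      ⟨v 0, Fin.tail v, (Fin.cons_self_tail v).symm⟩
    -- With `η = x dw` the product `a db η` is `a d(bx) dw - ab dx dw`, and the correction `a db dη`
    -- adds `a db dx dw`. The first two terms give the field `a δb` multiplied by `x` from the
    -- right. The Ward identity moves `x` to the next field, and the inserted `δx` is exactly the
    -- third term. For `n = 0` the next field is the first one of the list.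
    rw [mul_assoc, mul_assoc, dOf_mul_monomial, d_monomial, dOf_mul_monomial, mul_sub, mul_sub,
      of_mul_monomial, of_mul_monomial, of_mul_monomial, of_mul_monomial]
    simp only [mul_one]
    have hw : monomial (Fin.cons (a * b) (Fin.cons 1 (Fin.cons x w)) : Fin (n + 3) → 𝒜) = 0 := by
      rw [monomial_cons, List.ofFn_succ, List.prod_cons, Fin.cons_zero, ← d_of, of_one, d_one]
      simp
    rw [hw, sub_zero, map_add, map_sub, functional_monomial, functional_monomial,
      functional_monomial, functional_monomial]
    cases n with
    | zero =>
      simp only [cochain, word]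
      simp only [Fin.cons_zero, Fin.cons_one, Fin.cons_succ, List.ofFn_zero, List.ofFn_succ]
      have e1 : β.lmul a (β.der (b * x)) =
          β.lmul (a * b) (β.der x) + β.rmul x (β.lmul a (β.der b)) := by
        rw [β.der_mul, map_add, β.lmul_lmul, β.lmul_rmul]
      rw [e1, β.brk_add]
      cases L with
      | nil =>
        have h := β.ward_single x (β.lmul a (β.der b))
        simp only [List.nil_append] at h ⊢
        linear_combination -h
      | cons U l =>
        have h := β.ward_cons x U l (β.lmul a (β.der b))
        simp only [List.cons_append] at h ⊢
        linear_combination -h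
    | succ n =>
      simp only [cochain, word]
      simp only [Fin.cons_zero, Fin.cons_one, Fin.cons_succ, List.ofFn_succ]
      have e1 : β.lmul a (β.der (b * x)) =
          β.lmul (a * b) (β.der x) + β.rmul x (β.lmul a (β.der b)) := by
        rw [β.der_mul, map_add, β.lmul_lmul, β.lmul_rmul]
      have h := β.ward x L (List.ofFn fun j : Fin n => β.der (w j.succ)) (β.lmul a (β.der b))
        (β.der (w 0))
      rw [e1, β.brk_add]
      simp only [List.append_assoc, List.singleton_append]
      rw [h]
      ring_nf
  | zero => simp
  | add x y hx hy =>
    rw [mul_add, map_add d, mul_add, map_add (β.functional (L ++ _)), ← hx, ← hy, ← map_add]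
    congr 1
    abel
  | smul c x hx =>
    rw [mul_smul_comm, map_smul d, mul_smul_comm, ← smul_add, map_smul, map_smul, hx]

end WardBracket

/-! ### The trace property and the cocycle identities -/

theorem Forms.of_eq_monomial {𝒜 : Type*} [Ring 𝒜] [Algebra ℂ 𝒜] (a : 𝒜) :
    Forms.of a = Forms.monomial (Fin.cons a Fin.elim0 : Fin 1 → 𝒜) := by
  rw [Forms.monomial_cons]; simp

namespace WardBracket

open Forms

variable {𝒜 M : Type*} [Ring 𝒜] [Algebra ℂ 𝒜] [AddCommGroup M] [Module ℂ M]
  (β : WardBracket 𝒜 M)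

theorem functional_of (V : M) (l : List M) (b : 𝒜) :
    β.functional (V :: l) (of b) = β.brk (β.lmul b V :: l) := by
  rw [of_eq_monomial, functional_monomial]; rfl

theorem functional_nil_of (b : 𝒜) : β.functional [] (of b) = 0 := by
  rw [of_eq_monomial, functional_monomial]; rfl

theorem functional_dOf_mul (L : List M) (a : 𝒜) (η : LoopForms 𝒜) :
    β.functional L (LoopForms.mk (dOf a) * η).val = β.functional (L ++ [β.der a]) η.val := by
  have h := β.functional_one_form_mul L 1 a η
  rwa [of_one, one_mul, β.one_lmul] at h

theorem mk_prod_dOf (a : 𝒜) (l : List 𝒜) :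
    LoopForms.mk ((a :: l).map dOf).prod = LoopForms.mk (dOf a) * LoopForms.mk (l.map dOf).prod :=
  LoopForms.val_injective (by
    rw [LoopForms.val_mul, LoopForms.val_mk, LoopForms.val_mk, LoopForms.val_mk, d_prod_dOf]
    simp)

theorem mk_mul_prod_dOf (x : Forms 𝒜) (l : List 𝒜) :
    LoopForms.mk (x * (l.map dOf).prod) = LoopForms.mk x * LoopForms.mk (l.map dOf).prod :=
  LoopForms.val_injective (by
    rw [LoopForms.val_mul, LoopForms.val_mk, LoopForms.val_mk, LoopForms.val_mk, d_prod_dOf]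
    simp)

theorem functional_prod_dOf_mul (L : List M) (l : List 𝒜) (η : LoopForms 𝒜) :
    β.functional L (LoopForms.mk (l.map dOf).prod * η).val =
      β.functional (L ++ l.map β.der) η.val := by
  induction l generalizing L with
  | nil =>
    have : LoopForms.mk (([] : List 𝒜).map dOf).prod = 1 := rfl
    rw [this, one_mul]
    simp
  | cons a l ih =>
    rw [mk_prod_dOf, mul_assoc, functional_dOf_mul, ih]
    simp

/-- Factors are absorbed from the left and their fields accumulate in the list `L`; this is the
purpose of the prefix in `cochain`. -/
theorem functional_monomial_mul (L : List M) {n : ℕ} (v : Fin (n + 2) → 𝒜) (η : LoopForms 𝒜) :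
    β.functional L (LoopForms.mk (monomial v) * η).val = β.functional (L ++ β.word v) η.val := by
  have h1 : monomial v = of (v 0) * dOf (v 1) *
      ((List.ofFn fun j : Fin n => v j.succ.succ).map dOf).prod := by
    rw [monomial, List.ofFn_succ, List.prod_cons, List.map_ofFn, mul_assoc]
    rfl
  rw [h1, mk_mul_prod_dOf, mul_assoc, functional_one_form_mul, functional_prod_dOf_mul,
    List.map_ofFn, List.append_assoc]
  rfl

/-- In degree zero both sides vanish. Otherwise `x` is absorbed into the list, and `b` then
multiplies the first field, just as it does from the left. -/
theorem functional_mul_of (b : 𝒜) (x : Forms 𝒜) :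
    β.functional [] (LoopForms.mk x * LoopForms.mk (of b)).val =
      β.functional [] (LoopForms.mk (of b) * LoopForms.mk x).val := by
  induction x using Forms.linear_induction with
  | mono n v =>
    obtain ⟨x, w, rfl⟩ : ∃ (x : 𝒜) (w : Fin n → 𝒜), v = Fin.cons x w :=
      ⟨v 0, Fin.tail v, (Fin.cons_self_tail v).symm⟩
    have h2 : (LoopForms.mk (of b) * LoopForms.mk (monomial (Fin.cons x w))).val =
        monomial (Fin.cons (b * x) w : Fin (n + 1) → 𝒜) := by
      rw [LoopForms.val_mul, LoopForms.val_mk, LoopForms.val_mk, odd_of, zero_mul, add_zero,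
        of_mul_monomial]
    rw [h2]
    cases n with
    | zero =>
      have h1 : monomial (Fin.cons x w : Fin 1 → 𝒜) = of x := by rw [monomial_cons]; simp
      have h3 : (LoopForms.mk (of x) * LoopForms.mk (of b)).val = of (x * b) := by
        rw [LoopForms.val_mul, LoopForms.val_mk, LoopForms.val_mk, odd_of, of_mul]; simp
      rw [h1, h3, functional_nil_of, functional_monomial]
      rfl
    | succ n =>
      rw [functional_monomial_mul, LoopForms.val_mk, List.nil_append, word, functional_of,
        functional_monomial, β.lmul_lmul]
      rfl
  | zero => simp only [LoopForms.val_mul, LoopForms.val_mk]; simp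
  | add x y hx hy =>
    simp only [LoopForms.val_mul, LoopForms.val_mk, map_add, mul_add, add_mul] at hx hy ⊢
    linear_combination hx + hy
  | smul c x hx =>
    simp only [LoopForms.val_mul, LoopForms.val_mk, map_smul, map_add, smul_mul_assoc,
      mul_smul_comm, smul_eq_mul] at hx ⊢
    linear_combination c * hx

/-- The two orders insert `δb` at the end and at the beginning of the word of `x`, and cyclicity
identifies them. -/
theorem functional_mul_dOf (b : 𝒜) (x : Forms 𝒜) :
    β.functional [] (LoopForms.mk x * LoopForms.mk (dOf b)).val =
      β.functional [] (LoopForms.mk (dOf b) * LoopForms.mk x).val := by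
  induction x using Forms.linear_induction with
  | mono n v =>
    have hd : dOf b = monomial (Fin.cons 1 (Fin.cons b Fin.elim0) : Fin 2 → 𝒜) := by
      rw [← d_of, of_eq_monomial, d_monomial]
    rw [functional_dOf_mul]
    cases n with
    | zero =>
      have h1 : monomial v = of (v 0) := by rw [monomial]; simp
      have h3 : (LoopForms.mk (of (v 0)) * LoopForms.mk (dOf b)).val =
          (LoopForms.mk (of (v 0) * dOf b) * 1).val := by
        rw [mul_one, LoopForms.val_mul, LoopForms.val_mk, LoopForms.val_mk, odd_of, zero_mul,
          add_zero, LoopForms.val_mk]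
      rw [h1, h3, functional_one_form_mul, LoopForms.val_one, functional_one _ (by simp),
        LoopForms.val_mk, List.nil_append, List.nil_append, functional_of]
    | succ n =>
      rw [functional_monomial_mul, LoopForms.val_mk, LoopForms.val_mk, hd, functional_monomial,
        functional_monomial]
      change β.brk (β.word v ++ [β.lmul 1 (β.der b)]) = β.brk ([β.der b] ++ β.word v)
      rw [β.one_lmul, β.brk_rotate]
      rfl
  | zero => simp only [LoopForms.val_mul, LoopForms.val_mk]; simp
  | add x y hx hy =>
    simp only [LoopForms.val_mul, LoopForms.val_mk, map_add, mul_add, add_mul] at hx hy ⊢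
    linear_combination hx + hy
  | smul c x hx =>
    simp only [LoopForms.val_mul, LoopForms.val_mk, map_smul, map_add, smul_mul_assoc,
      mul_smul_comm, smul_eq_mul] at hx ⊢
    linear_combination c * hx

theorem functional_mul_comm_mul {y z : LoopForms 𝒜}
    (hy : ∀ x : LoopForms 𝒜, β.functional [] (x * y).val = β.functional [] (y * x).val)
    (hz : ∀ x : LoopForms 𝒜, β.functional [] (x * z).val = β.functional [] (z * x).val)
    (x : LoopForms 𝒜) :
    β.functional [] (x * (y * z)).val = β.functional [] (y * z * x).val := by
  rw [← mul_assoc, hz, ← mul_assoc, hy, mul_assoc]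

/-- The functional of a bracket is a trace for the product of `LoopForms`. -/
theorem functional_mul_comm (x y : LoopForms 𝒜) :
    β.functional [] (x * y).val = β.functional [] (y * x).val := by
  have hprod : ∀ (l : List 𝒜) (x : LoopForms 𝒜),
      β.functional [] (x * LoopForms.mk (l.map dOf).prod).val =
        β.functional [] (LoopForms.mk (l.map dOf).prod * x).val := by
    intro l
    induction l with
    | nil =>
      intro x
      have : LoopForms.mk (([] : List 𝒜).map dOf).prod = 1 := rfl
      rw [this, mul_one, one_mul]
    | cons a l ih =>
      rw [mk_prod_dOf]
      exact β.functional_mul_comm_mul (β.functional_mul_dOf a) ih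
  have key : ∀ y : Forms 𝒜, β.functional [] (x * LoopForms.mk y).val =
      β.functional [] (LoopForms.mk y * x).val := by
    intro y
    induction y using Forms.linear_induction with
    | mono n v =>
      -- A monomial is a product of generators for the second product as well, since products of the
      -- `da` are closed; and the elements that commute under the functional are stable under
      -- products.
      have h1 : monomial v = of (v 0) * ((List.ofFn fun j : Fin n => v j.succ).map dOf).prod := by
        rw [monomial, List.map_ofFn]; rfl
      rw [h1, mk_mul_prod_dOf]
      exact β.functional_mul_comm_mul (β.functional_mul_of _) (hprod _) x
    | zero => simp only [LoopForms.val_mul, LoopForms.val_mk]; simp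
    | add x y hx hy =>
      simp only [LoopForms.val_mul, LoopForms.val_mk, map_add, mul_add, add_mul] at hx hy ⊢
      linear_combination hx + hy
    | smul c x hx =>
      simp only [LoopForms.val_mul, LoopForms.val_mk, map_smul, map_add, smul_mul_assoc,
        mul_smul_comm, smul_eq_mul] at hx ⊢
      linear_combination c * hx
  exact key y.val

theorem functional_mul_comm' (x y : Forms 𝒜) :
    β.functional [] (x * y + odd x * d y) = β.functional [] (y * x + odd y * d x) :=
  β.functional_mul_comm (LoopForms.mk x) (LoopForms.mk y)

/-- For the ordinary product the defect of the trace property, with one even factor, is the single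
term `y₋ dx`. All cocycle and Chern-Simons computations below rest on this defect. -/
theorem functional_mul_comm_of_even {x : Forms 𝒜} (hx : odd x = 0) (y : Forms 𝒜) :
    β.functional [] (x * y) = β.functional [] (y * x) + β.functional [] (odd y * d x) := by
  have h := β.functional_mul_comm' x y
  rwa [hx, zero_mul, add_zero, map_add] at h

/-- Each factor of the power inserts one field, by linearity and `functional_one_form_mul`. -/
theorem brk_replicate {κ : Type*} (s : Finset κ) (a b : κ → 𝒜) (n : ℕ) :
    β.brk (List.replicate (n + 1) (∑ j ∈ s, β.lmul (a j) (β.der (b j)))) =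
      β.functional [] (LoopForms.mk (∑ j ∈ s, of (a j) * dOf (b j)) ^ (n + 1)).val := by
  classical
  have key : ∀ (L : List M) (η : LoopForms 𝒜),
      β.functional L (LoopForms.mk (∑ j ∈ s, of (a j) * dOf (b j)) * η).val =
        β.functional (L ++ [∑ j ∈ s, β.lmul (a j) (β.der (b j))]) η.val := by
    intro L η
    induction s using Finset.induction_on with
    | empty =>
      rw [Finset.sum_empty, Finset.sum_empty, functional_append_zero, LoopForms.val_mul,
        LoopForms.val_mk]
      simp
    | insert i s hi ih =>
      rw [Finset.sum_insert hi, Finset.sum_insert hi, functional_append_add, ← ih,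
        ← functional_one_form_mul, ← map_add]
      simp only [LoopForms.val_mul, LoopForms.val_mk, map_add, add_mul]
      ring
  have hpow : ∀ (n : ℕ) (L : List M),
      β.functional L (LoopForms.mk (∑ j ∈ s, of (a j) * dOf (b j)) ^ n).val =
        β.functional (L ++ List.replicate n (∑ j ∈ s, β.lmul (a j) (β.der (b j)))) 1 := by
    intro n
    induction n with
    | zero => intro L; simp; rfl
    | succ n ih => intro L; rw [pow_succ', key, ih, List.replicate_succ]; simp
  rw [hpow, List.nil_append, functional_one _ (by simp)]

end WardBracket

/-! ### The Hochschild coboundary in terms of forms -/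

section Coboundary

open Forms

variable {𝒜 : Type*} [Ring 𝒜] [Algebra ℂ 𝒜]

theorem Forms.parity_monomial {n : ℕ} (v : Fin (n + 1) → 𝒜) :
    parity (monomial v) = (-1 : ℂ) ^ n • monomial v := by
  have key : ∀ l : List 𝒜, parity (l.map dOf).prod = (-1 : ℂ) ^ l.length • (l.map dOf).prod := by
    intro l
    induction l with
    | nil =>
      have h := parity_of (1 : 𝒜)
      rw [of_one] at h
      simpa using h
    | cons a l ih =>
      rw [List.map_cons, List.prod_cons, parity_mul, ih, parity_dOf, List.length_cons, pow_succ]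
      simp
  have h := key (List.ofFn fun j => v j.succ)
  rw [List.map_ofFn, List.length_ofFn] at h
  rw [monomial, parity_mul, parity_of]
  have h' : parity (List.ofFn fun j => dOf (v j.succ)).prod =
      (-1 : ℂ) ^ n • (List.ofFn fun j => dOf (v j.succ)).prod := h
  rw [h', mul_smul_comm]

theorem Forms.odd_monomial_of_even {n : ℕ} (hn : Even n) (v : Fin (n + 1) → 𝒜) :
    odd (monomial v) = 0 :=
  odd_eq_of_parity (by rw [parity_monomial, hn.neg_one_pow]; simp)

theorem Forms.odd_monomial_of_odd {n : ℕ} (hn : Odd n) (v : Fin (n + 1) → 𝒜) :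
    odd (monomial v) = monomial v :=
  odd_eq_of_parity (by rw [parity_monomial, hn.neg_one_pow]; simp)

theorem Forms.monomial_mul_dOf {n : ℕ} (v : Fin (n + 2) → 𝒜) :
    monomial (fun j : Fin (n + 1) => v j.castSucc) * dOf (v (Fin.last (n + 1))) = monomial v := by
  rw [monomial, monomial, List.ofFn_succ' (n := n), List.concat_eq_append, List.prod_append, mul_assoc]
  simp

/-- Induction through `a₀ da₁ ⋯ = a₀ d(a₁ da₂ ⋯)`. The Leibniz rule moves the right factor under
`d`, and its correction term becomes the summand in which `a₀` and `a₁` are multiplied. -/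
theorem Forms.monomial_mul_of {n : ℕ} (v : Fin (n + 2) → 𝒜) :
    monomial (fun j : Fin (n + 1) => v j.castSucc) * of (v (Fin.last (n + 1))) =
      ∑ j : Fin (n + 1), (-1 : ℂ) ^ (n + j : ℕ) • monomial (Fin.contractNth j.castSucc (· * ·) v) := by
  induction n with
  | zero =>
    rw [Fin.sum_univ_one]
    simp [monomial, Fin.contractNth, of_mul]
  | succ n ih =>
    obtain ⟨x, u, rfl⟩ : ∃ (x : 𝒜) (u : Fin (n + 2) → 𝒜), v = Fin.cons x u :=
      ⟨v 0, Fin.tail v, (Fin.cons_self_tail v).symm⟩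
    have h1 : (fun j : Fin (n + 2) => (Fin.cons x u : Fin (n + 3) → 𝒜) j.castSucc) =
        Fin.cons x fun j : Fin (n + 1) => u j.castSucc := by
      funext j
      refine Fin.cases rfl (fun j => ?_) j
      rw [← Fin.succ_castSucc, Fin.cons_succ, Fin.cons_succ]
    have h2 : ∀ w : Fin (n + 1) → 𝒜, monomial (Fin.cons x w : Fin (n + 2) → 𝒜) =
        of x * d (monomial w) := by
      intro w
      rw [d_monomial, of_mul_monomial, mul_one]
    have h3 := ih u
    have h4 := d_mul (monomial fun j : Fin (n + 1) => u j.castSucc) (of (u (Fin.last (n + 1))))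
    have h5 : (Fin.cons x u : Fin (n + 3) → 𝒜) (Fin.last (n + 2)) = u (Fin.last (n + 1)) := by
      rw [← Fin.succ_last, Fin.cons_succ]
    rw [h1, h2, h5, mul_assoc, eq_sub_of_add_eq h4.symm, h3, parity_monomial, d_of, smul_mul_assoc,
      monomial_mul_dOf, mul_sub, map_sum, Finset.mul_sum]
    conv_rhs => rw [Fin.sum_univ_succ]
    have h6 : Fin.contractNth (Fin.castSucc 0) (· * ·) (Fin.cons x u : Fin (n + 3) → 𝒜) =
        Fin.cons (x * u 0) (Fin.tail u) := by
      funext j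
      refine Fin.cases ?_ (fun j => ?_) j
      · simp [Fin.contractNth]
      · simp [Fin.contractNth, Fin.tail]
    have h7 : ∀ j : Fin (n + 1), Fin.contractNth j.succ.castSucc (· * ·)
        (Fin.cons x u : Fin (n + 3) → 𝒜) = Fin.cons x (Fin.contractNth j.castSucc (· * ·) u) := by
      intro j
      funext i
      refine Fin.cases ?_ (fun i => ?_) i
      · simp [Fin.contractNth]
      · simp only [Fin.contractNth, Fin.cons_succ, ← Fin.succ_castSucc, Fin.val_succ,
          Fin.val_castSucc, Nat.add_lt_add_iff_right, Nat.add_right_cancel_iff]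
    have h8 : of x * monomial u = monomial (Fin.cons (x * u 0) (Fin.tail u) : Fin (n + 2) → 𝒜) := by
      rw [← of_mul_monomial, Fin.cons_self_tail]
    rw [h6, ← h8, mul_smul_comm, sub_eq_add_neg, add_comm]
    congr 1
    · rw [Fin.val_zero, add_zero, pow_succ, mul_neg_one, neg_smul]
    · refine Finset.sum_congr rfl fun j _ => ?_
      rw [h7, h2, map_smul, mul_smul_comm]
      congr 1
      rw [Fin.val_succ]
      ring

/-- The coboundary is, up to sign, the functional on the commutator of `a₀ da₁ ⋯ daₙ` with the last
argument. In this form the trace property applies. -/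
theorem opb_eq {n : ℕ} {φ : Cochain 𝒜 n} {I : Forms 𝒜 →ₗ[ℂ] ℂ} (hI : ∀ v, I (monomial v) = φ v)
    (v : Fin (n + 2) → 𝒜) :
    opb φ v = (-1 : ℂ) ^ n *
      (I (monomial (fun j : Fin (n + 1) => v j.castSucc) * of (v (Fin.last (n + 1)))) -
        I (of (v (Fin.last (n + 1))) * monomial fun j : Fin (n + 1) => v j.castSucc)) := by
  have h1 : (fun j : Fin (n + 1) => v j.castSucc) =
      Fin.cons (v 0) fun j : Fin n => v j.succ.castSucc := by
    funext j
    exact Fin.cases rfl (fun j => rfl) j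
  rw [monomial_mul_of, h1, of_mul_monomial, hI, map_sum, mul_sub, Finset.mul_sum, opb]
  simp only [map_smul, hI, smul_eq_mul, ← mul_assoc]
  rw [sub_eq_add_neg]
  congr 1
  · refine Finset.sum_congr rfl fun j _ => ?_
    rw [← pow_add, ← add_assoc, pow_add _ (n + n), Even.neg_one_pow ⟨n, rfl⟩, one_mul]
  · rw [pow_succ]; ring

omit [Algebra ℂ 𝒜] in
theorem opb_smul {n : ℕ} (c : ℂ) (φ : Cochain 𝒜 n) : opb (c • φ) = c • opb φ := by
  funext v
  simp only [opb, Pi.smul_apply, smul_eq_mul, mul_add, Finset.mul_sum]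
  congr 1
  · exact Finset.sum_congr rfl fun j _ => by ring
  · ring

omit [Algebra ℂ 𝒜] in
theorem opB_smul {n : ℕ} (c : ℂ) (φ : Cochain 𝒜 (n + 1)) : opB (c • φ) = c • opB φ := by
  funext v
  simp only [opB, Pi.smul_apply, smul_eq_mul, Finset.mul_sum]
  exact Finset.sum_congr rfl fun j _ => by ring

omit [Algebra ℂ 𝒜] in
theorem opB_sub {n : ℕ} (φ χ : Cochain 𝒜 (n + 1)) : opB (φ - χ) = opB φ - opB χ := by
  funext v
  simp only [opB, Pi.sub_apply, mul_sub, Finset.sum_sub_distrib]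

theorem IsHochschildCochain.smul {n : ℕ} {φ : Cochain 𝒜 n} (hφ : IsHochschildCochain φ) (c : ℂ) :
    IsHochschildCochain (c • φ) := by
  obtain ⟨⟨M, hM⟩, hn⟩ := hφ
  exact ⟨⟨c • M, fun a => by simp [hM]⟩, fun a j h => by simp [hn a j h]⟩

theorem IsHochschildCochain.sub {n : ℕ} {φ χ : Cochain 𝒜 n} (hφ : IsHochschildCochain φ)
    (hχ : IsHochschildCochain χ) : IsHochschildCochain (φ - χ) := by
  obtain ⟨⟨M, hM⟩, hn⟩ := hφ
  obtain ⟨⟨M', hM'⟩, hn'⟩ := hχ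
  exact ⟨⟨M - M', fun a => by simp [hM, hM']⟩, fun a j h => by simp [hn a j h, hn' a j h]⟩

theorem IsHochschildCochain.opB0 {n : ℕ} {φ : Cochain 𝒜 (n + 1)} (hφ : IsHochschildCochain φ) :
    IsHochschildCochain (opB0 φ) := by
  obtain ⟨⟨M, hM⟩, hn⟩ := hφ
  refine ⟨⟨M.curryLeft 1, fun a => ?_⟩, fun a j h => ?_⟩
  · rw [MultilinearMap.curryLeft_apply, hM]; rfl
  · exact hn _ j.succ (by rw [Fin.cons_succ]; exact h)

end Coboundary

/-! ### The cocycles of a bracket -/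

namespace WardBracket

open Forms

variable {𝒜 M : Type*} [Ring 𝒜] [Algebra ℂ 𝒜] [AddCommGroup M] [Module ℂ M]
  (β : WardBracket 𝒜 M)

theorem brk_ofFn_add {n : ℕ} (W : Fin (n + 1) → M) (k : Fin (n + 1)) :
    β.brk (List.ofFn fun i => W (i + k)) = β.brk (List.ofFn W) := by
  have step : ∀ W : Fin (n + 1) → M,
      β.brk (List.ofFn fun i => W (i + 1)) = β.brk (List.ofFn W) := by
    intro W
    rw [List.ofFn_succ', List.ofFn_succ, List.concat_eq_append, β.brk_rotate]
    simp [Fin.coeSucc_eq_succ]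
  induction k using Fin.induction with
  | zero => simp
  | succ k ih =>
    rw [← ih, ← step fun i => W (i + k.castSucc)]
    congr 2
    funext i
    rw [add_assoc, add_comm 1, Fin.coeSucc_eq_succ]

theorem cochain_cons_one {n : ℕ} (u : Fin (n + 1) → 𝒜) :
    β.cochain [] (n + 1) (Fin.cons 1 u) = β.brk (List.ofFn fun i => β.der (u i)) := by
  simp only [cochain, word, List.nil_append]
  rw [List.ofFn_succ]
  simp only [Fin.cons_zero, Fin.cons_succ, β.one_lmul]
  rfl

/-- By cyclicity all summands of `B` agree up to sign, so only the sum of the signs matters. -/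
theorem opB_cochain {n : ℕ} (v : Fin (n + 1) → 𝒜) :
    opB (β.cochain [] (n + 1)) v =
      (∑ j : Fin (n + 1), (-1 : ℂ) ^ (n * (j : ℕ))) * β.brk (List.ofFn fun i => β.der (v i)) := by
  rw [opB, Finset.sum_mul]
  refine Finset.sum_congr rfl fun j _ => ?_
  rw [cochain_cons_one, β.brk_ofFn_add (fun i => β.der (v i)) j]

/-- `B₀` and `B` each supply an argument `1`, and one of them lands in a slot where a normalized
cochain vanishes. -/
theorem opB_opB0_cochain (n : ℕ) : opB (opB0 (β.cochain [] (n + 2))) = 0 := by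
  funext v
  rw [opB]
  refine Finset.sum_eq_zero fun j _ => ?_
  rw [opB0, (β.isHochschildCochain [] (n + 2)).2 _ 0 (by simp), mul_zero]

theorem opB_cochain_of_odd {n : ℕ} (hn : Odd n) : opB (β.cochain [] (n + 1)) = 0 := by
  funext v
  rw [opB_cochain]
  have h : ∑ j : Fin (n + 1), (-1 : ℂ) ^ (n * (j : ℕ)) = 0 := by
    simp only [pow_mul, hn.neg_one_pow]
    rw [Fin.sum_neg_one_pow, if_pos (by simpa using hn.add_one)]
  rw [h, zero_mul]
  rfl

theorem opB_cochain_of_even {n : ℕ} (hn : Even n) (v : Fin (n + 1) → 𝒜) :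
    opB (β.cochain [] (n + 1)) v = (n + 1) * β.brk (List.ofFn fun i => β.der (v i)) := by
  rw [opB_cochain]
  simp [pow_mul, hn.neg_one_pow]

theorem opb_cochain_of_even {n : ℕ} (hn : Even n) : opb (β.cochain [] n) = 0 := by
  funext v
  rw [opb_eq (I := β.functional []) (β.functional_monomial []) v,
    β.functional_mul_comm_of_even (odd_of _) _, odd_monomial_of_even hn]
  simp

theorem isEvenCocycle : IsEvenCocycle (β.cochain []) :=
  ⟨fun n _ => β.isHochschildCochain [] n, fun n hn => by
    rw [β.opb_cochain_of_even hn, β.opB_cochain_of_odd hn.add_one, add_zero]⟩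

/-- The cochain `φ_n - ½ B₀ φ_{n+1}`. -/
def oddCochain (n : ℕ) : Cochain 𝒜 n :=
  β.cochain [] n - (1 / 2 : ℂ) • opB0 (β.cochain [] (n + 1))

theorem isHochschildCochain_oddCochain (n : ℕ) : IsHochschildCochain (β.oddCochain n) :=
  (β.isHochschildCochain [] n).sub ((β.isHochschildCochain [] (n + 1)).opB0.smul _)

/-- The functional on forms that belongs to `oddCochain`. -/
def oddFunctional : Forms 𝒜 →ₗ[ℂ] ℂ :=
  β.functional [] - (1 / 2 : ℂ) • β.functional [] ∘ₗ d

theorem oddFunctional_apply (x : Forms 𝒜) :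
    β.oddFunctional x = β.functional [] x - 1 / 2 * β.functional [] (d x) := rfl

theorem oddFunctional_monomial {n : ℕ} (v : Fin (n + 1) → 𝒜) :
    β.oddFunctional (monomial v) = β.oddCochain n v := by
  rw [oddFunctional_apply, functional_monomial, d_monomial, functional_monomial]
  rfl

theorem opB_oddCochain (n : ℕ) : opB (β.oddCochain (n + 1)) = opB (β.cochain [] (n + 1)) := by
  rw [oddCochain, opB_sub, opB_smul, opB_opB0_cochain, smul_zero, sub_zero]

/-- For an odd monomial `ω` and the last argument `b`, the trace property reduces `ψ(ωb) - ψ(bω)` to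
`½ φ(db ω - ω db) = -½ φ(db dω)`, and `db dω` evaluates to the bracket of the derivations alone. -/
theorem opb_oddCochain_of_odd {n : ℕ} (hn : Odd n) (v : Fin (n + 2) → 𝒜) :
    opb (β.oddCochain n) v = 1 / 2 * β.brk (List.ofFn fun i => β.der (v i)) := by
  rw [opb_eq (I := β.oddFunctional) β.oddFunctional_monomial v, hn.neg_one_pow,
    oddFunctional_apply, oddFunctional_apply]
  set b := v (Fin.last (n + 1))
  set u : Fin (n + 1) → 𝒜 := fun j => v j.castSucc with hu
  have hodd : odd (monomial u) = monomial u := odd_monomial_of_odd hn u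
  have hpar : parity (monomial u) = -monomial u := by
    rw [parity_eq, hodd]; abel
  have h1 := β.functional_mul_comm_of_even (odd_of b) (monomial u)
  have h2 := β.functional_mul_comm_of_even (odd_of b) (d (monomial u))
  have h3 := β.functional_mul_comm' (monomial u) (dOf b)
  rw [hodd, d_of] at h1
  rw [odd_d, hodd, sub_self, zero_mul, map_zero, add_zero] at h2
  rw [d_dOf, mul_zero, add_zero, odd_dOf, map_add] at h3
  have h4 : dOf b * d (monomial u) = monomial (Fin.cons 1 (Fin.cons b u) : Fin (n + 3) → 𝒜) := by
    have := dOf_mul_monomial b 1 u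
    rw [d_monomial, this, mul_one, sub_eq_self, monomial_cons, List.ofFn_succ, List.prod_cons,
      Fin.cons_zero, ← d_of, of_one, d_one]
    simp
  have h5 : β.brk (List.ofFn fun i => β.der ((Fin.cons b u : Fin (n + 2) → 𝒜) i)) =
      β.brk (List.ofFn fun i => β.der (v i)) := by
    conv_rhs => rw [List.ofFn_succ', List.concat_eq_append, β.brk_rotate]
    rw [List.ofFn_succ]
    rfl
  rw [h4, functional_monomial, cochain_cons_one, h5] at h3
  rw [d_mul, d_mul, d_of, hpar, parity_of, map_add, map_add, neg_mul (monomial u),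
    map_neg, h1, h2]
  linear_combination (1 / 2 : ℂ) * h3

theorem opB_oddCochain_one : opB (β.oddCochain 1) = 0 := by
  rw [opB_oddCochain]
  funext v
  rw [opB_cochain]
  simp [β.brk_der]

/-- The normalizations of the odd cochains that make them a cocycle. -/
theorem isOddCocycle : IsOddCocycle fun n =>
    ((-1 : ℂ) ^ (n / 2) * ((n / 2).factorial : ℂ) / (n.factorial : ℂ)) • β.oddCochain n := by
  refine ⟨fun n _ => (β.isHochschildCochain_oddCochain n).smul _, fun n hn => ?_, ?_⟩
  · funext v
    rw [opb_smul, opB_smul, opB_oddCochain, Pi.add_apply, Pi.smul_apply, Pi.smul_apply,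
      β.opb_oddCochain_of_odd hn, β.opB_cochain_of_even hn.add_one]
    -- Before normalization `b ψ_n` is `1/2` times and `B ψ_{n+2}` is `n + 2` times the same
    -- bracket. For `n = 2k + 1` consecutive normalizations must therefore have the ratio `-1 / (2
    -- (2k + 3))`.
    obtain ⟨k, rfl⟩ := hn
    have e1 : (2 * k + 1) / 2 = k := by omega
    have e2 : (2 * k + 1 + 2) / 2 = k + 1 := by omega
    rw [e1, e2, Nat.factorial_succ (2 * k + 1 + 1), Nat.factorial_succ (2 * k + 1),
      Nat.factorial_succ k]
    have h0 : ((2 * k + 1).factorial : ℂ) ≠ 0 := by exact_mod_cast Nat.factorial_ne_zero _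
    have h1 : (2 * (k : ℂ) + 1 + 1 + 1) ≠ 0 := by exact_mod_cast Nat.succ_ne_zero (2 * k + 1 + 1)
    have h2 : (2 * (k : ℂ) + 1 + 1) ≠ 0 := by exact_mod_cast Nat.succ_ne_zero (2 * k + 1)
    push_cast
    simp only [smul_eq_mul, Pi.zero_apply]
    field_simp
    ring
  · simp only [opB_smul, opB_oddCochain_one, smul_zero]

end WardBracket

/-! ### Powers of a one-form -/

theorem sum_antidiagonal_of_recurrence {R : Type*} [Ring R] {x y : R} {s : ℕ → R} (h0 : s 0 = 1)
    (h : ∀ n, s (n + 1) = y * s n + x ^ (n + 1)) (n : ℕ) :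
    s n = ∑ p ∈ Finset.HasAntidiagonal.antidiagonal n, y ^ p.1 * x ^ p.2 := by
  induction n with
  | zero => simp [h0]
  | succ n ih =>
    rw [h, ih, Finset.Nat.antidiagonal_succ, Finset.sum_cons, Finset.sum_map, Finset.mul_sum,
      add_comm]
    simp [pow_succ', mul_assoc]

section Powers

open Forms

variable {𝒜 : Type*} [Ring 𝒜] [Algebra ℂ 𝒜]

/-- The coefficients of `t ^ n` in `∑ k, (t dA + t² A²) ^ k`, shifted by one. -/
def connSeq (A : Forms 𝒜) : ℕ → Forms 𝒜
  | 0 => 0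
  | 1 => 1
  | n + 2 => d A * connSeq A (n + 1) + A ^ 2 * connSeq A n

theorem connSeq_succ_succ (A : Forms 𝒜) (n : ℕ) :
    connSeq A (n + 2) = d A * connSeq A (n + 1) + A * A * connSeq A n := by
  rw [connSeq, pow_two]

/-- A noncommutative geometric series can be expanded from the left or from the right. Both
recursions are needed, as `A` and `dA` do not commute. -/
theorem connSeq_succ_succ' (A : Forms 𝒜) (n : ℕ) :
    connSeq A (n + 2) = connSeq A (n + 1) * d A + connSeq A n * (A * A) := by
  induction n using Nat.strong_induction_on with
  | _ n ih =>
    match n with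
    | 0 => simp [connSeq]
    | 1 => simp [connSeq, pow_two]
    | n + 2 =>
      have h1 := ih (n + 1) (by omega)
      have h0 := ih n (by omega)
      calc connSeq A (n + 4)
          = d A * (connSeq A (n + 2) * d A + connSeq A (n + 1) * (A * A)) +
              A * A * (connSeq A (n + 1) * d A + connSeq A n * (A * A)) := by
            rw [← h1, ← h0, ← connSeq_succ_succ]
        _ = (d A * connSeq A (n + 2) + A * A * connSeq A (n + 1)) * d A +
              (d A * connSeq A (n + 1) + A * A * connSeq A n) * (A * A) := by noncomm_ring
        _ = _ := by rw [← connSeq_succ_succ, ← connSeq_succ_succ]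

variable {A : Forms 𝒜} (hA : odd A = A)

include hA

theorem odd_d_of_odd : odd (d A) = 0 := by rw [odd_d, hA, sub_self]

theorem odd_mul_self_of_odd : odd (A * A) = 0 := by rw [odd_mul, hA]; simp

theorem odd_connSeq (n : ℕ) : odd (connSeq A n) = 0 := by
  induction n using Nat.strong_induction_on with
  | _ n ih =>
    match n with
    | 0 => simp [connSeq]
    | 1 => exact Forms.odd_one
    | n + 2 =>
      rw [connSeq_succ_succ, map_add, odd_mul, odd_mul, ih (n + 1) (by omega), ih n (by omega),
        odd_d_of_odd hA, odd_mul_self_of_odd hA]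
      simp

theorem d_mul_of_odd (y : Forms 𝒜) : d (A * y) = d A * y - A * d y := by
  rw [d_mul, parity_eq, hA]; noncomm_ring

theorem d_connSeq_mul (n : ℕ) (y : Forms 𝒜) :
    d (connSeq A n * y) = d (connSeq A n) * y + connSeq A n * d y := by
  rw [d_mul, parity_eq, odd_connSeq hA]; simp

/-- A Bianchi identity: with `S = (1 - t dA - t² A²)⁻¹` one has `dS = t (S A - A S)`, because `d(t²
A²)` equals `t (A S⁻¹ - S⁻¹ A)`. -/
theorem d_connSeq_succ (n : ℕ) :
    d (connSeq A (n + 1)) = connSeq A n * A - A * connSeq A n := by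
  induction n using Nat.strong_induction_on with
  | _ n ih =>
    match n with
    | 0 => simp [connSeq, d_one]
    | 1 =>
      have h : connSeq A 2 = d A := by simp [connSeq]
      rw [h, d_d]
      simp [connSeq]
    | n + 2 =>
      have hX : parity (d A) = d A := by rw [parity_eq, odd_d_of_odd hA]; simp
      have hZ : parity (A * A) = A * A := by rw [parity_eq, odd_mul_self_of_odd hA]; simp
      rw [connSeq_succ_succ A (n + 1), map_add, d_mul, d_mul, d_d, hX, hZ, d_mul_of_odd hA,
        ih (n + 1) (by omega), ih n (by omega), connSeq_succ_succ A n]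
      noncomm_ring

theorem val_mk_mul_of_odd (y : LoopForms 𝒜) :
    (LoopForms.mk A * y).val = A * y.val + A * d y.val := by
  rw [LoopForms.val_mul, LoopForms.val_mk, hA]

theorem val_mk_sub_mul (y : LoopForms 𝒜) :
    (LoopForms.mk (d A - A) * y).val = (d A - A) * y.val - A * d y.val := by
  rw [LoopForms.val_mul, LoopForms.val_mk, map_sub, hA, odd_d_of_odd hA]
  noncomm_ring

theorem val_mk_pow_succ (n : ℕ) :
    (LoopForms.mk A ^ (n + 1)).val = A * connSeq A (n + 1) + A * connSeq A n * A := by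
  induction n with
  | zero => rw [zero_add, pow_one, LoopForms.val_mk]; simp [connSeq]
  | succ n ih =>
    rw [pow_succ', val_mk_mul_of_odd hA, ih, map_add, d_mul_of_odd hA, mul_assoc A (connSeq A n) A,
      d_mul_of_odd hA, d_connSeq_succ hA, d_connSeq_mul hA]
    cases n with
    | zero => simp [connSeq]; abel
    | succ n =>
      rw [d_connSeq_succ hA]
      have h1 := connSeq_succ_succ A (n + 1)
      have h2 := connSeq_succ_succ A n
      have h3 : A * A * connSeq A (n + 2) =
        A * A * (connSeq A (n + 1) * d A + connSeq A n * (A * A)) := by rw [connSeq_succ_succ']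
      rw [h1]
      have h4 : A * connSeq A (n + 2) * A =
        A * (d A * connSeq A (n + 1) + A * A * connSeq A n) * A := by rw [h2]
      rw [show n + 1 + 1 = n + 2 from rfl, mul_add, h4, ← mul_assoc A A, h3]
      noncomm_ring

theorem val_mk_sub_pow (n : ℕ) :
    (LoopForms.mk (d A - A) ^ n).val = connSeq A (n + 1) - connSeq A n * A := by
  induction n with
  | zero => rw [pow_zero, LoopForms.val_one]; simp [connSeq]
  | succ n ih =>
    rw [pow_succ', val_mk_sub_mul hA, ih, map_sub, d_connSeq_succ hA, d_connSeq_mul hA]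
    cases n with
    | zero => simp [connSeq]
    | succ n =>
      rw [d_connSeq_succ hA, connSeq_succ_succ A (n + 1)]
      have h1 : A * connSeq A (n + 2) = A * (connSeq A (n + 1) * d A + connSeq A n * (A * A)) := by
        rw [connSeq_succ_succ']
      have h2 : connSeq A (n + 2) * A =
          (d A * connSeq A (n + 1) + A * A * connSeq A n) * A := by rw [connSeq_succ_succ]
      rw [show n + 1 + 1 = n + 2 from rfl, sub_mul (d A), mul_sub A, h1, h2]
      noncomm_ring

/-- This expansion and the one of `mk_connSeq_sub` consist of the same powers of `A` and `dA - A` in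
opposite orders, so a trace cannot tell `S_{n+1}` from `S_{n+1} - dS_{n+1}`. -/
theorem mk_connSeq (n : ℕ) : LoopForms.mk (connSeq A (n + 1)) =
    ∑ p ∈ Finset.HasAntidiagonal.antidiagonal n, LoopForms.mk (d A - A) ^ p.1 * LoopForms.mk A ^ p.2 := by
  refine sum_antidiagonal_of_recurrence (s := fun n => LoopForms.mk (connSeq A (n + 1))) rfl
    (fun n => LoopForms.val_injective ?_) n
  rw [LoopForms.val_add, val_mk_sub_mul hA, val_mk_pow_succ hA, LoopForms.val_mk, LoopForms.val_mk,
    d_connSeq_succ hA, connSeq_succ_succ]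
  noncomm_ring

theorem mk_connSeq_sub (n : ℕ) : LoopForms.mk (connSeq A (n + 1) - d (connSeq A (n + 1))) =
    ∑ p ∈ Finset.HasAntidiagonal.antidiagonal n, LoopForms.mk A ^ p.1 * LoopForms.mk (d A - A) ^ p.2 := by
  refine sum_antidiagonal_of_recurrence
    (s := fun n => LoopForms.mk (connSeq A (n + 1) - d (connSeq A (n + 1)))) ?_
    (fun n => LoopForms.val_injective ?_) n
  · refine LoopForms.val_injective ?_
    rw [LoopForms.val_mk, LoopForms.val_one]
    simp [connSeq, d_one]
  · rw [LoopForms.val_add, val_mk_mul_of_odd hA, val_mk_sub_pow hA, LoopForms.val_mk,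
      LoopForms.val_mk, map_sub, d_d, d_connSeq_succ hA (n + 1)]
    noncomm_ring

namespace WardBracket

variable {M : Type*} [AddCommGroup M] [Module ℂ M] (β : WardBracket 𝒜 M)

omit hA in
theorem functional_val_sum {κ : Type*} (s : Finset κ) (g : κ → LoopForms 𝒜) :
    β.functional [] (∑ i ∈ s, g i).val = ∑ i ∈ s, β.functional [] (g i).val :=
  map_sum (β.functional []) g s

theorem functional_d_connSeq (n : ℕ) : β.functional [] (d (connSeq A n)) = 0 := by
  cases n with
  | zero => simp [connSeq]
  | succ n =>
    have h1 : β.functional [] (connSeq A (n + 1)) =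
        β.functional [] (connSeq A (n + 1) - d (connSeq A (n + 1))) := by
      have e1 := congrArg (fun y => β.functional [] (LoopForms.val y)) (mk_connSeq hA n)
      have e2 := congrArg (fun y => β.functional [] (LoopForms.val y)) (mk_connSeq_sub hA n)
      simp only [LoopForms.val_mk, functional_val_sum] at e1 e2
      rw [e1, e2, ← Finset.Nat.sum_antidiagonal_swap]
      exact Finset.sum_congr rfl fun p _ => β.functional_mul_comm _ _
    rw [map_sub] at h1
    linear_combination h1

/-- Apply the functional to `dS_{n+1} = S_n A - A S_n`: the left side gives zero, and the right side
is the defect `A dS_n` of the trace property. -/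
theorem functional_mul_d_connSeq (n : ℕ) : β.functional [] (A * d (connSeq A n)) = 0 := by
  have h1 := β.functional_d_connSeq hA (n + 1)
  rw [d_connSeq_succ hA, map_sub, β.functional_mul_comm_of_even (odd_connSeq hA n), hA] at h1
  linear_combination h1

/-- The powers of a one-form in terms of the Chern-Simons and curvature coefficients. -/
theorem functional_mk_pow_succ (n : ℕ) :
    β.functional [] (LoopForms.mk A ^ (n + 1)).val =
      β.oddFunctional (A * connSeq A (n + 1)) +
        1 / 2 * β.functional [] (connSeq A (n + 1) * d A + connSeq A n * (A ^ 2 + A ^ 2)) := by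
  have h1 := β.functional_mul_d_connSeq hA (n + 1)
  have h2 := h1
  rw [d_connSeq_succ hA, mul_sub, map_sub, ← mul_assoc, ← mul_assoc] at h1
  have h3 := β.functional_mul_comm_of_even (odd_connSeq hA n) (A * A)
  have h4 := β.functional_mul_comm_of_even (odd_connSeq hA (n + 1)) (d A)
  rw [odd_mul_self_of_odd hA, zero_mul, map_zero, add_zero] at h3
  rw [odd_d_of_odd hA, zero_mul, map_zero, add_zero] at h4
  rw [val_mk_pow_succ hA, oddFunctional_apply, d_mul_of_odd hA, map_sub, map_add, map_add, pow_two,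
    mul_add (connSeq A n), map_add, h2, h3, h4]
  linear_combination h1

end WardBracket

end Powers

/-! ### Chern-Simons forms and powers of the curvature -/

section Polynomials

open Forms Polynomial

variable {𝒜 : Type*} [Ring 𝒜] [Algebra ℂ 𝒜]

/-- The polynomial `t dA + t² A²`. -/
def connPoly (A : Forms 𝒜) : (Forms 𝒜)[X] := X * C (d A) + X ^ 2 * C (A ^ 2)

variable (A : Forms 𝒜)

theorem coeff_connPoly_mul_zero (p : (Forms 𝒜)[X]) : (connPoly A * p).coeff 0 = 0 := by
  rw [connPoly, mul_coeff_zero]; simp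

theorem coeff_connPoly_mul_one (p : (Forms 𝒜)[X]) :
    (connPoly A * p).coeff 1 = d A * p.coeff 0 := by
  rw [connPoly, add_mul, mul_assoc, mul_assoc, coeff_add, pow_two, mul_assoc, coeff_X_mul,
    coeff_X_mul]
  simp

theorem coeff_connPoly_mul (p : (Forms 𝒜)[X]) (n : ℕ) :
    (connPoly A * p).coeff (n + 2) = d A * p.coeff (n + 1) + A ^ 2 * p.coeff n := by
  rw [connPoly, add_mul, mul_assoc, mul_assoc, coeff_add, pow_two, mul_assoc, coeff_X_mul,
    coeff_X_mul, coeff_X_mul, coeff_C_mul, coeff_C_mul]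

/-- The geometric series satisfies `Σ = 1 + P Σ`, which is the recursion of `connSeq`. As `P` has no
constant term, truncation at `K > n` does not affect the coefficient of `t^n`. -/
theorem sum_coeff_connPoly_pow (K n : ℕ) (hn : n < K) :
    ∑ k ∈ Finset.range K, (connPoly A ^ k).coeff n = connSeq A (n + 1) := by
  induction K generalizing n with
  | zero => omega
  | succ K ih =>
    rw [← finsetSum_coeff] at *
    have h : ∑ k ∈ Finset.range (K + 1), connPoly A ^ k =
        1 + connPoly A * ∑ k ∈ Finset.range K, connPoly A ^ k := by
      rw [Finset.sum_range_succ', Finset.mul_sum, add_comm, pow_zero]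
      simp only [pow_succ']
    rw [h, coeff_add]
    match n with
    | 0 => rw [coeff_connPoly_mul_zero]; simp [connSeq]
    | 1 =>
      have h0 := ih 0 (by omega)
      rw [← finsetSum_coeff] at h0
      rw [coeff_connPoly_mul_one, h0]
      simp [connSeq, coeff_one]
    | n + 2 =>
      have h0 := ih n (by omega)
      have h1 := ih (n + 1) (by omega)
      rw [← finsetSum_coeff] at h0 h1
      rw [coeff_connPoly_mul, h0, h1, connSeq]
      simp [coeff_one, connSeq]

theorem coeff_connPoly_pow_of_lt (k n : ℕ) (hn : 2 * k < n) : (connPoly A ^ k).coeff n = 0 := by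
  induction k generalizing n with
  | zero => rw [pow_zero, coeff_one, if_neg (by omega)]
  | succ k ih =>
    obtain ⟨n, rfl⟩ : ∃ m, n = m + 2 := ⟨n - 2, by omega⟩
    rw [pow_succ', coeff_connPoly_mul, ih _ (by omega), ih _ (by omega)]
    simp

theorem coeff_connPoly_pow_succ_zero (k : ℕ) : (connPoly A ^ (k + 1)).coeff 0 = 0 := by
  rw [pow_succ', coeff_connPoly_mul_zero]

theorem derivative_connPoly :
    derivative (connPoly A) = C (d A) + X * C (A ^ 2 + A ^ 2) := by
  rw [connPoly, pow_two, map_add, derivative_mul, derivative_mul, derivative_mul]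
  simp only [derivative_C, derivative_X, mul_zero, add_zero, one_mul, mul_one, C_add, mul_add,
    add_mul]

theorem chernSimons_eq (k m : ℕ) (hm : 2 * k < m) : chernSimons (k + 1) A =
    ∑ j ∈ Finset.range m, (1 / ((j : ℂ) + 1)) • (A * (connPoly A ^ k).coeff j) := by
  have h : ∀ j, (C A * connPoly A ^ k).coeff j = A * (connPoly A ^ k).coeff j :=
    fun j => coeff_C_mul _
  change (C A * connPoly A ^ k).sum (fun j c => (1 / ((j : ℂ) + 1)) • c) = _
  rw [Polynomial.sum_over_range' _ (fun j => smul_zero _) m]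
  · simp only [h]
  · refine lt_of_le_of_lt ((natDegree_le_iff_coeff_eq_zero (n := 2 * k)).2 fun j hj => ?_) hm
    rw [h, coeff_connPoly_pow_of_lt A k j hj, mul_zero]

/-- `F` is the value of `t dA + t² A²` at `t = 1`, and evaluation there is multiplicative because
`1` is central. -/
theorem curvature_pow_eq (k m : ℕ) (hm : 2 * k < m) : curvature A ^ k =
    ∑ j ∈ Finset.range m, (connPoly A ^ k).coeff j := by
  let ev : (Forms 𝒜)[X] →+* Forms 𝒜 :=
    eval₂RingHom' (RingHom.id _) 1 fun a => Commute.one_right a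
  have h1 : ev (connPoly A) = curvature A := by
    change eval₂ (RingHom.id _) 1 (connPoly A) = _
    rw [connPoly, X_pow_mul_C, X_mul_C, eval₂_add, eval₂_mul_X, pow_two X, ← mul_assoc,
      eval₂_mul_X, eval₂_mul_X, eval₂_C, eval₂_C]
    simp [curvature]
  rw [← h1, ← map_pow]
  change eval₂ (RingHom.id _) 1 (connPoly A ^ k) = _
  rw [eval₂_eq_sum_range' (n := m)]
  · simp
  · exact lt_of_le_of_lt ((natDegree_le_iff_coeff_eq_zero (n := 2 * k)).2
      fun j hj => coeff_connPoly_pow_of_lt A k j hj) hm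

variable {A}

theorem coeff_connPoly_pow_mem (hA : A ∈ degree 𝒜 1) (k n : ℕ) :
    (connPoly A ^ k).coeff n ∈ degree 𝒜 (2 * k) := by
  have hA2 : A ^ 2 ∈ degree 𝒜 2 := by
    have h := mul_mem_degree hA hA
    rwa [← pow_two, one_add_one_eq_two] at h
  have hd : d A ∈ degree 𝒜 2 := by
    have h := d_mem_degree hA
    rwa [one_add_one_eq_two] at h
  induction k generalizing n with
  | zero =>
    rw [pow_zero, coeff_one]
    split_ifs
    · exact one_mem_degree
    · exact Submodule.zero_mem _
  | succ k ih =>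
    rw [pow_succ', show 2 * (k + 1) = 2 + 2 * k by ring]
    match n with
    | 0 => rw [coeff_connPoly_mul_zero]; exact Submodule.zero_mem _
    | 1 => rw [coeff_connPoly_mul_one]; exact mul_mem_degree hd (ih _)
    | n + 2 =>
      rw [coeff_connPoly_mul]
      exact Submodule.add_mem _ (mul_mem_degree hd (ih _)) (mul_mem_degree hA2 (ih _))

theorem odd_coeff_mul {p q : (Forms 𝒜)[X]} (hp : ∀ n, odd (p.coeff n) = 0)
    (hq : ∀ n, odd (q.coeff n) = 0) (n : ℕ) : odd ((p * q).coeff n) = 0 := by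
  rw [coeff_mul, map_sum]
  refine Finset.sum_eq_zero fun i _ => ?_
  rw [odd_mul, hp, hq]
  simp

theorem odd_coeff_connPoly (hA : odd A = A) (n : ℕ) : odd ((connPoly A).coeff n) = 0 := by
  rw [connPoly, coeff_add, coeff_mul_C, coeff_mul_C, coeff_X, coeff_X_pow, pow_two]
  split_ifs <;> simp [odd_d_of_odd hA, odd_mul_self_of_odd hA]

theorem odd_coeff_connPoly_pow (hA : odd A = A) (k n : ℕ) :
    odd ((connPoly A ^ k).coeff n) = 0 := by
  induction k generalizing n with
  | zero =>
    rw [pow_zero, coeff_one]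
    split_ifs <;> simp [Forms.odd_one]
  | succ k ih => rw [pow_succ]; exact odd_coeff_mul ih (odd_coeff_connPoly hA) n

theorem odd_coeff_derivative {p : (Forms 𝒜)[X]} (hp : ∀ n, odd (p.coeff n) = 0) (n : ℕ) :
    odd ((derivative p).coeff n) = 0 := by
  rw [coeff_derivative, ← Nat.cast_succ, ← nsmul_eq_mul', map_nsmul, hp, smul_zero]

namespace WardBracket

variable {M : Type*} [AddCommGroup M] [Module ℂ M] (β : WardBracket 𝒜 M)

theorem functional_coeff_mul_comm {p q : (Forms 𝒜)[X]}
    (hp : ∀ n, odd (p.coeff n) = 0) (hq : ∀ n, odd (q.coeff n) = 0) (n : ℕ) :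
    β.functional [] ((p * q).coeff n) = β.functional [] ((q * p).coeff n) := by
  rw [coeff_mul, coeff_mul, map_sum, map_sum, ← Finset.Nat.sum_antidiagonal_swap]
  refine Finset.sum_congr rfl fun i _ => ?_
  rw [Prod.fst_swap, Prod.snd_swap, β.functional_mul_comm_of_even (hp _), hq]
  simp

/-- All coefficients are even, so under the functional `P` and its derivative may be permuted
cyclically. The extra factor `P^j` is what the induction on `k` needs. -/
theorem functional_coeff_derivative_pow (hA : odd A = A) (k j n : ℕ) :
    β.functional [] ((derivative (connPoly A ^ (k + 1)) * connPoly A ^ j).coeff n) =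
      (k + 1) * β.functional [] ((connPoly A ^ (k + j) * derivative (connPoly A)).coeff n) := by
  have hF := odd_coeff_connPoly_pow hA
  have hF' := odd_coeff_derivative (odd_coeff_connPoly hA)
  induction k generalizing j with
  | zero =>
    rw [zero_add, pow_one, β.functional_coeff_mul_comm hF' (hF j), zero_add]
    simp
  | succ k ih =>
    have h1 := β.functional_coeff_mul_comm (odd_coeff_mul (hF (k + 1)) hF') (hF j) n
    rw [← mul_assoc, ← pow_add] at h1
    rw [pow_succ _ (k + 1), derivative_mul, add_mul, coeff_add, map_add, mul_assoc (derivative _),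
      ← pow_succ', ih, h1, add_comm j (k + 1), Nat.add_right_comm k 1 j, add_assoc k j 1]
    push_cast
    ring

theorem functional_coeff_pow (hA : odd A = A) (k n : ℕ) :
    ((n : ℂ) + 1) * β.functional [] ((connPoly A ^ (k + 1)).coeff (n + 1)) =
      (k + 1) * β.functional [] ((connPoly A ^ k * derivative (connPoly A)).coeff n) := by
  have h := β.functional_coeff_derivative_pow hA k 0 n
  rw [pow_zero, mul_one, coeff_derivative, ← Nat.cast_succ, ← nsmul_eq_mul', map_nsmul, add_zero] at h
  rw [← h]
  simp

/-- The contribution of `n + 1` fields to the `k`-th term of the expansion. -/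
def expansionTerm (A : Forms 𝒜) (k n : ℕ) : ℂ :=
  β.oddFunctional ((1 / ((n : ℂ) + 1)) • (A * (connPoly A ^ k).coeff n)) +
    1 / (2 * ((k : ℂ) + 1)) * β.functional [] ((connPoly A ^ (k + 1)).coeff (n + 1))

/-- `functional_coeff_pow` trades the factor `1 / (k + 1)` of the curvature term for `1 / (n + 1)`.
The sum over `k` is then a geometric series, and `functional_mk_pow_succ` recognizes a power of `A`.
-/
theorem sum_expansionTerm_left (hA : odd A = A) {K n : ℕ} (hn : n < K) :
    ∑ k ∈ Finset.range K, β.expansionTerm A k n =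
      1 / ((n : ℂ) + 1) * β.functional [] (LoopForms.mk A ^ (n + 1)).val := by
  have hn0 : (n : ℂ) + 1 ≠ 0 := Nat.cast_add_one_ne_zero n
  have h1 : ∀ k, β.expansionTerm A k n = 1 / ((n : ℂ) + 1) *
      (β.oddFunctional (A * (connPoly A ^ k).coeff n) +
        1 / 2 * β.functional [] ((connPoly A ^ k * derivative (connPoly A)).coeff n)) := by
    intro k
    have hk : (k : ℂ) + 1 ≠ 0 := Nat.cast_add_one_ne_zero k
    have h := β.functional_coeff_pow hA k n
    rw [expansionTerm, map_smul, smul_eq_mul]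
    field_simp
    linear_combination h
  simp only [h1]
  rw [← Finset.mul_sum, Finset.sum_add_distrib, ← Finset.mul_sum, ← map_sum, ← map_sum,
    ← Finset.mul_sum, sum_coeff_connPoly_pow A K n hn, β.functional_mk_pow_succ hA]
  congr 4
  rw [derivative_connPoly]
  simp only [mul_add (connPoly A ^ _), coeff_add, coeff_mul_C, ← mul_assoc]
  rw [Finset.sum_add_distrib, ← Finset.sum_mul, ← Finset.sum_mul,
    sum_coeff_connPoly_pow A K n hn]
  congr 2
  cases n with
  | zero => simp [connSeq]
  | succ n =>
    simp only [coeff_mul_X]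
    exact sum_coeff_connPoly_pow A K n (by omega)

theorem sum_expansionTerm_right (A : Forms 𝒜) {m k : ℕ} (hm : 2 * k + 1 < m) :
    ∑ n ∈ Finset.range m, β.expansionTerm A k n =
      β.oddFunctional (chernSimons (k + 1) A) +
        1 / (2 * ((k : ℂ) + 1)) * β.functional [] (curvature A ^ (k + 1)) := by
  simp only [expansionTerm]
  rw [Finset.sum_add_distrib, ← Finset.mul_sum, ← map_sum, ← map_sum,
    chernSimons_eq A k m (by omega), curvature_pow_eq A (k + 1) (m + 1) (by omega),
    Finset.sum_range_succ' _ m, coeff_connPoly_pow_succ_zero, add_zero]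

end WardBracket

end Polynomials

/-! ### The asymptotic expansion -/

section Expansion

open Forms

variable {𝒜 : Type*} [Ring 𝒜] [Algebra ℂ 𝒜]

/-- The part of degree `2k + 1` of the contribution of `n + 1` fields to the `k`-th term. -/
def oddTerm (A : Forms 𝒜) (k n : ℕ) : Forms 𝒜 :=
  (1 / ((n : ℂ) + 1)) • (A * (connPoly A ^ k).coeff n)

/-- The part of degree `2k + 2` of the contribution of `n + 1` fields to the `k`-th term. -/
def evenTerm (A : Forms 𝒜) (k n : ℕ) : Forms 𝒜 :=
  (1 / (2 * ((k : ℂ) + 1))) • (connPoly A ^ (k + 1)).coeff (n + 1) -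
    (1 / 2 : ℂ) • d (oddTerm A k n)

/-- The forms in the remainder of the expansion. -/
def remainderForm (A : Forms 𝒜) (K l : ℕ) : Forms 𝒜 :=
  ∑ k ∈ Finset.range K, ((if 2 * k + 1 = l then -∑ n ∈ Finset.Ico K (2 * K), oddTerm A k n else 0) +
    if 2 * k + 2 = l then -∑ n ∈ Finset.Ico K (2 * K), evenTerm A k n else 0)

theorem oddTerm_mem {A : Forms 𝒜} (hA : A ∈ degree 𝒜 1) (k n : ℕ) :
    oddTerm A k n ∈ degree 𝒜 (2 * k + 1) := by
  rw [add_comm]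
  exact Submodule.smul_mem _ _ (mul_mem_degree hA (coeff_connPoly_pow_mem hA k n))

theorem evenTerm_mem {A : Forms 𝒜} (hA : A ∈ degree 𝒜 1) (k n : ℕ) :
    evenTerm A k n ∈ degree 𝒜 (2 * k + 2) :=
  Submodule.sub_mem _ (Submodule.smul_mem _ _ (coeff_connPoly_pow_mem hA (k + 1) (n + 1)))
    (Submodule.smul_mem _ _ (d_mem_degree (oddTerm_mem hA k n)))

theorem oddTerm_of_lt (A : Forms 𝒜) {k n : ℕ} (h : 2 * k < n) : oddTerm A k n = 0 := by
  rw [oddTerm, coeff_connPoly_pow_of_lt A k n h, mul_zero, smul_zero]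

theorem evenTerm_of_lt (A : Forms 𝒜) {k n : ℕ} (h : 2 * k + 1 < n) : evenTerm A k n = 0 := by
  rw [evenTerm, oddTerm_of_lt A (by omega), coeff_connPoly_pow_of_lt A _ _ (by omega)]
  simp

theorem remainderForm_mem {A : Forms 𝒜} (hA : A ∈ degree 𝒜 1) (K l : ℕ) :
    remainderForm A K l ∈ degree 𝒜 l := by
  refine Submodule.sum_mem _ fun k _ => Submodule.add_mem _ ?_ ?_
  · split_ifs with h
    · subst h
      exact Submodule.neg_mem _ (Submodule.sum_mem _ fun n _ => oddTerm_mem hA k n)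
    · exact Submodule.zero_mem _
  · split_ifs with h
    · subst h
      exact Submodule.neg_mem _ (Submodule.sum_mem _ fun n _ => evenTerm_mem hA k n)
    · exact Submodule.zero_mem _

/-- A term with `n ≥ K` is nonzero only in degree at least `K + 1`, and `k < K` bounds the degree by
`2K`. So no term is lost; the form in degree `2K + 1` is in fact zero. -/
theorem sum_remainderForm (A : Forms 𝒜) (K : ℕ) :
    ∑ l ∈ Finset.Icc (K + 1) (2 * K + 1), remainderForm A K l =
      -∑ k ∈ Finset.range K, ∑ n ∈ Finset.Ico K (2 * K), (oddTerm A k n + evenTerm A k n) := by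
  simp only [remainderForm]
  rw [Finset.sum_comm, ← Finset.sum_neg_distrib]
  refine Finset.sum_congr rfl fun k hk => ?_
  rw [Finset.mem_range] at hk
  rw [Finset.sum_add_distrib, Finset.sum_ite_eq, Finset.sum_ite_eq, Finset.sum_add_distrib, neg_add]
  congr 1
  · split_ifs with h
    · rfl
    · rw [Finset.sum_eq_zero, neg_zero]
      intro n hn
      rw [Finset.mem_Icc] at h
      rw [Finset.mem_Ico] at hn
      exact oddTerm_of_lt A (by omega)
  · split_ifs with h
    · rfl
    · rw [Finset.sum_eq_zero, neg_zero]
      intro n hn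
      rw [Finset.mem_Icc] at h
      rw [Finset.mem_Ico] at hn
      exact evenTerm_of_lt A (by omega)

theorem formIntegral_eq_of_monomial {n : ℕ} {φ : Cochain 𝒜 n} (hφ : IsHochschildCochain φ)
    {I : Forms 𝒜 →ₗ[ℂ] ℂ} (hI : ∀ v, I (monomial v) = φ v) {x : Forms 𝒜} (hx : x ∈ degree 𝒜 n) :
    formIntegral φ x = I x := by
  have h : Set.EqOn (formIntegral φ) I (degree 𝒜 n) :=
    LinearMap.eqOn_span' fun x ⟨v, hv⟩ => by rw [← hv, (formIntegral_spec hφ).1, hI]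
  exact h hx

theorem chernSimons_mem {A : Forms 𝒜} (hA : A ∈ degree 𝒜 1) (k : ℕ) :
    chernSimons (k + 1) A ∈ degree 𝒜 (2 * k + 1) := by
  rw [chernSimons_eq A k _ (Nat.lt_succ_self _)]
  exact Submodule.sum_mem _ fun n _ => oddTerm_mem hA k n

theorem curvature_pow_mem {A : Forms 𝒜} (hA : A ∈ degree 𝒜 1) (k : ℕ) :
    curvature A ^ k ∈ degree 𝒜 (2 * k) := by
  rw [curvature_pow_eq A k _ (Nat.lt_succ_self _)]
  exact Submodule.sum_mem _ fun n _ => coeff_connPoly_pow_mem hA k n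

namespace WardBracket

variable {M : Type*} [AddCommGroup M] [Module ℂ M] (β : WardBracket 𝒜 M)

theorem expansionTerm_eq (A : Forms 𝒜) (k n : ℕ) :
    β.expansionTerm A k n = β.functional [] (oddTerm A k n + evenTerm A k n) := by
  rw [expansionTerm, oddFunctional_apply, evenTerm, map_add, map_sub, map_smul _ (_ / _ : ℂ)
    (Polynomial.coeff _ _), map_smul _ (1 / 2 : ℂ), smul_eq_mul, smul_eq_mul, oddTerm]
  ring

/-- The expansion of the sum of all powers of a one-form in Chern-Simons and curvature terms. -/
theorem expansion {A : Forms 𝒜} (hA : A ∈ degree 𝒜 1) (hodd : odd A = A) (K : ℕ) :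
    ∑ n ∈ Finset.range K, 1 / ((n : ℂ) + 1) * β.functional [] (LoopForms.mk A ^ (n + 1)).val -
      ∑ k ∈ Finset.range K, (formIntegral (β.oddCochain (2 * k + 1)) (chernSimons (k + 1) A) +
        1 / (2 * ((k : ℂ) + 1)) *
          formIntegral (β.cochain [] (2 * k + 2)) (curvature A ^ (k + 1))) =
    ∑ l ∈ Finset.Icc (K + 1) (2 * K + 1),
      formIntegral (β.cochain [] l) (remainderForm A K l) := by
  have hl : ∀ l, formIntegral (β.cochain [] l) (remainderForm A K l) =
      β.functional [] (remainderForm A K l) := fun l =>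
    formIntegral_eq_of_monomial (β.isHochschildCochain [] l) (β.functional_monomial [])
      (remainderForm_mem hA K l)
  -- For `k < K` all contributions with `n ≥ 2K` vanish, so this range exhausts the Chern-Simons and
  -- curvature terms.
  have hk : ∀ k ∈ Finset.range K,
      formIntegral (β.oddCochain (2 * k + 1)) (chernSimons (k + 1) A) +
        1 / (2 * ((k : ℂ) + 1)) *
          formIntegral (β.cochain [] (2 * k + 2)) (curvature A ^ (k + 1)) =
      ∑ n ∈ Finset.range (2 * K), β.expansionTerm A k n := by
    intro k hk
    rw [Finset.mem_range] at hk
    rw [formIntegral_eq_of_monomial (β.isHochschildCochain_oddCochain _) β.oddFunctional_monomial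
      (chernSimons_mem hA k), formIntegral_eq_of_monomial (β.isHochschildCochain [] _)
      (β.functional_monomial []) (show _ ∈ degree 𝒜 (2 * k + 2) from curvature_pow_mem hA (k + 1)),
      β.sum_expansionTerm_right A (m := 2 * K) (by omega)]
  have hn : ∀ n ∈ Finset.range K,
      1 / ((n : ℂ) + 1) * β.functional [] (LoopForms.mk A ^ (n + 1)).val =
        ∑ k ∈ Finset.range K, β.expansionTerm A k n := fun n hn =>
    (β.sum_expansionTerm_left hodd (Finset.mem_range.1 hn)).symm
  simp only [hl]
  rw [← map_sum, sum_remainderForm, map_neg, map_sum, Finset.sum_congr rfl hk,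
    Finset.sum_congr rfl hn, Finset.sum_comm, ← Finset.sum_sub_distrib, ← Finset.sum_neg_distrib]
  refine Finset.sum_congr rfl fun k _ => ?_
  -- The square `k, n < K` cancels against the sum of the brackets, and the rectangle `K ≤ n < 2K`
  -- is the remainder.
  rw [map_sum, ← Finset.sum_range_add_sum_Ico (fun n => β.expansionTerm A k n)
    (show K ≤ 2 * K by omega)]
  simp only [expansionTerm_eq]
  ring

end WardBracket

theorem sum_of_mul_dOf_mem {r : ℕ} (a b : Fin r → 𝒜) :
    ∑ j, of (a j) * dOf (b j) ∈ degree 𝒜 1 := by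
  refine Submodule.sum_mem _ fun j _ => ?_
  have h : of (a j) * dOf (b j) = monomial ![a j, b j] := by simp [monomial]
  rw [h]
  exact monomial_mem_degree _

theorem odd_sum_of_mul_dOf {r : ℕ} (a b : Fin r → 𝒜) :
    odd (∑ j, of (a j) * dOf (b j)) = ∑ j, of (a j) * dOf (b j) := by
  rw [map_sum]
  refine Finset.sum_congr rfl fun j _ => ?_
  rw [odd_mul, odd_of, odd_dOf]
  simp

end Expansion

/-! ### The cochains of a spectral triple -/

theorem contDiff_deriv_of_contDiff {f : ℝ → ℂ} (hf : ContDiff ℝ (⊤ : ℕ∞) f) :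
    ContDiff ℝ (⊤ : ℕ∞) (deriv f) :=
  (contDiff_infty_iff_deriv.1 hf).2

section OpWard

variable {H : Type*} [NormedAddCommGroup H] [InnerProductSpace ℂ H] [CompleteSpace H]
  {𝒜 : Type*} [Ring 𝒜] [StarRing 𝒜] [Algebra ℂ 𝒜] (T : SpectralTriple 𝒜 H)
  {ι : Type*} [DecidableEq ι] {φ : HilbertBasis ι ℂ H} {f : ℝ → ℂ} {lam : ι → ℝ} {N : ℕ}
  {e : Fin N ↪ ι}
  (hf : ContDiff ℝ (⊤ : ℕ∞) (deriv f))
  (hpos : ∀ k l : Fin N, ∃ s : ℝ, 0 < s ∧ divDiff [lam (e k), lam (e l)] (deriv f) = (s : ℂ))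
  (hφ : ∀ i, ∃ h : φ i ∈ T.D.domain, T.D ⟨φ i, h⟩ = (lam i : ℂ) • φ i)
  (hfin : ∀ x y : 𝒜, IsFiniteMatrix φ (T.rep x * T.comm y))
  (hinv : ∀ (x : 𝒜) (k : Fin N), T.rep x (φ (e k)) ∈ Submodule.span ℂ (Set.range fun l => φ (e l)))

theorem phiN_eq_cochain :
    phiN T φ f lam e = (opWard hf hpos T hφ hfin hinv).cochain [] := by
  funext n v
  cases n with
  | zero => rfl
  | succ n =>
    simp only [phiN, WardBracket.cochain, WardBracket.word, List.nil_append]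
    rw [← List.ofFn_cons]
    refine Eq.trans ?_ (listBracket_ofFn _).symm
    congr 1
    funext j
    exact Fin.cases rfl (fun j => rfl) j

theorem psiN_eq_oddCochain :
    psiN T φ f lam e = (opWard hf hpos T hφ hfin hinv).oddCochain := by
  funext n
  rw [psiN, phiN_eq_cochain T hf hpos hφ hfin hinv]
  rfl

theorem opBracket_const_eq {r : ℕ} (a b : Fin r → 𝒜) (n : ℕ) :
    opBracket φ f lam e (fun _ : Fin (n + 1) => ∑ j, T.rep (a j) * T.comm (b j)) =
      (opWard hf hpos T hφ hfin hinv).functional []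
        (LoopForms.mk (∑ j, Forms.of (a j) * Forms.dOf (b j)) ^ (n + 1)).val := by
  rw [← WardBracket.brk_replicate, ← List.ofFn_const]
  refine Eq.trans ?_ (listBracket_ofFn _).symm
  congr 1
  funext j
  rw [AddSubmonoidClass.coe_finsetSum]
  rfl

end OpWard

end

end OneLoop

/-! ### The theorem -/

theorem mainTheorem4 {𝒜 : Type*} [Ring 𝒜] [StarRing 𝒜] [Algebra ℂ 𝒜] [StarModule ℂ 𝒜]
    {r : ℕ} (a b : Fin r → 𝒜) (A : Forms 𝒜)
    (hA : A = ∑ j, Forms.of (a j) * Forms.dOf (b j)) :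
    ∃ ω : ℕ → ℕ → Forms 𝒜, (∀ K l, ω K l ∈ Forms.degree 𝒜 l) ∧
      ∀ {H : Type*} [NormedAddCommGroup H] [InnerProductSpace ℂ H] [CompleteSpace H]
        (T : SpectralTriple 𝒜 H)
        -- an orthonormal basis of eigenvectors of `D`
        {ι : Type*} [DecidableEq ι] (φ : HilbertBasis ι ℂ H) (lam : ι → ℝ)
        (_ : ∀ i, ∃ h : φ i ∈ T.D.domain, T.D ⟨φ i, h⟩ = (lam i : ℂ) • φ i)
        -- the one-forms `x[D,y]` are finite matrices in this basis
        (_ : ∀ x y : 𝒜, IsFiniteMatrix φ (T.rep x * T.comm y))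
        -- the cutoff: `N` of the basis vectors, whose span is invariant under `𝒜`
        {N : ℕ} (e : Fin N ↪ ι)
        (_ : ∀ (x : 𝒜) (k : Fin N),
          T.rep x (φ (e k)) ∈ Submodule.span ℂ (Set.range fun l => φ (e l)))
        (f : ℝ → ℂ) (_ : ContDiff ℝ (⊤ : ℕ∞) f)
        (_ : ∀ k l : Fin N, ∃ s : ℝ, 0 < s ∧ divDiff [lam (e k), lam (e l)] (deriv f) = (s : ℂ))
        -- the field `V = π_D(A)`
        (V : H →L[ℂ] H) (_ : V = ∑ j, T.rep (a j) * T.comm (b j)),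
        -- the propagator
        (∀ k l m n : Fin N, gaussMean f lam e (fun x => hermitian x k l * hermitian x m n) =
          if k = n ∧ l = m then 1 / divDiff [lam (e k), lam (e l)] (deriv f) else 0) ∧
        -- the sum over diagrams is finite, and amplitudes only depend on the isomorphism class
        (∀ n, Finite (RelevantClass n)) ∧
        (∀ (n m : ℕ) (G G' : NCDiagram n m) (W : Fin n → H →L[ℂ] H), G.Relevant → G.Iso G' →
          (∀ j, IsFiniteMatrix φ (W j)) →
          G.amplitude f lam e (fun j => matrixElt φ (W j)) =
            G'.amplitude f lam e (fun j => matrixElt φ (W j))) ∧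
        -- cyclicity
        (∀ (n : ℕ) (W : Fin n → H →L[ℂ] H), (∀ j, IsFiniteMatrix φ (W j)) →
          opBracket φ f lam e (fun j => W (finRotate n j)) = opBracket φ f lam e W) ∧
        -- the quantum Ward identity
        (∀ (n : ℕ) (W : Fin (n + 1) → H →L[ℂ] H) (x : 𝒜), (∀ j, IsFiniteMatrix φ (W j)) →
          opBracket φ f lam e (Function.update W 0 (T.rep x * W 0)) -
              opBracket φ f lam e
                (Function.update W (Fin.last n) (W (Fin.last n) * T.rep x)) =
            opBracket φ f lam e
              (Fin.snoc (α := fun _ => H →L[ℂ] H) W (T.comm x))) ∧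
        -- the cocycles
        (∀ n, IsHochschildCochain (phiN T φ f lam e n)) ∧
        (∀ n, Even n → opb (phiN T φ f lam e n) = 0) ∧
        IsEvenCocycle (phiN T φ f lam e) ∧
        IsOddCocycle (psiTildeN T φ f lam e) ∧
        -- the asymptotic expansion
        ∀ K : ℕ,
          ∑ n ∈ Finset.Icc 1 K, (1 / (n : ℂ)) * opBracket φ f lam e (fun _ : Fin n => V) -
            ∑ k ∈ Finset.Icc 1 K,
              (formIntegral (psiN T φ f lam e (2 * k - 1)) (chernSimons k A) +
                (1 / (2 * (k : ℂ))) *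
                  formIntegral (phiN T φ f lam e (2 * k)) (curvature A ^ k)) =
          ∑ l ∈ Finset.Icc (K + 1) (2 * K + 1),
            formIntegral (phiN T φ f lam e l) (ω K l) := by
  have hA1 : A ∈ Forms.degree 𝒜 1 := hA ▸ sum_of_mul_dOf_mem a b
  have hA2 : Forms.odd A = A := hA ▸ odd_sum_of_mul_dOf a b
  -- The forms are built from `A` and `K` alone, before any spectral triple is chosen.
  refine ⟨remainderForm A, remainderForm_mem hA1, ?_⟩
  intro H _ _ _ T ι _ φ lam hφ hfin N e hinv f hf₀ hpos V hV
  have hf := contDiff_deriv_of_contDiff hf₀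
  refine ⟨gaussMean_hermitian e hpos, fun n => inferInstance, ?_,
    fun n W hW => opBracket_rotate hf hpos hW,
    fun n W x hW => opBracket_ward hf hpos hφ hfin hinv hW x, ?_⟩
  · intro n m G G' W _ h hW
    obtain ⟨B, hB, hB'⟩ := IsFiniteMatrix.exists_supportedIn hW (Finset.univ.map e)
    exact amplitude_eq_of_iso e hf hpos
      (fun k => hB (Finset.mem_map_of_mem _ (Finset.mem_univ k))) h hB'
  · have hψ : psiTildeN T φ f lam e = fun n =>
        ((-1 : ℂ) ^ (n / 2) * ((n / 2).factorial : ℂ) / (n.factorial : ℂ)) •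
          (opWard hf hpos T hφ hfin hinv).oddCochain n := by
      funext n
      rw [psiTildeN, psiN_eq_oddCochain T hf hpos hφ hfin hinv]
    rw [hψ, phiN_eq_cochain T hf hpos hφ hfin hinv, psiN_eq_oddCochain T hf hpos hφ hfin hinv]
    set β := opWard hf hpos T hφ hfin hinv with hβ
    refine ⟨β.isHochschildCochain [], fun n hn => β.opb_cochain_of_even hn, β.isEvenCocycle,
      β.isOddCocycle, fun K => ?_⟩
    have h1 : ∀ F : ℕ → ℂ, ∑ n ∈ Finset.Icc 1 K, F n = ∑ n ∈ Finset.range K, F (n + 1) := by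
      intro F
      rw [Finset.range_eq_Ico, Finset.sum_Ico_add' F 0 K 1]
      rfl
    rw [h1, h1, ← β.expansion hA1 hA2 K]
    subst hV hA
    congr 1
    · refine Finset.sum_congr rfl fun n _ => ?_
      rw [opBracket_const_eq T hf hpos hφ hfin hinv]
      push_cast
      rfl
    · refine Finset.sum_congr rfl fun k _ => ?_
      push_cast
      rfl
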